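/- **Setting.** Let $G=(V,E)$ be a connected graph on $n$ vertices and $k\ge 2$. At round $0$ each of $k$ agents is placed on a vertex of $G$ uniformly at random, independently; one agent, fixed in advance, is green, the others are white. In every round all agents synchronously make one step of independent simple random walks on $G$ (an agent at $v$ moves to each neighbour of $v$ with probability $1/\deg(v)$). A white agent becomes green when she is at the same vertex as a green agent at the end of some round $t\ge 0$, or when in some round she moves from $u$ to $v$ while a green agent moves from $v$ to $u$. The broadcasting time $\xi(G,k)$ is the first round at the end of which all agents are green. An event (depending on $n$) holds asymptotically almost surely (a.a.s.) if its probability tends to $1$ as $n\to\infty$. **Theorem 1.** Let $G=P_n$ be the path, or $G=C_n$ the cycle, on $n$ vertices, let $k=k(n)\ge 2$ be integers, and let $\omega=\omega(n)$ be any real function with $\omega\to\infty$ as $n\to\infty$. There are absolute constants $c,C>0$ (not depending on $k$, $\omega$ or the choice between paths and cycles) such that the following hold a.a.s. (a) If $k\le\omega$, then $\dfrac{n^2}{\omega^3\ln\omega}\le\xi(G,k)\le n^2\omega$. (b) If $\omega<k\le\omega\ln n$, then $\dfrac{n^2}{\omega k^2\ln k}\le\xi(G,k)\le n^2\omega$.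 (c) If $\omega\ln n<k\le n/\ln^2 n$, then $c\,\dfrac{n^2}{k(\ln k)(\ln n)}\le\xi(G,k)\le C\,\dfrac{n^2\ln n}{k}$. (d) If $n/\ln^2 n<k\le 50n\ln n$, then $c\,n\le\xi(G,k)\le C\,\dfrac{n^2\ln n}{k}$. (e) If $k\ge 50n\ln n$, then $c\,n\le\xi(G,k)\le C\,n$. In any case, if $k=n^{x+o(1)}$ for some $x\in[0,1]$, then there is a deterministic sequence $\delta(n)\to0$ such that a.a.s. $n^{2-\delta(n)}/k\le\xi(G,k)\le n^{2+\delta(n)}/k$ and $n^{2-x-\delta(n)}\le\xi(G,k)\le n^{2-x+\delta(n)}$; that is, $\xi(G,k)=n^{2+o(1)}/k=n^{2-x+o(1)}$. -/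

import Mathlib

open MeasureTheory ProbabilityTheory Filter Topology

noncomputable section

namespace Broadcast

section Walk

variable {V : Type*} [MeasurableSpace V] [DiscreteMeasurableSpace V]

open scoped Classical in
/-- One step of the simple random walk on `G`: from `v`, move to a uniformly random neighbour.
(The walk stays put at a vertex without neighbours or with infinitely many; this never happens
on a finite connected graph with at least two vertices.) -/
def stepMeasure (G : SimpleGraph V) (v : V) : Measure V :=
  if (G.neighborSet v).Finite ∧ (G.neighborSet v).Nonempty
  then uniformOn (G.neighborSet v) else Measure.dirac v

theorem isProbabilityMeasure_stepMeasure (G : SimpleGraph V) (v : V) :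
    IsProbabilityMeasure (stepMeasure G v) := by
  unfold stepMeasure
  split_ifs with h
  · exact isProbabilityMeasure_uniformOn' h.1 h.2 (MeasurableSet.of_discrete)
  · infer_instance

/-- The transition kernel of the simple random walk on `G`. -/
def stepKernel (G : SimpleGraph V) : Kernel V V where
  toFun := stepMeasure G
  measurable' := Measurable.of_discrete

instance (G : SimpleGraph V) : IsMarkovKernel (stepKernel G) :=
  ⟨isProbabilityMeasure_stepMeasure G⟩

/-- The same kernel, as a function of the whole past `(x 0, …, x t)` of the walk: the next
position depends on the current position `x t` only. -/
def pastKernel (G : SimpleGraph V) (t : ℕ) : Kernel (Finset.Iic t → V) V :=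
  (stepKernel G).comap (fun x => x ⟨t, Finset.mem_Iic.2 le_rfl⟩) (measurable_pi_apply _)

instance (G : SimpleGraph V) (t : ℕ) : IsMarkovKernel (pastKernel G t) := by
  unfold pastKernel
  infer_instance

/-- The law, on the space of trajectories `ℕ → V`, of the simple random walk on `G` started from
a uniformly random vertex. -/
def walkLaw (G : SimpleGraph V) : Measure (ℕ → V) :=
  Kernel.trajMeasure (X := fun _ => V) (uniformOn Set.univ) (pastKernel G)

/-- The joint law of the trajectories of `k` agents performing independent simple random walks,
all started from independent uniformly random vertices. The position of agent `i` at the end of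
round `t` is `X i t`. -/
def agentsLaw (G : SimpleGraph V) (k : ℕ) : Measure (Fin k → ℕ → V) :=
  Measure.pi fun _ => walkLaw G

end Walk

section Message

variable {V : Type*} {k : ℕ}

/-- `green X t` is the set of agents that are green at the end of round `t`.
At round `0` these are the agents that start at the vertex of agent `0`, the initial green agent.
In round `t + 1`, first an agent that moves from `u` to `v` becomes green if some green agent
moves from `v` to `u`; then, at the end of the round, an agent becomes green if some green agent
is at the same vertex. -/
def green (X : Fin k → ℕ → V) : ℕ → Set (Fin k)
  | 0 => {i | ∃ j : Fin k, (j : ℕ) = 0 ∧ X i 0 = X j 0}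
  | t + 1 =>
    {i | ∃ j : Fin k, X i (t + 1) = X j (t + 1) ∧
      (j ∈ green X t ∨
        ∃ l ∈ green X t, X l t = X j (t + 1) ∧ X l (t + 1) = X j t)}

/-- The broadcasting time: the first round at the end of which all agents are green
(`⊤` if there is no such round). -/
def broadcastTime (X : Fin k → ℕ → V) : ℕ∞ :=
  ⨅ (t : ℕ) (_ : ∀ i, i ∈ green X t), (t : ℕ∞)

end Message

/-- The time `ξ` is finite and lies between the real numbers `a` and `b`. -/
def Between (a : ℝ) (ξ : ℕ∞) (b : ℝ) : Prop :=
  ∃ t : ℕ, ξ = t ∧ a ≤ t ∧ (t : ℝ) ≤ b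

/-- The broadcasting time `ξ(G n, k n)` satisfies the property `E n` asymptotically almost surely,
that is, with probability tending to `1` as `n → ∞`. -/
def AAS (G : (n : ℕ) → SimpleGraph (Fin n)) (k : ℕ → ℕ) (E : ℕ → ℕ∞ → Prop) : Prop :=
  Tendsto (fun n => agentsLaw (G n) (k n) {X | E n (broadcastTime X)}) atTop (𝓝 1)

end Broadcast

end

open MeasureTheory ProbabilityTheory Filter Topology

noncomputable section

namespace Broadcast

/-! ### Overtaking on the line and the deterministic spread of the colour. -/

section Deterministic

variable {V : Type*} {k : ℕ} {X : Fin k → ℕ → V}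

/-! Path and cycle are both quotients of the integer line to which the simple random walk lifts
(`LineCover`, `LineCover.map_traj`), so an agent is a random start plus a fair ±1 walk. On the line
two agents cannot exchange their order without meeting or swapping along an edge, so a green agent
that passes another one turns her green (`mem_green_of_overtake`).

Upper bounds. With few agents, a white agent is trapped between two consecutive lifts of the initial
green one (`mem_green_of_gap`); she survives a block of order `n ^ 2` steps with probability at most
`29 / 32`, and a union bound over agents finishes. With more agents, somebody who crosses the green
agent to the left and then returns far to her right leaves a green interval of length `2 * L`
(`greenOn_of_double_crossing`). In each later stage of `16 * L ^ 2` steps one agent pushes the right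
end by `L` while another guards the left end (`GreenOn.extend`), so about `2 * n / L` stages fill a
period. A given mover is missing with probability `exp (-c * k * L / n)`; hence `L` of order `n *
log n / k` survives the union bound and the time is of order `n * L`.

Lower bounds. With few agents, all others start too far from the green one to reach her in time
(`eq_of_mem_green_of_isolated`). In the sparse regime, time is cut into windows in which nobody
moves farther than a small multiple of `n / k`. Agents close on that scale form subcritical clusters
of `O(log k)` members, so the colour advances by `O((n / k) * log k)` per window
(`dist_le_of_no_chain`), while some agent is at distance of order `n`. With many agents, speed at
most one suffices.

The walk estimates are a fourth moment bound (`le_coins_real_le_srw`) and an exponential maximal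
inequality (`coins_real_exists_le_abs_srw_le`). For `k = n ^ (x + o(1))`, all regimes agree with `n
^ 2 / k` up to `n ^ o(1)`. -/

theorem green_subset_succ (t : ℕ) : green X t ⊆ green X (t + 1) :=
  fun i hi => ⟨i, rfl, Or.inl hi⟩

theorem green_mono : Monotone (green X) :=
  monotone_nat_of_le_succ green_subset_succ

/-- Agents at the same vertex have the same colour. -/
theorem mem_green_of_eq {t : ℕ} {i j : Fin k} (hj : j ∈ green X t) (h : X i t = X j t) :
    i ∈ green X t := by
  cases t with
  | zero =>
    obtain ⟨l, hl, hjl⟩ := hj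
    exact ⟨l, hl, h.trans hjl⟩
  | succ t =>
    obtain ⟨l, hjl, hl⟩ := hj
    exact ⟨l, h.trans hjl, hl⟩

theorem mem_green_succ_of_swap {t : ℕ} {i l : Fin k} (hl : l ∈ green X t)
    (h₁ : X l t = X i (t + 1)) (h₂ : X l (t + 1) = X i t) : i ∈ green X (t + 1) :=
  ⟨i, rfl, Or.inr ⟨l, hl, h₁, h₂⟩⟩

/-- If every agent is green at time `t`, the broadcasting time is at most `t`. -/
theorem broadcastTime_le {t : ℕ} (h : ∀ i, i ∈ green X t) : broadcastTime X ≤ t :=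
  iInf₂_le t h

theorem lt_broadcastTime {t : ℕ} {i : Fin k} (h : i ∉ green X t) :
    (t : ℕ∞) < broadcastTime X := by
  have : ((t + 1 : ℕ) : ℕ∞) ≤ broadcastTime X := by
    refine le_iInf₂ fun s hs => ?_
    by_contra hlt
    have hst : s ≤ t := by
      have := not_le.1 hlt
      have : s < t + 1 := by exact_mod_cast this
      omega
    exact h (green_mono hst (hs i))
  refine lt_of_lt_of_le ?_ this
  exact_mod_cast Nat.lt_succ_self t

/-- Being white at `t` rules out round `t` itself, so the broadcasting time is at least `t + 1`. The
slack in `ha` later absorbs the rounding of real lower bounds. -/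
theorem between_broadcastTime {t u : ℕ} {a b : ℝ} {i : Fin k} (ha : a ≤ (t : ℝ) + 1)
    (hi : i ∉ green X t) (hu : ∀ j, j ∈ green X u) (hb : (u : ℝ) ≤ b) :
    Between a (broadcastTime X) b := by
  have h1 := lt_broadcastTime hi
  have h2 := broadcastTime_le hu
  obtain ⟨s, hs⟩ := ENat.ne_top_iff_exists.1 (ne_top_of_le_ne_top (ENat.natCast_ne_top u) h2)
  rw [← hs] at h1 h2
  have h1' : t < s := by exact_mod_cast h1
  have h2' : s ≤ u := by exact_mod_cast h2
  refine ⟨s, hs.symm, ha.trans ?_, le_trans ?_ hb⟩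
  · exact_mod_cast h1'
  · exact_mod_cast h2'

/-- A sequence of integers with increments `±1`. -/
def IsNNPath (a : ℕ → ℤ) : Prop := ∀ t, a (t + 1) = a t + 1 ∨ a (t + 1) = a t - 1

theorem IsNNPath.add_const {a : ℕ → ℤ} (ha : IsNNPath a) (c : ℤ) :
    IsNNPath fun t => a t + c := by
  intro t
  rcases ha t with h | h <;> simp only [h] <;> [left; right] <;> ring

theorem IsNNPath.neg {a : ℕ → ℤ} (ha : IsNNPath a) : IsNNPath fun t => - a t := by
  intro t
  rcases ha t with h | h <;> simp only [h] <;> [right; left] <;> ring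

/-- A green agent whose lift overtakes the lift of another agent makes that agent green. -/
theorem mem_green_of_overtake {φ : ℤ → V} {g w : Fin k} {a b : ℕ → ℤ}
    (ha : IsNNPath a) (hb : IsNNPath b) (hga : ∀ t, X g t = φ (a t)) (hwb : ∀ t, X w t = φ (b t))
    {t u : ℕ} (htu : t ≤ u) (hg : g ∈ green X t) (h₁ : a t ≤ b t) (h₂ : b u ≤ a u) :
    w ∈ green X u := by
  induction u, htu using Nat.le_induction with
  | base =>
    exact mem_green_of_eq hg (by rw [hga, hwb, le_antisymm h₁ h₂])
  | succ u htu ih =>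
    by_cases hu : b u ≤ a u
    · exact green_subset_succ u (ih hu)
    · have hgu : g ∈ green X u := green_mono htu hg
      have hgu' : g ∈ green X (u + 1) := green_subset_succ u hgu
      by_cases he : a (u + 1) = b (u + 1)
      · exact mem_green_of_eq hgu' (by rw [hga, hwb, he])
      -- The difference `b - a` was at least 1, is now at most -1 and changes by at most 2: the two
      -- agents cross the same edge in opposite directions.
      · have e₁ : a u = b (u + 1) := by rcases ha u with h | h <;> rcases hb u with h' | h' <;> omega
        have e₂ : a (u + 1) = b u := by rcases ha u with h | h <;> rcases hb u with h' | h' <;> omega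
        exact mem_green_succ_of_swap hgu (by rw [hga, hwb, e₁]) (by rw [hga, hwb, e₂])

/-- Reflecting the line exchanges left and right, and the projection `φ` is arbitrary. -/
theorem mem_green_of_overtake' {φ : ℤ → V} {g w : Fin k} {a b : ℕ → ℤ}
    (ha : IsNNPath a) (hb : IsNNPath b) (hga : ∀ t, X g t = φ (a t)) (hwb : ∀ t, X w t = φ (b t))
    {t u : ℕ} (htu : t ≤ u) (hg : g ∈ green X t) (h₁ : b t ≤ a t) (h₂ : a u ≤ b u) :
    w ∈ green X u :=
  mem_green_of_overtake (φ := fun z => φ (-z)) ha.neg hb.neg (by simpa using hga)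
    (by simpa using hwb) htu hg (neg_le_neg h₁) (neg_le_neg h₂)

/-- If two green agents exchange their order, everybody who ends between them is green. -/
theorem mem_green_of_exchange {φ : ℤ → V} {g h w : Fin k} {a b c : ℕ → ℤ}
    (ha : IsNNPath a) (hb : IsNNPath b) (hc : IsNNPath c)
    (hga : ∀ t, X g t = φ (a t)) (hhb : ∀ t, X h t = φ (b t)) (hwc : ∀ t, X w t = φ (c t))
    {t u : ℕ} (htu : t ≤ u) (hg : g ∈ green X t) (hh : h ∈ green X t)
    (h₁ : b t ≤ a t) (h₂ : a u ≤ c u) (h₃ : c u ≤ b u) : w ∈ green X u := by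
  rcases le_total (c t) (a t) with h | h
  · exact mem_green_of_overtake' ha hc hga hwc htu hg h h₂
  · exact mem_green_of_overtake hb hc hhb hwc htu hh (h₁.trans h) h₃

/-- All agents with a lift in `[a, b)` are green at time `t`. The lifts of agent `i` are the
translates of `Z i` by multiples of `N`. -/
def GreenOn (X : Fin k → ℕ → V) (Z : Fin k → ℕ → ℤ) (N : ℤ) (t : ℕ) (a b : ℤ) : Prop :=
  ∀ i, ∀ q : ℤ, a ≤ Z i t + q * N → Z i t + q * N < b → i ∈ green X t

section Lift

variable {φ : ℤ → V} {Z : Fin k → ℕ → ℤ} {N : ℤ}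

theorem lift_eq (hφ : ∀ z, φ (z + N) = φ z) (z q : ℤ) : φ (z + q * N) = φ z := by
  have : Function.Periodic φ N := hφ
  simpa using this.int_mul q z

theorem GreenOn.all_green {t : ℕ} {a b : ℤ} (h : GreenOn X Z N t a b) (hN : 0 < N)
    (hab : a + N ≤ b) (i : Fin k) : i ∈ green X t := by
  have h1 := Int.emod_nonneg (Z i t - a) hN.ne'
  have h2 := Int.emod_lt_of_pos (Z i t - a) hN
  have h3 := Int.mul_ediv_add_emod (Z i t - a) N
  refine h i (-((Z i t - a) / N)) ?_ ?_ <;> nlinarith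

/-- An agent found in `[a, b + L)` at time `u` was in `[a, b)` at time `t`, or was at or beyond `b`
and has been passed by the right mover, or was below `a` and has been passed by the left mover.
Since `a + L ≤ b`, both movers start inside the green interval. -/
theorem GreenOn.extend (hZ : ∀ i, IsNNPath (Z i)) (hX : ∀ i t, X i t = φ (Z i t))
    (hφ : ∀ z, φ (z + N) = φ z) {t u : ℕ} (htu : t ≤ u) {a b L : ℤ}
    (hab : a + L ≤ b) (h : GreenOn X Z N t a b)
    (hr : ∃ i, ∃ q : ℤ, b - L ≤ Z i t + q * N ∧ Z i t + q * N < b ∧ b + L ≤ Z i u + q * N)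
    (hl : ∃ i, ∃ q : ℤ, a ≤ Z i t + q * N ∧ Z i t + q * N < a + L ∧ Z i u + q * N ≤ a) :
    GreenOn X Z N u a (b + L) := by
  have key : ∀ i (q : ℤ), IsNNPath (fun t => Z i t + q * N) ∧
      ∀ t, X i t = φ (Z i t + q * N) := fun i q =>
    ⟨(hZ i).add_const _, fun t => by rw [lift_eq hφ, hX]⟩
  obtain ⟨r, qr, hr1, hr2, hr3⟩ := hr
  obtain ⟨l, ql, hl1, hl2, hl3⟩ := hl
  have hrg : r ∈ green X t := h r qr (by omega) hr2
  have hlg : l ∈ green X t := h l ql hl1 (by omega)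
  intro w q hw1 hw2
  by_cases h1 : Z w t + q * N < a
  · exact mem_green_of_overtake' (key l ql).1 (key w q).1 (key l ql).2 (key w q).2 htu hlg
      (by omega) (by omega)
  by_cases h2 : b ≤ Z w t + q * N
  · exact mem_green_of_overtake (key r qr).1 (key w q).1 (key r qr).2 (key w q).2 htu hrg
      (by omega) (by omega)
  · exact green_mono htu (h w q (by omega) (by omega))

/-- An agent that starts to the right of a green agent, is then seen on its left, and later
far away on its right, leaves an interval of green agents between the two. -/
theorem greenOn_of_double_crossing (hZ : ∀ i, IsNNPath (Z i)) (hX : ∀ i t, X i t = φ (Z i t))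
    (hφ : ∀ z, φ (z + N) = φ z) {t u v : ℕ} (htu : t ≤ u) (huv : u ≤ v) {g h : Fin k} {q L : ℤ}
    (hg : g ∈ green X t) (h₁ : Z g t ≤ Z h t + q * N) (h₂ : Z h u + q * N ≤ Z g u)
    (h₃ : Z g v + L ≤ Z h v + q * N) : GreenOn X Z N v (Z g v) (Z g v + L) := by
  have key : ∀ i (q : ℤ), IsNNPath (fun t => Z i t + q * N) ∧
      ∀ t, X i t = φ (Z i t + q * N) := fun i q =>
    ⟨(hZ i).add_const _, fun t => by rw [lift_eq hφ, hX]⟩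
  have hh : h ∈ green X u := mem_green_of_overtake (hZ g) (key h q).1 (hX g) (key h q).2 htu hg
    h₁ h₂
  intro w q' hw1 hw2
  exact mem_green_of_exchange (hZ g) (key h q).1 (key w q').1 (hX g) (key h q).2 (key w q').2 huv
    (green_mono htu hg) hh h₂ hw1 (by omega)

/-- Consecutive lifts of the green agent act as walls: touching either one turns the white agent
green. Her increment over any block of time therefore differs from that of the green agent by less
than `N`. -/
theorem mem_green_of_gap (hZ : ∀ i, IsNNPath (Z i)) (hX : ∀ i t, X i t = φ (Z i t))
    (hφ : ∀ z, φ (z + N) = φ z) (hN : 0 < N) {t u : ℕ} (_ : t ≤ u) {g h : Fin k}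
    (hg : g ∈ green X t) (hh : h ∉ green X u) :
    ∃ q : ℤ, ∀ s, t ≤ s → s ≤ u → Z g s < Z h s + q * N ∧ Z h s + q * N < Z g s + N := by
  have key : ∀ i (q : ℤ), IsNNPath (fun t => Z i t + q * N) ∧
      ∀ t, X i t = φ (Z i t + q * N) := fun i q =>
    ⟨(hZ i).add_const _, fun t => by rw [lift_eq hφ, hX]⟩
  have h1 := Int.emod_nonneg (Z h t - Z g t) hN.ne'
  have h2 := Int.emod_lt_of_pos (Z h t - Z g t) hN
  have h3 := Int.mul_ediv_add_emod (Z h t - Z g t) N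
  refine ⟨-((Z h t - Z g t) / N), fun s hs1 hs2 => ⟨?_, ?_⟩⟩
  · by_contra hlt
    exact hh (green_mono hs2 (mem_green_of_overtake (hZ g) (key h _).1 (hX g) (key h _).2 hs1 hg
      (by nlinarith) (not_lt.1 hlt)))
  · by_contra hlt
    exact hh (green_mono hs2 (mem_green_of_overtake' (hZ g) (key h (-((Z h t - Z g t) / N) - 1)).1
      (hX g) (key h _).2 hs1 hg (by nlinarith) (by nlinarith)))

end Lift

/-! ### Finite speed and clusters of nearby agents. -/

section Speed

variable {G : SimpleGraph V}

/-- Information travels at speed at most one. -/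
theorem dist_le_of_mem_green (hG : G.Connected) (hX : ∀ i t, G.dist (X i t) (X i (t + 1)) ≤ 1)
    {o : Fin k} (ho : (o : ℕ) = 0) {t : ℕ} {i : Fin k} (hi : i ∈ green X t) :
    G.dist (X o 0) (X i t) ≤ t := by
  induction t generalizing i with
  | zero =>
    obtain ⟨j, hj, hij⟩ := hi
    have : j = o := Fin.ext (hj.trans ho.symm)
    simp [hij, this]
  | succ t ih =>
    obtain ⟨j, hij, hj | ⟨l, hl, h1, -⟩⟩ := hi
    · rw [hij]
      exact (hG.dist_triangle (v := X j t)).trans (add_le_add (ih hj) (hX j t))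
    · rw [hij, ← h1]
      exact (ih hl).trans (Nat.le_succ t)

/-- The graph on agents where two agents are adjacent if they are close to each other at time
`t`. -/
def closeGraph (G : SimpleGraph V) (X : Fin k → ℕ → V) (t r : ℕ) : SimpleGraph (Fin k) :=
  SimpleGraph.fromRel fun i j => G.dist (X i t) (X j t) ≤ r

theorem closeGraph_adj {t r : ℕ} {i j : Fin k} :
    (closeGraph G X t r).Adj i j ↔ i ≠ j ∧ G.dist (X i t) (X j t) ≤ r := by
  simp only [closeGraph, SimpleGraph.fromRel_adj]
  rw [SimpleGraph.dist_comm (u := X j t), or_self]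

/-- If every agent stays close to her position at time `t`, colour only spreads within the
connected components of `closeGraph`. -/
theorem exists_reachable_of_mem_green (hG : G.Connected) {t u d : ℕ}
    (hX : ∀ i, ∀ s, t ≤ s → s ≤ u → G.dist (X i t) (X i s) ≤ d) {s : ℕ} (hts : t ≤ s) (hsu : s ≤ u)
    {i : Fin k} (hi : i ∈ green X s) :
    ∃ l ∈ green X t, (closeGraph G X t (2 * d)).Reachable l i := by
  have close : ∀ {i j : Fin k} {v : V}, G.dist (X i t) v ≤ d → G.dist (X j t) v ≤ d →
      (closeGraph G X t (2 * d)).Reachable i j := by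
    intro i j v h1 h2
    by_cases hij : i = j
    · rw [hij]
    · refine SimpleGraph.Adj.reachable (closeGraph_adj.2 ⟨hij, ?_⟩)
      refine (hG.dist_triangle (v := v)).trans ?_
      rw [SimpleGraph.dist_comm (u := v)]
      omega
  induction s, hts using Nat.le_induction generalizing i with
  | base => exact ⟨i, hi, SimpleGraph.Reachable.refl i⟩
  | succ s hts ih =>
    obtain ⟨j, hij, hj | ⟨l, hl, h1, -⟩⟩ := hi
    · obtain ⟨m, hm, hmj⟩ := ih (by omega) hj
      exact ⟨m, hm, hmj.trans (close (hX j (s + 1) (by omega) hsu)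
        (by rw [← hij]; exact hX i (s + 1) (by omega) hsu))⟩
    · obtain ⟨m, hm, hml⟩ := ih (by omega) hl
      refine ⟨m, hm, hml.trans (close (hX l s hts (by omega)) ?_)⟩
      rw [h1, ← hij]
      exact hX i (s + 1) (by omega) hsu

/-- If close agents never form a chain of `m + 1` distinct agents, then during a window in which
nobody moves by more than `d` the colour advances by at most `(2 * m + 1) * d`. -/
theorem dist_le_of_no_chain (hG : G.Connected) {t u d m R : ℕ} (htu : t ≤ u)
    (hX : ∀ i, ∀ s, t ≤ s → s ≤ u → G.dist (X i t) (X i s) ≤ d)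
    (hc : ∀ f : Fin (m + 1) → Fin k, Function.Injective f →
      ∃ l : Fin m, 2 * d < G.dist (X (f l.castSucc) t) (X (f l.succ) t))
    {x : V} (hR : ∀ i ∈ green X t, G.dist x (X i t) ≤ R) :
    ∀ i ∈ green X u, G.dist x (X i u) ≤ R + (2 * m + 1) * d := by
  intro i hi
  obtain ⟨l, hl, hli⟩ := exists_reachable_of_mem_green hG hX htu le_rfl hi
  obtain ⟨p, hp⟩ := hli.exists_isPath
  -- A path with at least `m` edges would list `m + 1` distinct, consecutively close agents, which
  -- `hc` forbids. The advance is then at most `2 * d` per edge, plus `d` for the last agent's own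
  -- displacement.
  have hlen : p.length < m := by
    by_contra hm
    push Not at hm
    obtain ⟨j, hj⟩ := hc (fun j => p.getVert j) (by
      intro a b hab
      have := hp.getVert_injOn (by simp; omega) (by simp; omega) hab
      exact Fin.ext this)
    have := closeGraph_adj.1 (p.adj_getVert_succ (i := (j : ℕ)) (by omega))
    simp only [Fin.val_castSucc, Fin.val_succ] at hj
    omega
  have hwalk : ∀ {a b : Fin k} (p : (closeGraph G X t (2 * d)).Walk a b),
      G.dist (X a t) (X b t) ≤ 2 * d * p.length := by
    intro a b p
    induction p with
    | nil => simp
    | cons h p ih =>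
      rw [SimpleGraph.Walk.length_cons]
      have h1 := (closeGraph_adj.1 h).2
      refine (hG.dist_triangle).trans ((add_le_add h1 ih).trans ?_)
      rw [mul_add]
      omega
  have h1 := hwalk p
  have h2 := hR l hl
  have h3 := hX i u htu le_rfl
  have h4 : 2 * d * p.length ≤ 2 * d * m := Nat.mul_le_mul_left _ hlen.le
  calc G.dist x (X i u) ≤ G.dist x (X l t) + G.dist (X l t) (X i u) := hG.dist_triangle
    _ ≤ G.dist x (X l t) + (G.dist (X l t) (X i t) + G.dist (X i t) (X i u)) := by
      gcongr; exact hG.dist_triangle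
    _ ≤ R + (2 * d * m + d) := by omega
    _ = R + (2 * m + 1) * d := by ring

/-- If nobody is close to the initial green agent, she meets nobody for a while. -/
theorem eq_of_mem_green_of_isolated (hG : G.Connected) {u d : ℕ}
    (hX : ∀ i, ∀ s ≤ u, G.dist (X i 0) (X i s) ≤ d) {o : Fin k} (ho : (o : ℕ) = 0)
    (hc : ∀ i, i ≠ o → 2 * d < G.dist (X o 0) (X i 0)) {i : Fin k} (hi : i ∈ green X u) :
    i = o := by
  have hiso : ∀ i, (closeGraph G X 0 (2 * d)).Reachable o i → i = o := by
    rintro i ⟨p⟩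
    cases p with
    | nil => rfl
    | cons h p =>
      have h1 := closeGraph_adj.1 h
      have h2 := hc _ h1.1.symm
      omega
  obtain ⟨l, ⟨j, hj, hlj⟩, hli⟩ := exists_reachable_of_mem_green hG (fun i s _ hs => hX i s hs)
    (Nat.zero_le u) le_rfl hi
  have hjo : j = o := Fin.ext (hj.trans ho.symm)
  subst hjo
  have hlo : l = j := by
    by_contra hne
    have := hc l hne
    rw [hlj] at this
    simp at this
  exact hiso i (hlo ▸ hli)

end Speed

end Deterministic

/-! ### Fair coins and estimates for the simple random walk on the integers. -/

section SimpleRandomWalk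

/-- A fair coin. -/
def coin : Measure Bool := uniformOn Set.univ

instance : IsProbabilityMeasure coin :=
  isProbabilityMeasure_uniformOn Set.finite_univ Set.univ_nonempty

theorem coin_real_singleton (b : Bool) : coin.real {b} = 1 / 2 := by
  rw [coin, measureReal_def, uniformOn_univ]
  simp

/-- The law of an infinite sequence of independent fair coins. -/
def coins : Measure (ℕ → Bool) := Measure.infinitePi fun _ => coin

instance : IsProbabilityMeasure coins := by
  unfold coins
  infer_instance

def consSeq (b : Bool) (e : ℕ → Bool) : ℕ → Bool
  | 0 => b
  | i + 1 => e i

def shiftSeq (t : ℕ) (e : ℕ → Bool) : ℕ → Bool := fun i => e (t + i)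

/-- The step encoded by a coin. -/
def sgn (b : Bool) : ℤ := if b then 1 else -1

/-- The simple random walk on `ℤ` started at `0`. -/
def srw (e : ℕ → Bool) (t : ℕ) : ℤ := ∑ i ∈ Finset.range t, sgn (e i)

theorem measurable_consSeq : Measurable fun p : Bool × (ℕ → Bool) => consSeq p.1 p.2 := by
  refine measurable_pi_iff.2 fun i => ?_
  cases i with
  | zero => exact measurable_fst
  | succ i => exact (measurable_pi_apply i).comp measurable_snd

theorem measurable_shiftSeq (t : ℕ) : Measurable (shiftSeq t) :=
  measurable_pi_iff.2 fun i => measurable_pi_apply (t + i)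

theorem measurable_srw (t : ℕ) : Measurable fun e => srw e t :=
  Finset.measurable_fun_sum _ fun i _ =>
    (Measurable.of_discrete (f := sgn)).comp (measurable_pi_apply i)

@[simp] theorem srw_zero (e : ℕ → Bool) : srw e 0 = 0 := rfl

theorem srw_succ (e : ℕ → Bool) (t : ℕ) : srw e (t + 1) = srw e t + sgn (e t) :=
  Finset.sum_range_succ _ _

theorem srw_add (e : ℕ → Bool) (t s : ℕ) : srw e (t + s) = srw e t + srw (shiftSeq t e) s :=
  Finset.sum_range_add _ _ _

theorem srw_consSeq_succ (b : Bool) (e : ℕ → Bool) (t : ℕ) :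
    srw (consSeq b e) (t + 1) = sgn b + srw e t := by
  rw [srw, Finset.sum_range_succ', add_comm]
  rfl

theorem shiftSeq_consSeq_succ (b : Bool) (e : ℕ → Bool) (t : ℕ) :
    shiftSeq (t + 1) (consSeq b e) = shiftSeq t e := by
  funext i
  simp only [shiftSeq, Nat.add_right_comm t 1 i, consSeq]

theorem shiftSeq_shiftSeq (s t : ℕ) (e : ℕ → Bool) :
    shiftSeq s (shiftSeq t e) = shiftSeq (t + s) e := by
  funext i
  simp only [shiftSeq, add_assoc]

theorem isNNPath_srw (e : ℕ → Bool) : IsNNPath (srw e) := by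
  intro t
  rw [srw_succ]
  cases e t <;> simp [sgn, sub_eq_add_neg]

/-- Checked on cylinders: padding the index set to an initial segment with full factors lets the
zeroth coin split off. All conditioning on the first step rests on this. -/
theorem map_consSeq : (coin.prod coins).map (fun p => consSeq p.1 p.2) = coins := by
  refine Measure.eq_infinitePi _ fun s t ht => ?_
  classical
  obtain ⟨N, hN⟩ : ∃ N, s ⊆ Finset.range (N + 1) := by
    obtain ⟨N, hN⟩ := s.exists_nat_subset_range
    exact ⟨N, hN.trans (Finset.range_mono (Nat.le_succ N))⟩
  set t' : ℕ → Set Bool := fun i => if i ∈ s then t i else Set.univ with ht'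
  have hprod : ∏ i ∈ s, coin (t i) = ∏ i ∈ Finset.range (N + 1), coin (t' i) := by
    rw [← Finset.prod_subset hN (fun i _ hi => by simp only [ht', hi, if_false, measure_univ])]
    exact Finset.prod_congr rfl fun i hi => by simp [ht', hi]
  have hset : (fun p : Bool × (ℕ → Bool) => consSeq p.1 p.2) ⁻¹' (s : Set ℕ).pi t =
      t' 0 ×ˢ ((Finset.range N : Finset ℕ) : Set ℕ).pi fun i => t' (i + 1) := by
    ext ⟨b, e⟩
    simp only [Set.mem_preimage, Set.mem_pi, Set.mem_prod, Finset.mem_coe, Finset.mem_range, ht']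
    constructor
    · intro h
      refine ⟨?_, fun i _ => ?_⟩
      · split_ifs with h0
        · exact h 0 h0
        · trivial
      · split_ifs with h0
        · exact h (i + 1) h0
        · trivial
    · rintro ⟨h0, h1⟩ i hi
      cases i with
      | zero => rwa [if_pos hi] at h0
      | succ i =>
        have := h1 i (by have := Finset.mem_range.1 (hN hi); omega)
        rwa [if_pos hi] at this
  rw [Measure.map_apply measurable_consSeq (MeasurableSet.pi s.countable_toSet fun i _ => ht i),
    hset, Measure.prod_prod, coins, Measure.infinitePi_pi _ (fun i _ => .of_discrete), hprod,
    Finset.prod_range_succ', mul_comm]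

/-- Conditioning on the first coin. -/
theorem coins_real_eq {A : Set (ℕ → Bool)} (hA : MeasurableSet A) :
    coins.real A = (coins.real {e | consSeq true e ∈ A} + coins.real {e | consSeq false e ∈ A}) / 2 := by
  have h1 : coins A = ∑ b : Bool, coin {b} * coins {e | consSeq b e ∈ A} := by
    conv_lhs => rw [← map_consSeq]
    rw [Measure.map_apply measurable_consSeq hA, Measure.prod_apply (measurable_consSeq hA),
      lintegral_fintype]
    exact Finset.sum_congr rfl fun b _ => mul_comm _ _
  rw [measureReal_def, h1, Fintype.sum_bool, ENNReal.toReal_add (by finiteness) (by finiteness),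
    ENNReal.toReal_mul, ENNReal.toReal_mul]
  simp only [← measureReal_def, coin_real_singleton]
  ring

/-- The Markov property at a fixed time, by induction on `s`: conditioning on the first coin
translates `A` by its sign and leaves `B` alone. -/
theorem coins_real_srw_and_shiftSeq (s : ℕ) (A : Set ℤ) {B : Set (ℕ → Bool)}
    (hB : MeasurableSet B) :
    coins.real {e | srw e s ∈ A ∧ shiftSeq s e ∈ B} =
      coins.real {e | srw e s ∈ A} * coins.real B := by
  induction s generalizing A with
  | zero =>
    by_cases h : (0 : ℤ) ∈ A
    · have : ∀ e : ℕ → Bool, shiftSeq 0 e = e := fun e => by funext i; simp [shiftSeq]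
      simp [h, this]
    · simp [h]
  | succ s ih =>
    have hm : ∀ t, MeasurableSet {e | srw e t ∈ A} := fun t => measurable_srw t .of_discrete
    have hm' : MeasurableSet {e | srw e (s + 1) ∈ A ∧ shiftSeq (s + 1) e ∈ B} :=
      (hm _).inter (measurable_shiftSeq _ hB)
    rw [coins_real_eq hm', coins_real_eq (hm _)]
    simp only [Set.mem_ofPred_eq, srw_consSeq_succ, shiftSeq_consSeq_succ]
    have h1 := ih {z | sgn true + z ∈ A}
    have h2 := ih {z | sgn false + z ∈ A}
    simp only [Set.mem_ofPred_eq] at h1 h2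
    rw [h1, h2]
    ring

theorem coins_real_shiftSeq (s : ℕ) {B : Set (ℕ → Bool)} (hB : MeasurableSet B) :
    coins.real {e | shiftSeq s e ∈ B} = coins.real B := by
  simpa using coins_real_srw_and_shiftSeq s Set.univ hB

/-- Increments of the walk over disjoint blocks of equal length are independent. -/
theorem coins_real_blocks (s M : ℕ) (B : ℕ → Set ℤ) :
    coins.real {e | ∀ j < M, srw e ((j + 1) * s) - srw e (j * s) ∈ B j} =
      ∏ j ∈ Finset.range M, coins.real {e | srw e s ∈ B j} := by
  have hincr : ∀ (e : ℕ → Bool) j, srw e ((j + 1) * s) - srw e (j * s) =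
      srw (shiftSeq (j * s) e) s := by
    intro e j
    rw [add_mul, one_mul, srw_add, add_sub_cancel_left]
  simp only [hincr]
  induction M generalizing B with
  | zero => simp
  | succ M ih =>
    have hm : MeasurableSet {e | ∀ j < M, srw (shiftSeq (j * s) e) s ∈ B (j + 1)} := by
      simp only [Set.ofPred_forall]
      exact MeasurableSet.iInter fun j => MeasurableSet.iInter fun _ =>
        (measurable_srw s).comp (measurable_shiftSeq _) .of_discrete
    have hset : {e | ∀ j < M + 1, srw (shiftSeq (j * s) e) s ∈ B j} =
        {e | srw e s ∈ B 0 ∧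
          shiftSeq s e ∈ {e | ∀ j < M, srw (shiftSeq (j * s) e) s ∈ B (j + 1)}} := by
      ext e
      have h0 : shiftSeq (0 * s) e = e := by funext i; simp [shiftSeq]
      have h1 : ∀ j, shiftSeq (j * s) (shiftSeq s e) = shiftSeq ((j + 1) * s) e := fun j => by
        rw [shiftSeq_shiftSeq, add_mul, one_mul, add_comm]
      simp only [Set.mem_ofPred_eq, h1]
      constructor
      · exact fun h => ⟨h0 ▸ h 0 (Nat.succ_pos M), fun j hj => h (j + 1) (by omega)⟩
      · rintro ⟨h, h'⟩ j hj
        cases j with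
        | zero => rwa [h0]
        | succ j => exact h' j (by omega)
    rw [hset, coins_real_srw_and_shiftSeq s _ hm, ih, Finset.prod_range_succ', mul_comm]

/-- Averaging over the two neighbours of an integer. -/
def stepAvg (f : ℤ → ℝ) (x : ℤ) : ℝ := (f (x + 1) + f (x - 1)) / 2

theorem stepAvg_iterate_mono {f g : ℤ → ℝ} (h : ∀ x, f x ≤ g x) (s : ℕ) (x : ℤ) :
    stepAvg^[s] f x ≤ stepAvg^[s] g x := by
  induction s generalizing x with
  | zero => exact h x
  | succ s ih =>
    rw [Function.iterate_succ_apply', Function.iterate_succ_apply', stepAvg, stepAvg]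
    linarith [ih (x + 1), ih (x - 1)]

/-- Probabilities become iterates of a monotone averaging operator, so moment bounds can be read off
from test functions dominated by an indicator. -/
theorem coins_real_srw (s : ℕ) (A : Set ℤ) (x : ℤ) :
    coins.real {e | x + srw e s ∈ A} = stepAvg^[s] (A.indicator 1) x := by
  induction s generalizing x with
  | zero =>
    by_cases h : x ∈ A <;> simp [h]
  | succ s ih =>
    have hm : MeasurableSet {e | x + srw e (s + 1) ∈ A} :=
      (measurable_srw (s + 1)).const_add x .of_discrete
    rw [coins_real_eq hm, Function.iterate_succ_apply', stepAvg, ← ih, ← ih]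
    simp only [Set.mem_ofPred_eq, srw_consSeq_succ, sgn, ← add_assoc, if_true, Bool.false_eq_true,
      if_false, sub_eq_add_neg]

theorem stepAvg_iterate_comp_neg (f : ℤ → ℝ) (s : ℕ) (x : ℤ) :
    stepAvg^[s] (fun x => f (-x)) x = stepAvg^[s] f (-x) := by
  induction s generalizing x with
  | zero => rfl
  | succ s ih =>
    rw [Function.iterate_succ_apply', Function.iterate_succ_apply', stepAvg, stepAvg, ih, ih,
      add_comm, neg_sub, neg_add, sub_eq_add_neg, add_comm 1 (-x), ← sub_eq_add_neg]

theorem coins_real_neg_srw (s : ℕ) (A : Set ℤ) :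
    coins.real {e | - srw e s ∈ A} = coins.real {e | srw e s ∈ A} := by
  have h1 := coins_real_srw s {z | -z ∈ A} 0
  have h2 := coins_real_srw s A 0
  simp only [zero_add] at h1 h2
  rw [h2]
  refine h1.trans ?_
  have : (Set.indicator {z : ℤ | -z ∈ A} (1 : ℤ → ℝ)) = fun x => A.indicator 1 (-x) := by
    funext x
    by_cases h : -x ∈ A <;> simp [h]
  rw [this, stepAvg_iterate_comp_neg, neg_zero]

/-- The second and fourth moments of the walk started at `x`, packaged for the test function used
next. -/
theorem stepAvg_iterate_quartic (a b c : ℝ) (s : ℕ) (x : ℤ) :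
    stepAvg^[s] (fun x => a * (x : ℝ) ^ 2 - b * (x : ℝ) ^ 4 - c) x =
      a * ((x : ℝ) ^ 2 + s) - b * ((x : ℝ) ^ 4 + 6 * s * (x : ℝ) ^ 2 + 3 * (s : ℝ) ^ 2 - 2 * s) - c := by
  induction s generalizing x with
  | zero => simp
  | succ s ih =>
    rw [Function.iterate_succ_apply', stepAvg, ih, ih]
    push_cast
    ring

/-- With probability bounded from below, the walk has moved to the right by half a standard
deviation. -/
theorem le_coins_real_le_srw (L : ℕ) (hL : 0 < L) :
    3 / 32 ≤ coins.real {e | 2 * (L : ℤ) ≤ srw e (16 * L ^ 2)} := by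
  set s := 16 * L ^ 2 with hs
  have hL' : (0 : ℝ) < L := by exact_mod_cast hL
  have habs : 3 / 16 ≤ coins.real {e | srw e s ∈ {z : ℤ | 2 * (L : ℤ) ≤ |z|}} := by
    have h1 := coins_real_srw s {z : ℤ | 2 * (L : ℤ) ≤ |z|} 0
    simp only [zero_add] at h1
    rw [h1]
    -- With `y = a * x ^ 2`, the function `y - y ^ 2 / 4 - 1 / 8` is at most 1 everywhere and at
    -- most 0 for `y ≤ 1 / 8`, that is, `|x| ≤ 2 * L`. Its mean at time `16 * L ^ 2` is at least `1
    -- / 2 - 3 / 16 - 1 / 8 = 3 / 16`; symmetry then halves this.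
    set a : ℝ := 1 / (32 * (L : ℝ) ^ 2)
    have ha : a * (L : ℝ) ^ 2 = 1 / 32 := by simp only [a]; field_simp
    have h2 := stepAvg_iterate_mono (f := fun x => a * (x : ℝ) ^ 2 - a ^ 2 / 4 * (x : ℝ) ^ 4 -
      1 / 8) (g := Set.indicator {z : ℤ | 2 * (L : ℤ) ≤ |z|} 1) (fun x => ?_) s 0
    · refine le_trans ?_ h2
      rw [stepAvg_iterate_quartic, hs]
      push_cast
      have h3 : a ^ 2 * (L : ℝ) ^ 4 = (1 / 32) ^ 2 := by rw [← ha]; ring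
      have h4 : 0 ≤ a ^ 2 * (L : ℝ) ^ 2 := by positivity
      nlinarith
    · by_cases hx : 2 * (L : ℤ) ≤ |x|
      · simp only [Set.indicator, Set.mem_ofPred_eq, hx, if_true, Pi.one_apply]
        nlinarith [sq_nonneg (a * (x : ℝ) ^ 2 - 2)]
      · simp only [Set.indicator, Set.mem_ofPred_eq, hx, if_false]
        have h3 : |(x : ℝ)| < 2 * L := by
          rw [not_le] at hx
          exact_mod_cast hx
        have h4 : (x : ℝ) ^ 2 ≤ (2 * L) ^ 2 := sq_le_sq' (by linarith [(abs_lt.1 h3).1])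
          (abs_lt.1 h3).2.le
        have h5 : 0 ≤ a := by positivity
        nlinarith [mul_le_mul_of_nonneg_left h4 h5, sq_nonneg (a * (x : ℝ) ^ 2)]
  have hsub : {e : ℕ → Bool | srw e s ∈ {z : ℤ | 2 * (L : ℤ) ≤ |z|}} ⊆
      {e | srw e s ∈ {z | 2 * (L : ℤ) ≤ z}} ∪ {e | - srw e s ∈ {z | 2 * (L : ℤ) ≤ z}} := by
    intro e he
    simp only [Set.mem_ofPred_eq, Set.mem_union] at he ⊢
    exact le_abs.1 he
  have h1 := (measureReal_mono hsub).trans (measureReal_union_le (μ := coins) _ _)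
  rw [coins_real_neg_srw] at h1
  simp only [Set.mem_ofPred_eq] at h1 habs
  linarith

/-- Doob's maximal inequality for the exponential martingale, by induction on the first step; once
`d ≤ x` the right side is at least 1. The sign `σ` serves both tails. -/
theorem coins_real_exists_le_srw_le (σ : Bool) (s : ℕ) (x d : ℤ) {lam : ℝ} (hlam : 0 ≤ lam) :
    coins.real {e | ∃ u ≤ s, d ≤ x + sgn σ * srw e u} ≤
      Real.exp (lam * (x - d)) * Real.cosh lam ^ s := by
  induction s generalizing x with
  | zero =>
    by_cases h : d ≤ x
    · refine measureReal_le_one.trans ?_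
      have : (d : ℝ) ≤ x := by exact_mod_cast h
      simpa using mul_nonneg hlam (sub_nonneg.2 this)
    · simp [h, Real.exp_nonneg]
  | succ s ih =>
    by_cases h : d ≤ x
    · refine measureReal_le_one.trans ?_
      have : (d : ℝ) ≤ x := by exact_mod_cast h
      exact one_le_mul_of_one_le_of_one_le
        (Real.one_le_exp (mul_nonneg hlam (sub_nonneg.2 this)))
        (one_le_pow₀ (Real.one_le_cosh lam))
    · have hm : ∀ t, MeasurableSet {e | ∃ u ≤ t, d ≤ x + sgn σ * srw e u} := by
        intro t
        have : {e | ∃ u ≤ t, d ≤ x + sgn σ * srw e u} =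
            ⋃ u, ⋃ _ : u ≤ t, {e | srw e u ∈ {z | d ≤ x + sgn σ * z}} := by
          ext e; simp
        rw [this]
        exact MeasurableSet.iUnion fun u => MeasurableSet.iUnion fun _ =>
          measurable_srw u .of_discrete
      have hcons : ∀ b, {e | consSeq b e ∈ {e | ∃ u ≤ s + 1, d ≤ x + sgn σ * srw e u}} =
          {e | ∃ u ≤ s, d ≤ (x + sgn σ * sgn b) + sgn σ * srw e u} := by
        intro b
        ext e
        simp only [Set.mem_ofPred_eq]
        constructor
        · rintro ⟨u, hu, hd⟩
          cases u with
          | zero => simp at hd; exact absurd hd h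
          | succ u =>
            rw [srw_consSeq_succ, mul_add] at hd
            exact ⟨u, by omega, by linarith⟩
        · rintro ⟨u, hu, hd⟩
          refine ⟨u + 1, by omega, ?_⟩
          rw [srw_consSeq_succ, mul_add]
          linarith
      rw [coins_real_eq (hm _), hcons, hcons]
      have h1 := ih (x + sgn σ * sgn true)
      have h2 := ih (x + sgn σ * sgn false)
      have h3 : Real.exp (lam * ((x + 1 : ℤ) - d)) + Real.exp (lam * ((x + -1 : ℤ) - d)) =
          2 * (Real.exp (lam * (x - d)) * Real.cosh lam) := by
        push_cast
        rw [Real.cosh_eq, show lam * ((x : ℝ) + 1 - d) = lam * (x - d) + lam by ring,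
          show lam * ((x : ℝ) + -1 - d) = lam * (x - d) + -lam by ring, Real.exp_add, Real.exp_add]
        ring
      have h4 : (Real.exp (lam * ((x + sgn σ * sgn true : ℤ) - d)) * Real.cosh lam ^ s +
          Real.exp (lam * ((x + sgn σ * sgn false : ℤ) - d)) * Real.cosh lam ^ s) / 2 =
          Real.exp (lam * (x - d)) * Real.cosh lam ^ (s + 1) := by
        rw [← add_mul, pow_succ]
        cases σ
        · simp only [sgn, if_true, Bool.false_eq_true, if_false]
          norm_num only
          rw [add_comm (Real.exp _), h3]
          ring
        · simp only [sgn, if_true, Bool.false_eq_true, if_false]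
          norm_num only
          rw [h3]
          ring
      linarith

/-- The maximal displacement of the walk has Gaussian tails. -/
theorem coins_real_exists_le_abs_srw_le {s d : ℕ} (hs : 0 < s) :
    coins.real {e | ∃ u ≤ s, (d : ℤ) ≤ |srw e u|} ≤ 2 * Real.exp (-((d : ℝ) ^ 2 / (2 * s))) := by
  have hs' : (0 : ℝ) < s := by exact_mod_cast hs
  have hsub : {e | ∃ u ≤ s, (d : ℤ) ≤ |srw e u|} ⊆
      {e | ∃ u ≤ s, (d : ℤ) ≤ 0 + sgn true * srw e u} ∪
        {e | ∃ u ≤ s, (d : ℤ) ≤ 0 + sgn false * srw e u} := by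
    rintro e ⟨u, hu, hd⟩
    rcases le_abs.1 hd with h | h
    · exact Or.inl ⟨u, hu, by simpa [sgn] using h⟩
    · exact Or.inr ⟨u, hu, by simpa [sgn] using h⟩
  -- `lam = d / s` minimises `-lam * d + lam ^ 2 * s / 2`, the exponent left by `cosh lam ≤ exp (lam
  -- ^ 2 / 2)`.
  have hlam : (0 : ℝ) ≤ d / s := by positivity
  have key : Real.exp (d / s * ((0 : ℤ) - (d : ℤ))) * Real.cosh (d / s) ^ s ≤
      Real.exp (-((d : ℝ) ^ 2 / (2 * s))) := by
    calc _ ≤ Real.exp (d / s * ((0 : ℤ) - (d : ℤ))) * Real.exp ((d / s) ^ 2 / 2) ^ s := by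
          gcongr
          · exact Real.cosh_le_exp_half_sq _
      _ = _ := by
          rw [← Real.exp_nat_mul, ← Real.exp_add]
          congr 1
          push_cast
          field_simp
          ring
  have h1 := (measureReal_mono hsub).trans (measureReal_union_le (μ := coins) _ _)
  have h2 := coins_real_exists_le_srw_le true s 0 d hlam
  have h3 := coins_real_exists_le_srw_le false s 0 d hlam
  linarith

end SimpleRandomWalk

/-! ### The law of an agent as the projection of a walk on the line. -/

section WalkLaw

open Preorder

theorem frestrictLe_succ_eq {V : Type*} (a : ℕ) (x : ℕ → V) :
    frestrictLe (π := fun _ => V) (a + 1) x =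
      fun i : Finset.Iic (a + 1) => if h : (i : ℕ) ≤ a then frestrictLe (π := fun _ => V) a x ⟨i, Finset.mem_Iic.2 h⟩
        else x (a + 1) := by
  funext i
  split_ifs with h
  · rfl
  · have := Finset.mem_Iic.1 i.2
    have hi : (i : ℕ) = a + 1 := by omega
    rw [frestrictLe_apply, hi]

/-- Laws of trajectories with the same initial distribution and the same transition
probabilities coincide. -/
theorem eq_of_map_frestrictLe_compProd {V : Type*} [MeasurableSpace V] {μ ν : Measure (ℕ → V)}
    [IsProbabilityMeasure μ] [IsProbabilityMeasure ν]
    {κ : (a : ℕ) → Kernel (Finset.Iic a → V) V} [∀ a, IsMarkovKernel (κ a)]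
    (h0 : μ.map (fun x => x 0) = ν.map (fun x => x 0))
    (hμ : ∀ a, μ.map (frestrictLe (π := fun _ => V) a) ⊗ₘ κ a =
      μ.map fun x => (frestrictLe (π := fun _ => V) a x, x (a + 1)))
    (hν : ∀ a, ν.map (frestrictLe (π := fun _ => V) a) ⊗ₘ κ a =
      ν.map fun x => (frestrictLe (π := fun _ => V) a x, x (a + 1))) : μ = ν := by
  have key : ∀ a, μ.map (frestrictLe (π := fun _ => V) a) =
      ν.map (frestrictLe (π := fun _ => V) a) := by
    intro a
    induction a with
    | zero =>
      have hf : Measurable fun (v : V) (_ : Finset.Iic 0) => v :=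
        measurable_pi_iff.2 fun _ => measurable_id
      have hfun : frestrictLe (π := fun _ => V) 0 = (fun v _ => v) ∘ fun x : ℕ → V => x 0 := by
        funext x i
        have hi : (i : ℕ) = 0 := Nat.le_zero.1 (Finset.mem_Iic.1 i.2)
        simp [frestrictLe_apply, hi]
      rw [hfun, ← Measure.map_map hf (measurable_pi_apply 0), h0,
        Measure.map_map hf (measurable_pi_apply 0)]
    | succ a ih =>
      set F : (Finset.Iic a → V) × V → (Finset.Iic (a + 1) → V) := fun p i =>
        if h : (i : ℕ) ≤ a then p.1 ⟨i, Finset.mem_Iic.2 h⟩ else p.2 with hFdef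
      have hF : Measurable F := by
        refine measurable_pi_iff.2 fun i => ?_
        by_cases h : (i : ℕ) ≤ a
        · simp only [hFdef, h, dif_pos]
          exact (measurable_pi_apply _).comp measurable_fst
        · simp only [hFdef, h, dif_neg, not_false_eq_true]
          exact measurable_snd
      have hfun : frestrictLe (π := fun _ => V) (a + 1) =
          F ∘ fun x => (frestrictLe (π := fun _ => V) a x, x (a + 1)) := by
        funext x
        exact frestrictLe_succ_eq a x
      have hm : Measurable fun x : ℕ → V => (frestrictLe (π := fun _ => V) a x, x (a + 1)) := by
        fun_prop
      rw [hfun, ← Measure.map_map hF hm, ← Measure.map_map hF hm, ← hμ, ← hν, ih]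
  -- Marginals on initial segments determine the measure: both are projective limits of the same
  -- family.
  have hfam := isProjectiveMeasureFamily_map_restrict
    (X := fun (i : ℕ) (x : ℕ → V) => x i) (P := μ) (fun i => (measurable_pi_apply i).aemeasurable)
  have e1 := (isProjectiveLimit_nat_iff hfam μ).2 fun a => rfl
  have e2 := (isProjectiveLimit_nat_iff hfam ν).2 fun a => (key a).symm
  have : ∀ I : Finset ℕ, IsFiniteMeasure
      (μ.map fun ω => I.restrict fun i => ω i) := fun I => inferInstance
  exact e1.unique e2

theorem map_zero_walkLaw {V : Type*} [MeasurableSpace V] [DiscreteMeasurableSpace V] [Finite V]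
    [Nonempty V] (G : SimpleGraph V) : (walkLaw G).map (fun x => x 0) = uniformOn Set.univ := by
  have : IsProbabilityMeasure (uniformOn (Set.univ : Set V)) :=
    isProbabilityMeasure_uniformOn Set.finite_univ Set.univ_nonempty
  have h1 : (walkLaw G).map (frestrictLe (π := fun _ => V) 0) =
      (uniformOn Set.univ).map
        (MeasurableEquiv.piUnique fun _ : Finset.Iic 0 => V).symm := by
    rw [walkLaw, Kernel.trajMeasure, Measure.map_comp _ _ (by fun_prop),
      Kernel.traj_map_frestrictLe, Kernel.partialTraj_self, Measure.id_comp]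
  have h2 : (fun x : ℕ → V => x 0) =
      (fun p : Finset.Iic 0 → V => p ⟨0, Finset.mem_Iic.2 le_rfl⟩) ∘
        frestrictLe (π := fun _ => V) 0 := rfl
  rw [h2, ← Measure.map_map (by fun_prop) (by fun_prop), h1,
    Measure.map_map (by fun_prop) (MeasurableEquiv.measurable _)]
  exact Measure.map_id

instance {V : Type*} [MeasurableSpace V] [DiscreteMeasurableSpace V] [Finite V]
    [Nonempty V] (G : SimpleGraph V) : IsProbabilityMeasure (walkLaw G) := by
  have : IsProbabilityMeasure (uniformOn (Set.univ : Set V)) :=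
    isProbabilityMeasure_uniformOn Set.finite_univ Set.univ_nonempty
  unfold walkLaw
  infer_instance

theorem eq_walkLaw {V : Type*} [MeasurableSpace V] [DiscreteMeasurableSpace V] [Finite V]
    [Nonempty V] (G : SimpleGraph V) {ν : Measure (ℕ → V)} [IsProbabilityMeasure ν]
    (h0 : ν.map (fun x => x 0) = uniformOn Set.univ)
    (h : ∀ a, ν.map (frestrictLe (π := fun _ => V) a) ⊗ₘ pastKernel G a =
      ν.map fun x => (frestrictLe (π := fun _ => V) a x, x (a + 1))) : ν = walkLaw G := by
  have : IsProbabilityMeasure (uniformOn (Set.univ : Set V)) :=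
    isProbabilityMeasure_uniformOn Set.finite_univ Set.univ_nonempty
  exact eq_of_map_frestrictLe_compProd (h0.trans (map_zero_walkLaw G).symm) h fun a =>
    Kernel.map_frestrictLe_trajMeasure_compProd_eq_map_trajMeasure

/-- The next coin is independent of events determined by the previous coins. -/
theorem coins_inter_eq {a : ℕ} {D : Set (ℕ → Bool)}
    (hD : ∀ e e' : ℕ → Bool, (∀ i < a, e i = e' i) → e ∈ D → e' ∈ D) (b : Bool) :
    coins (D ∩ {e | e a = b}) = coins D * 2⁻¹ := by
  have hind : iIndepFun (fun i (e : ℕ → Bool) => e i) coins :=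
    iIndepFun_infinitePi (X := fun _ b => b) fun _ => measurable_id
  have h2 := hind.indepFun_finset (Finset.range a) {a}
    (by simp) (fun i => measurable_pi_apply i)
  set R : (ℕ → Bool) → (Finset.range a → Bool) := fun e i => e i with hR
  -- `D` depends only on the first `a` coins, so it is the preimage of its image in a finite
  -- discrete space.
  have hDR : D = R ⁻¹' (R '' D) := by
    refine Set.Subset.antisymm (Set.subset_preimage_image R D) ?_
    rintro e ⟨e', he', h⟩
    exact hD e' e (fun i hi => congrFun h ⟨i, Finset.mem_range.2 hi⟩) he'
  have hb : {e : ℕ → Bool | e a = b} =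
      (fun (e : ℕ → Bool) (i : ({a} : Finset ℕ)) => e i) ⁻¹'
        {g | g ⟨a, Finset.mem_singleton_self a⟩ = b} := rfl
  have h3 := h2.measure_inter_preimage_eq_mul (R '' D)
    {g | g ⟨a, Finset.mem_singleton_self a⟩ = b} .of_discrete .of_discrete
  rw [← hb] at h3
  change coins (R ⁻¹' (R '' D) ∩ _) = coins (R ⁻¹' (R '' D)) * _ at h3
  rw [← hDR] at h3
  rw [h3]
  congr 1
  have h4 : coins {e | e a = b} = coin {b} := by
    have := Measure.infinitePi_map_eval (fun _ : ℕ => coin) a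
    rw [← this, Measure.map_apply (measurable_pi_apply a) .of_discrete]
    rfl
  rw [h4]
  have h5 := coin_real_singleton b
  rw [measureReal_def, one_div] at h5
  rw [← ENNReal.ofReal_toReal (a := coin {b}) (by finiteness), h5,
    ENNReal.ofReal_inv_of_pos (by norm_num)]
  norm_num

/-- A covering of a path or cycle by the line, compatible with the simple random walks. -/
structure LineCover {n : ℕ} (G : SimpleGraph (Fin n)) where
  proj : ℤ → Fin n
  period : ℕ
  le_period : n ≤ period
  period_le : period ≤ 2 * n
  proj_add_period : ∀ z, proj (z + period) = proj z
  neighborSet_proj : ∀ z, G.neighborSet (proj z) = {proj (z + 1), proj (z - 1)}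
  bijective_proj : ∀ b, Function.Bijective fun x : Fin n => proj (sgn b * (x : ℕ))
  exists_dvd : ∀ a : ℤ, ∃ (x : Fin n) (b : Bool), (period : ℤ) ∣ sgn b * (x : ℕ) - a
  card_window_le : ∀ (c : ℤ) (v : Fin n),
    (Finset.univ.filter fun x : Fin n => proj (c + (x : ℕ)) = v).card ≤ 2
  connected : G.Connected

/-- The randomness driving one agent: the starting point, up to sign, and the steps. -/
abbrev AgentSpace (n : ℕ) : Type := (Fin n × Bool) × (ℕ → Bool)

def startMeasure (n : ℕ) : Measure (Fin n × Bool) := uniformOn Set.univ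

instance (n : ℕ) [NeZero n] : IsProbabilityMeasure (startMeasure n) :=
  isProbabilityMeasure_uniformOn Set.finite_univ Set.univ_nonempty

instance (n : ℕ) : IsFiniteMeasure (startMeasure n) := by
  unfold startMeasure uniformOn
  infer_instance

def agentMeasure (n : ℕ) : Measure (AgentSpace n) := (startMeasure n).prod coins

instance (n : ℕ) [NeZero n] : IsProbabilityMeasure (agentMeasure n) := by
  unfold agentMeasure
  infer_instance

instance (n : ℕ) : IsFiniteMeasure (agentMeasure n) := by
  unfold agentMeasure
  infer_instance

/-- Either sign alone gives a uniform vertex after projection (`bijective_proj`). The random sign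
makes the starts meet every residue modulo the period (`exists_dvd`), also for the path, whose
period is nearly twice its number of vertices. -/
def startPos {n : ℕ} (p : Fin n × Bool) : ℤ := sgn p.2 * (p.1 : ℕ)

/-- The position of the lift of an agent to the line. -/
def lift {n : ℕ} (ω : AgentSpace n) (t : ℕ) : ℤ := startPos ω.1 + srw ω.2 t

theorem measurable_lift {n : ℕ} (t : ℕ) : Measurable fun ω : AgentSpace n => lift ω t :=
  ((Measurable.of_discrete (f := startPos)).comp measurable_fst).add
    ((measurable_srw t).comp measurable_snd)

theorem isNNPath_lift {n : ℕ} (ω : AgentSpace n) : IsNNPath (lift ω) := by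
  intro t
  simp only [lift]
  rcases isNNPath_srw ω.2 t with h | h <;> rw [h] <;> [left; right] <;> ring

namespace LineCover

variable {n : ℕ} {G : SimpleGraph (Fin n)} (c : LineCover G)

def traj (ω : AgentSpace n) (t : ℕ) : Fin n := c.proj (lift ω t)

theorem measurable_traj : Measurable c.traj :=
  measurable_pi_iff.2 fun t => Measurable.of_discrete.comp (measurable_lift t)

/-- Where the two lifted neighbours project to the same vertex, as at an end of the path, the two
halves add up to the full step probability. So one unreflected walk serves every vertex. -/
theorem stepMeasure_proj (z : ℤ) (w : Fin n) :
    stepMeasure G (c.proj z) {w} =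
      ∑ b : Bool, (if c.proj (z + sgn b) = w then 1 else 0) * 2⁻¹ := by
  classical
  have hN := c.neighborSet_proj z
  rw [stepMeasure, if_pos ⟨Set.toFinite _, by rw [hN]; exact Set.insert_nonempty _ _⟩, hN,
    Fintype.sum_bool]
  have hs : ({c.proj (z + 1), c.proj (z - 1)} : Set (Fin n)) =
      (({c.proj (z + 1), c.proj (z - 1)} : Finset (Fin n)) : Set (Fin n)) := by simp
  have hw : ({w} : Set (Fin n)) = (({w} : Finset (Fin n)) : Set (Fin n)) := by simp
  rw [hs, hw, uniformOn_apply_finset]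
  simp only [sgn, if_true, Bool.false_eq_true, if_false, ← sub_eq_add_neg]
  by_cases h : c.proj (z + 1) = c.proj (z - 1)
  · rw [h]
    by_cases h' : c.proj (z - 1) = w
    · simp [h', ENNReal.inv_two_add_inv_two]
    · simp [h', Finset.singleton_inter_of_notMem]
  · rw [Finset.card_pair h]
    by_cases h1 : c.proj (z + 1) = w
    · have h2 : c.proj (z - 1) ≠ w := fun h2 => h (h1.trans h2.symm)
      rw [Finset.inter_singleton_of_mem (by simp [h1])]
      simp [h1, h2]
    · by_cases h2 : c.proj (z - 1) = w
      · rw [Finset.inter_singleton_of_mem (by simp [h2])]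
        simp [h1, h2]
      · rw [Finset.inter_singleton_of_notMem (by simp [Ne.symm h1, Ne.symm h2])]
        simp [h1, h2]

/-- The start is uniform because each vertex has exactly one preimage for each sign. For the
transitions, fix the start: the past depends on the first `a` coins only, the next coin is
independent of them, and it gives each lifted neighbour weight one half. -/
theorem map_traj [NeZero n] : (agentMeasure n).map c.traj = walkLaw G := by
  have hprob : IsProbabilityMeasure ((agentMeasure n).map c.traj) :=
    Measure.isProbabilityMeasure_map c.measurable_traj.aemeasurable
  refine eq_walkLaw G ?_ fun a => ?_
  · rw [Measure.map_map (measurable_pi_apply 0) c.measurable_traj]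
    have hf : (fun x : ℕ → Fin n => x 0) ∘ c.traj = (fun p => c.proj (startPos p)) ∘ Prod.fst := by
      funext ω
      simp [traj, lift]
    rw [hf, ← Measure.map_map .of_discrete measurable_fst, agentMeasure, Measure.map_fst_prod,
      measure_univ, one_smul]
    refine Measure.ext_of_singleton fun v => ?_
    rw [Measure.map_apply .of_discrete .of_discrete, startMeasure, uniformOn_univ, uniformOn_univ]
    have hcard : Measure.count ((fun p : Fin n × Bool => c.proj (startPos p)) ⁻¹' {v}) = 2 := by
      choose x hx hx' using fun b => (c.bijective_proj b).existsUnique v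
      have : (fun p : Fin n × Bool => c.proj (startPos p)) ⁻¹' {v} =
          ((Finset.univ.image fun b => (x b, b) : Finset (Fin n × Bool)) : Set (Fin n × Bool)) := by
        ext ⟨y, b⟩
        simp only [Set.mem_preimage, Set.mem_singleton_iff, Finset.coe_image, Finset.coe_univ,
          Set.image_univ, Set.mem_range, Prod.mk.injEq]
        constructor
        · exact fun h => ⟨b, (hx' b y h).symm, rfl⟩
        · rintro ⟨b', rfl, rfl⟩
          exact hx b'
      rw [this, Measure.count_apply_finset, Finset.card_image_of_injective]
      · rfl
      · exact fun b b' h => (Prod.mk.inj h).2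
    rw [hcard, Measure.count_singleton, Fintype.card_prod, Fintype.card_bool]
    push_cast
    rw [mul_comm, ← ENNReal.mul_div_mul_left 1 (Fintype.card (Fin n) : ENNReal) two_ne_zero
      ENNReal.ofNat_ne_top, mul_one]
  · have hm : Measurable fun x : ℕ → Fin n =>
        (frestrictLe (π := fun _ => Fin n) a x, x (a + 1)) := by fun_prop
    refine Measure.ext_of_singleton fun ⟨p, w⟩ => ?_
    rw [← Set.singleton_prod_singleton, Measure.compProd_apply_prod .of_discrete .of_discrete,
      lintegral_singleton, Measure.map_map (by fun_prop) c.measurable_traj,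
      Measure.map_map hm c.measurable_traj,
      Measure.map_apply ((measurable_frestrictLe a).comp c.measurable_traj) .of_discrete,
      Measure.map_apply (hm.comp c.measurable_traj) (by exact .of_discrete)]
    set v := p ⟨a, Finset.mem_Iic.2 le_rfl⟩
    have hk : pastKernel G a p {w} = stepMeasure G v {w} := rfl
    rw [hk, agentMeasure,
      Measure.prod_apply (((measurable_frestrictLe a).comp c.measurable_traj) .of_discrete),
      Measure.prod_apply ((hm.comp c.measurable_traj) (by exact .of_discrete)),
      ← lintegral_const_mul _ .of_discrete]
    refine lintegral_congr fun x => ?_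
    set D : Set (ℕ → Bool) :=
      {e | ∀ i : Finset.Iic a, c.proj (startPos x + srw e i) = p i} with hD
    have hDm : MeasurableSet D := by
      simp only [hD, Set.ofPred_forall]
      exact MeasurableSet.iInter fun i => ((measurable_srw i).const_add _)
        (MeasurableSet.of_discrete (s := {z | c.proj z = p i}))
    set E : Bool → Set (ℕ → Bool) := fun b =>
      {e | c.proj (startPos x + srw e a + sgn b) = w} with hE
    have hEm : ∀ b, MeasurableSet (E b) := fun b =>
      ((measurable_srw a).const_add _)
        (MeasurableSet.of_discrete (s := {z | c.proj (z + sgn b) = w}))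
    have h1 : (Prod.mk x ⁻¹' (frestrictLe (π := fun _ => Fin n) a ∘ c.traj ⁻¹' {p})) = D := by
      ext e
      simp only [Set.mem_preimage, Function.comp_apply, Set.mem_singleton_iff, funext_iff, hD,
        Set.mem_ofPred_eq, frestrictLe_apply, traj, lift]
    have h2 : (Prod.mk x ⁻¹' ((fun x : ℕ → Fin n =>
        (frestrictLe (π := fun _ => Fin n) a x, x (a + 1))) ∘ c.traj ⁻¹' ({p} ×ˢ {w}))) =
        ⋃ b, (D ∩ E b) ∩ {e | e a = b} := by
      ext e
      simp only [Set.mem_preimage, Function.comp_apply, Set.mem_prod, Set.mem_singleton_iff,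
        funext_iff, frestrictLe_apply, traj, lift, srw_succ, Set.mem_iUnion, Set.mem_inter_iff,
        hD, hE, Set.mem_ofPred_eq, exists_eq_right', add_assoc]
    have hdep : ∀ e e' : ℕ → Bool, (∀ i < a, e i = e' i) → ∀ i ≤ a, srw e i = srw e' i := by
      intro e e' h i hi
      exact Finset.sum_congr rfl fun j hj => by rw [h j (by have := Finset.mem_range.1 hj; omega)]
    have h3 : ∀ b, coins ((D ∩ E b) ∩ {e | e a = b}) = coins (D ∩ E b) * 2⁻¹ := by
      intro b
      refine coins_inter_eq ?_ b
      rintro e e' h ⟨h1, h2⟩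
      refine ⟨fun i => ?_, ?_⟩
      · rw [← hdep e e' h i (Finset.mem_Iic.1 i.2)]
        exact h1 i
      · simp only [hE, Set.mem_ofPred_eq] at h2 ⊢
        rwa [← hdep e e' h a le_rfl]
    rw [h1, h2, measure_iUnion ?_ ?_, tsum_fintype]
    · simp only [h3]
      have h4 : ∀ b, coins (D ∩ E b) * 2⁻¹ = ∫⁻ e in D,
          (if c.proj (startPos x + srw e a + sgn b) = w then 1 else 0) * 2⁻¹ ∂coins := by
        intro b
        rw [lintegral_mul_const' _ _ (by simp)]
        congr 1
        rw [Set.inter_comm, ← Measure.restrict_apply (hEm b), ← lintegral_indicator_one (hEm b)]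
        refine lintegral_congr fun e => ?_
        simp [Set.indicator, hE]
      simp only [h4]
      rw [← lintegral_finsetSum]
      · rw [← setLIntegral_const]
        refine setLIntegral_congr_fun hDm fun e he => ?_
        rw [← c.stepMeasure_proj, he ⟨a, Finset.mem_Iic.2 le_rfl⟩]
      · intro b _
        exact (Measurable.of_discrete (f := fun z : ℤ =>
          (if c.proj (startPos x + z + sgn b) = w then (1 : ENNReal) else 0) * 2⁻¹)).comp
          (measurable_srw a)
    · intro b b' hbb
      refine Set.disjoint_left.2 ?_
      rintro e ⟨-, h⟩ ⟨-, h'⟩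
      exact hbb (h.symm.trans h')
    · intro b
      have hb : Measurable fun e : ℕ → Bool => e a := measurable_pi_apply a
      exact (hDm.inter (hEm b)).inter (hb (MeasurableSet.of_discrete (s := {b})))

end LineCover

end WalkLaw

/-! ### The covers of the cycle and of the path. -/

section Covers

theorem sgn_mul_sub_dvd {N : ℤ} {b : Bool} {x y : ℤ} (h : N ∣ sgn b * x - sgn b * y) :
    N ∣ x - y := by
  cases b
  · have := (dvd_neg (α := ℤ)).2 h
    simpa [sgn, neg_add_eq_sub, add_comm, sub_eq_add_neg] using this
  · simpa [sgn] using h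

theorem eq_of_dvd_sub {n : ℕ} {N : ℤ} (hN : (n : ℤ) ≤ N) {x y : Fin n}
    (h : N ∣ ((x : ℕ) : ℤ) - ((y : ℕ) : ℤ)) : x = y := by
  have hx := x.2
  have hy := y.2
  have := Int.eq_zero_of_abs_lt_dvd h (by rw [abs_lt]; constructor <;> omega)
  exact Fin.ext (by omega)

/-- Reduction modulo `m + 2`, using that `ZMod (m + 2)` unfolds to `Fin (m + 2)`. -/
def cycleCover (m : ℕ) : LineCover (SimpleGraph.cycleGraph (m + 2)) where
  proj z := (z : ZMod (m + 2))
  period := m + 2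
  le_period := le_rfl
  period_le := by omega
  proj_add_period z := by
    have h : ((m + 2 : ℕ) : ZMod (m + 2)) = 0 := ZMod.natCast_self _
    change ((z + (m + 2 : ℕ) : ℤ) : ZMod (m + 2)) = z
    rw [Int.cast_add, Int.cast_natCast, h, add_zero]
  neighborSet_proj z := by
    have h0 := SimpleGraph.cycleGraph_neighborSet (n := m) (v := ((z : ZMod (m + 2)) :))
    rw [Set.pair_comm] at h0
    have h1 : ((z + 1 : ℤ) : ZMod (m + 2)) = z + 1 := by push_cast; rfl
    have h2 : ((z - 1 : ℤ) : ZMod (m + 2)) = z - 1 := by push_cast; rfl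
    rw [h1, h2]
    exact h0
  bijective_proj b := by
    refine Finite.injective_iff_bijective.1 fun x y h => ?_
    have h' := (ZMod.intCast_eq_intCast_iff_dvd_sub _ _ (m + 2)).1 h
    exact (eq_of_dvd_sub le_rfl (sgn_mul_sub_dvd h')).symm
  exists_dvd a := by
    have h1 := Int.emod_nonneg a (b := (m + 2 : ℕ)) (by positivity)
    have h2 := Int.emod_lt_of_pos a (b := (m + 2 : ℕ)) (by positivity)
    refine ⟨⟨(a % (m + 2 : ℕ)).toNat, by omega⟩, true, ?_⟩
    have h3 : sgn true * (((a % (m + 2 : ℕ)).toNat : ℕ) : ℤ) - a = a % (m + 2 : ℕ) - a := by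
      rw [Int.toNat_of_nonneg h1]
      simp [sgn]
    rw [h3]
    exact dvd_sub_comm.1 (Int.dvd_self_sub_emod)
  card_window_le c v := by
    refine le_trans (Finset.card_le_one.2 fun x hx y hy => ?_) one_le_two
    have hxy := (Finset.mem_filter.1 hx).2.trans (Finset.mem_filter.1 hy).2.symm
    have h' := (ZMod.intCast_eq_intCast_iff_dvd_sub _ _ (m + 2)).1 hxy
    rw [add_sub_add_left_eq_sub] at h'
    exact (eq_of_dvd_sub le_rfl h').symm
  connected := SimpleGraph.cycleGraph_connected

/-- Reflection of the line onto the path with `m + 2` vertices. -/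
def fold (m : ℕ) (z : ℤ) : Fin (m + 2) :=
  ⟨(min (z % (2 * (m + 1) : ℤ)) (2 * (m + 1) - z % (2 * (m + 1) : ℤ))).toNat, by omega⟩

theorem fold_val (m : ℕ) (z : ℤ) : (((fold m z : Fin (m + 2)) : ℕ) : ℤ) =
    min (z % (2 * (m + 1) : ℤ)) (2 * (m + 1) - z % (2 * (m + 1) : ℤ)) := by
  have h1 := Int.emod_nonneg z (b := (2 * (m + 1) : ℤ)) (by positivity)
  have h2 := Int.emod_lt_of_pos z (b := (2 * (m + 1) : ℤ)) (by positivity)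
  refine Int.toNat_of_nonneg ?_
  omega

theorem neighborSet_fold (m : ℕ) (z : ℤ) :
    (SimpleGraph.pathGraph (m + 2)).neighborSet (fold m z) = {fold m (z + 1), fold m (z - 1)} := by
  have h1 := Int.emod_nonneg z (b := (2 * (m + 1) : ℤ)) (by positivity)
  have h2 := Int.emod_lt_of_pos z (b := (2 * (m + 1) : ℤ)) (by positivity)
  have v0 := fold_val m z
  have v1 := fold_val m (z + 1)
  have v2 := fold_val m (z - 1)
  have e1 : (z + 1) % (2 * (m + 1) : ℤ) = if z % (2 * (m + 1) : ℤ) + 1 = 2 * (m + 1) then 0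
      else z % (2 * (m + 1) : ℤ) + 1 := by
    rw [← Int.emod_add_emod]
    split_ifs with h
    · rw [h, Int.emod_self]
    · exact Int.emod_eq_of_lt (by omega) (by omega)
  have e2 : (z - 1) % (2 * (m + 1) : ℤ) = if z % (2 * (m + 1) : ℤ) = 0 then (2 * (m + 1) - 1 : ℤ)
      else z % (2 * (m + 1) : ℤ) - 1 := by
    rw [← Int.emod_sub_emod]
    split_ifs with h
    · rw [h, ← Int.add_emod_right, Int.emod_eq_of_lt (by omega) (by omega)]
      ring
    · exact Int.emod_eq_of_lt (by omega) (by omega)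
  rw [e1] at v1
  rw [e2] at v2
  ext w
  have hw := w.2
  simp only [SimpleGraph.mem_neighborSet, SimpleGraph.pathGraph_adj, Set.mem_insert_iff,
    Set.mem_singleton_iff, Fin.ext_iff]
  generalize z % (2 * (m + 1) : ℤ) = r at *
  split_ifs at v1 v2 <;> omega

/-- Reflection does not double the end vertices, hence the period `2 * (m + 1)`. A vertex comes from
at most two residues, and a window of `m + 2` integers meets each residue at most once. -/
def pathCover (m : ℕ) : LineCover (SimpleGraph.pathGraph (m + 2)) where
  proj := fold m
  period := 2 * (m + 1)
  le_period := by omega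
  period_le := by omega
  proj_add_period z := by
    simp only [fold, Nat.cast_mul, Nat.cast_add, Nat.cast_ofNat, Nat.cast_one, Int.add_emod_right]
  neighborSet_proj := neighborSet_fold m
  bijective_proj b := by
    refine Finite.injective_iff_bijective.1 fun x y h => ?_
    have key : ∀ x : Fin (m + 2), fold m (sgn b * (x : ℕ)) = x := by
      intro x
      have hx := x.2
      have v := fold_val m (sgn b * (x : ℕ))
      have e : (sgn b * (x : ℕ)) % (2 * (m + 1) : ℤ) =
          if b then ((x : ℕ) : ℤ) else if (x : ℕ) = 0 then 0 else 2 * (m + 1) - (x : ℕ) := by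
        cases b
        · simp only [sgn, Bool.false_eq_true, if_false]
          split_ifs with h
          · simp [h]
          · rw [← Int.add_emod_right]
            rw [Int.emod_eq_of_lt (by omega) (by omega)]
            ring
        · simp only [sgn, if_true, one_mul]
          exact Int.emod_eq_of_lt (by omega) (by omega)
      rw [e] at v
      refine Fin.ext ?_
      split_ifs at v <;> omega
    rw [key, key] at h
    exact h
  exists_dvd a := by
    have h1 := Int.emod_nonneg a (b := (2 * (m + 1) : ℤ)) (by positivity)
    have h2 := Int.emod_lt_of_pos a (b := (2 * (m + 1) : ℤ)) (by positivity)
    have h3 : (2 * (m + 1) : ℤ) ∣ a % (2 * (m + 1)) - a :=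
      dvd_sub_comm.1 (Int.dvd_self_sub_emod)
    push_cast
    by_cases h : a % (2 * (m + 1) : ℤ) < m + 2
    · refine ⟨⟨(a % (2 * (m + 1) : ℤ)).toNat, by omega⟩, true, ?_⟩
      simpa [sgn, Int.toNat_of_nonneg h1] using h3
    · refine ⟨⟨(2 * (m + 1) - a % (2 * (m + 1) : ℤ)).toNat, by omega⟩, false, ?_⟩
      have h4 : (((2 * (m + 1) - a % (2 * (m + 1) : ℤ)).toNat : ℕ) : ℤ) =
        2 * (m + 1) - a % (2 * (m + 1) : ℤ) := Int.toNat_of_nonneg (by omega)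
      simp only [sgn, Bool.false_eq_true, if_false, h4]
      have h5 := dvd_sub h3 (dvd_refl (2 * (m + 1) : ℤ))
      refine h5.trans (dvd_of_eq ?_)
      ring
  card_window_le c v := by
    have : ({((v : ℕ) : ℤ), 2 * (m + 1) - ((v : ℕ) : ℤ)} : Finset ℤ).card ≤ 2 := Finset.card_le_two
    refine le_trans (Finset.card_le_card_of_injOn
      (fun x : Fin (m + 2) => (c + (x : ℕ)) % (2 * (m + 1) : ℤ)) ?_ ?_) this
    · intro x hx
      have h1 := (Finset.mem_filter.1 hx).2
      have v0 := fold_val m (c + (x : ℕ))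
      rw [h1] at v0
      simp only [Finset.coe_insert, Finset.coe_singleton, Set.mem_insert_iff,
        Set.mem_singleton_iff]
      omega
    · intro x _ y _ hxy
      have h1 := Int.dvd_of_emod_eq_zero (Int.emod_eq_emod_iff_emod_sub_eq_zero.1 hxy)
      rw [add_sub_add_left_eq_sub] at h1
      exact eq_of_dvd_sub (by push_cast; linarith) h1
  connected := SimpleGraph.pathGraph_connected _

theorem exists_lineCover {G : (n : ℕ) → SimpleGraph (Fin n)}
    (hG : G = SimpleGraph.pathGraph ∨ G = SimpleGraph.cycleGraph) {n : ℕ} (hn : 2 ≤ n) :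
    Nonempty (LineCover (G n)) := by
  obtain ⟨m, rfl⟩ := Nat.exists_eq_add_of_le' hn
  rcases hG with rfl | rfl
  · exact ⟨pathCover m⟩
  · exact ⟨cycleCover m⟩

end Covers

/-! ### Probability estimates for a single agent. -/

section OneAgent

variable {n : ℕ}

theorem startMeasure_real [NeZero n] (S : Finset (Fin n × Bool)) :
    (startMeasure n).real S = S.card / (2 * n) := by
  rw [measureReal_def, startMeasure, uniformOn_univ, Measure.count_apply_finset, Fintype.card_prod,
    Fintype.card_bool, Fintype.card_fin, ENNReal.toReal_div]
  simp [mul_comm]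

theorem agentMeasure_eq_lintegral {A : Set (AgentSpace n)} (hA : MeasurableSet A) :
    agentMeasure n A = ∫⁻ e, startMeasure n {p | (p, e) ∈ A} ∂coins :=
  Measure.prod_apply_symm hA

/-- The steps are frozen and only the uniform start is used, so bounds hold at any time without
knowing the distribution of the walk. -/
theorem agentMeasure_real_le [NeZero n] {A : Set (AgentSpace n)} (hA : MeasurableSet A) {q : ℝ}
    (hq : 0 ≤ q) (h : ∀ e, (startMeasure n).real {p | (p, e) ∈ A} ≤ q) :
    (agentMeasure n).real A ≤ q := by
  refine ENNReal.toReal_le_of_le_ofReal hq ?_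
  rw [agentMeasure_eq_lintegral hA]
  calc _ ≤ ∫⁻ _, ENNReal.ofReal q ∂coins := lintegral_mono fun e =>
        (ENNReal.le_ofReal_iff_toReal_le (by finiteness) hq).2 (h e)
    _ = ENNReal.ofReal q := by simp

theorem le_agentMeasure_real [NeZero n] {A : Set (AgentSpace n)} (hA : MeasurableSet A) {q : ℝ}
    {E : Set (ℕ → Bool)} (hE : MeasurableSet E)
    (h : ∀ e ∈ E, q ≤ (startMeasure n).real {p | (p, e) ∈ A}) :
    q * coins.real E ≤ (agentMeasure n).real A := by
  have h1 : ENNReal.ofReal q * coins E ≤ agentMeasure n A := by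
    rw [agentMeasure_eq_lintegral hA, ← setLIntegral_const]
    refine le_trans (setLIntegral_mono' hE fun e he => ?_) (setLIntegral_le_lintegral E _)
    exact ENNReal.ofReal_le_of_le_toReal (h e he)
  have h2 := ENNReal.toReal_mono (by finiteness) h1
  rw [ENNReal.toReal_mul] at h2
  refine le_trans ?_ h2
  exact mul_le_mul_of_nonneg_right (ENNReal.toReal_ofReal' ▸ le_max_left q 0) measureReal_nonneg

theorem agentMeasure_real_snd [NeZero n] {E : Set (ℕ → Bool)} :
    (agentMeasure n).real {ω | ω.2 ∈ E} = coins.real E := by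
  have : {ω : AgentSpace n | ω.2 ∈ E} = Set.univ ×ˢ E := by ext; simp
  rw [this, agentMeasure, measureReal_prod_prod]
  simp

theorem lift_sub_lift (ω : AgentSpace n) (t u : ℕ) :
    lift ω (t + u) - lift ω t = srw (shiftSeq t ω.2) u := by
  rw [lift, lift, srw_add]
  ring

/-- Gaussian tails for the maximal displacement of an agent in a window of time. -/
theorem agentMeasure_real_displacement_le [NeZero n] (t : ℕ) {s d : ℕ} (hs : 0 < s) :
    (agentMeasure n).real {ω | ∃ u ≤ s, (d : ℤ) ≤ |lift ω (t + u) - lift ω t|} ≤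
      2 * Real.exp (-((d : ℝ) ^ 2 / (2 * s))) := by
  have hm : MeasurableSet {e | ∃ u ≤ s, (d : ℤ) ≤ |srw e u|} := by
    have : {e | ∃ u ≤ s, (d : ℤ) ≤ |srw e u|} = ⋃ u, ⋃ _ : u ≤ s, {e | srw e u ∈ {z | (d : ℤ) ≤ |z|}} := by
      ext e; simp
    rw [this]
    exact MeasurableSet.iUnion fun u => MeasurableSet.iUnion fun _ => measurable_srw u .of_discrete
  simp only [lift_sub_lift]
  have h1 := agentMeasure_real_snd (n := n)
    (E := {e | shiftSeq t e ∈ {e | ∃ u ≤ s, (d : ℤ) ≤ |srw e u|}})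
  rw [coins_real_shiftSeq t hm] at h1
  exact h1.le.trans (coins_real_exists_le_abs_srw_le hs)

/-- Whatever the target increments, an agent follows them only with small probability. -/
theorem agentMeasure_real_follow_le [NeZero n] {L : ℕ} (hL : 0 < L) (M : ℕ) (c : ℕ → ℤ) :
    (agentMeasure n).real {ω | ∀ j < M,
      |lift ω ((j + 1) * (16 * L ^ 2)) - lift ω (j * (16 * L ^ 2)) - c j| < L} ≤ (29 / 32) ^ M := by
  set s := 16 * L ^ 2 with hs
  have h1 := agentMeasure_real_snd (n := n)
    (E := {e | ∀ j < M, srw e ((j + 1) * s) - srw e (j * s) ∈ {z | |z - c j| < (L : ℤ)}})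
  rw [coins_real_blocks] at h1
  have h2 : ∀ ω : AgentSpace n, ∀ j, lift ω ((j + 1) * s) - lift ω (j * s) =
      srw ω.2 ((j + 1) * s) - srw ω.2 (j * s) := fun ω j => by simp only [lift]; ring
  simp only [h2]
  refine h1.le.trans ?_
  refine le_trans (Finset.prod_le_prod (g := fun _ => (29 / 32 : ℝ))
    (fun _ _ => measureReal_nonneg) fun j _ => ?_) (by simp [div_pow])
  have key : ∀ A : Set ℤ, (∀ z ∈ {z | |z - c j| < (L : ℤ)}, z ∉ A) →
      3 / 32 ≤ coins.real {e | srw e s ∈ A} →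
      coins.real {e | srw e s ∈ {z | |z - c j| < (L : ℤ)}} ≤ 29 / 32 := by
    intro A hA h
    have hm : MeasurableSet {e | srw e s ∈ A} := measurable_srw s .of_discrete
    have h3 : coins.real {e | srw e s ∈ {z | |z - c j| < (L : ℤ)}} ≤
        coins.real {e | srw e s ∈ A}ᶜ := measureReal_mono fun e he => hA _ he
    rw [probReal_compl_eq_one_sub hm] at h3
    linarith
  have h4 := le_coins_real_le_srw L hL
  -- With probability at least `3 / 32` the walk moves by `2 * L` in the direction opposite to `c
  -- j`, and so ends at distance at least `2 * L` from it.
  rcases le_total (c j) 0 with hc | hc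
  · refine key {z | 2 * (L : ℤ) ≤ z} ?_ h4
    intro z hz hz'
    simp only [Set.mem_ofPred_eq, abs_lt] at hz hz'
    omega
  · refine key {z | - z ∈ {z | 2 * (L : ℤ) ≤ z}} ?_ ?_
    · intro z hz hz'
      simp only [Set.mem_ofPred_eq, abs_lt] at hz hz'
      omega
    · have := coins_real_neg_srw s {z | 2 * (L : ℤ) ≤ z}
      simp only [Set.mem_ofPred_eq] at this ⊢
      rwa [this]

/-- With probability bounded from below, the walk moves to the left by a moderate distance. -/
theorem le_coins_real_srw_mem_Icc {L : ℕ} (hL : 0 < L) :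
    1 / 16 ≤ coins.real {e | srw e (16 * L ^ 2) ∈ Set.Icc (-16 * (L : ℤ)) (-2 * L)} := by
  set s := 16 * L ^ 2 with hs
  have h1 := le_coins_real_le_srw L hL
  have h2 := coins_real_neg_srw s {z | 2 * (L : ℤ) ≤ z}
  -- Reaching distance `16 * L` costs at most `2 * exp (-8) ≤ 1 / 32`, which leaves `3 / 32 - 1 / 32
  -- = 1 / 16`.
  have h3 := coins_real_exists_le_abs_srw_le (s := s) (d := 16 * L) (by positivity)
  have h4 : (((16 * L : ℕ) : ℝ) ^ 2 / (2 * (s : ℝ))) = 8 := by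
    have : (0 : ℝ) < L := by exact_mod_cast hL
    rw [hs]
    push_cast
    field_simp
    norm_num
  rw [h4] at h3
  have h5 : 2 * Real.exp (-8) ≤ 1 / 32 := by
    have h6 : (2 : ℝ) ^ 8 ≤ Real.exp 8 := by
      have h7 : (2 : ℝ) ≤ Real.exp 1 := by linarith [Real.add_one_le_exp (1 : ℝ)]
      calc (2 : ℝ) ^ 8 ≤ Real.exp 1 ^ 8 := by gcongr
        _ = Real.exp 8 := by rw [← Real.exp_nat_mul]; norm_num
    rw [Real.exp_neg]
    have h8 : (Real.exp 8)⁻¹ ≤ (2 ^ 8)⁻¹ := inv_anti₀ (by norm_num) h6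
    linarith
  have hsub : {e : ℕ → Bool | - srw e s ∈ {z | 2 * (L : ℤ) ≤ z}} ⊆
      {e | srw e s ∈ Set.Icc (-16 * (L : ℤ)) (-2 * L)} ∪
        {e | ∃ u ≤ s, ((16 * L : ℕ) : ℤ) ≤ |srw e u|} := by
    intro e he
    simp only [Set.mem_ofPred_eq, Set.mem_union, Set.mem_Icc] at he ⊢
    by_cases h : -16 * (L : ℤ) ≤ srw e s
    · exact Or.inl ⟨h, by omega⟩
    · refine Or.inr ⟨s, le_rfl, le_trans ?_ (neg_le_abs _)⟩
      push_cast
      omega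
  have h6 := (measureReal_mono hsub).trans (measureReal_union_le (μ := coins) _ _)
  rw [h2] at h6
  simp only [Set.mem_ofPred_eq] at h6
  linarith

/-- A block of `m` moderate moves to the left followed by `16 * m` moves to the right. -/
theorem le_coins_real_zigzag {L : ℕ} (hL : 0 < L) (m : ℕ) :
    (1 / 16) ^ (17 * m) ≤ coins.real {e | srw e (m * (16 * L ^ 2)) ≤ -2 * m * L ∧
      16 * m * (L : ℤ) ≤ srw e (17 * m * (16 * L ^ 2))} := by
  set s := 16 * L ^ 2 with hs
  set B : ℕ → Set ℤ := fun j => if j < m then Set.Icc (-16 * (L : ℤ)) (-2 * L)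
    else Set.Ici (2 * (L : ℤ)) with hB
  have h1 := coins_real_blocks s (17 * m) B
  have h2 : (1 / 16 : ℝ) ^ (17 * m) ≤
      ∏ j ∈ Finset.range (17 * m), coins.real {e | srw e s ∈ B j} := by
    rw [← Finset.card_range (17 * m), ← Finset.prod_const, Finset.card_range]
    refine Finset.prod_le_prod (fun _ _ => by norm_num) fun j _ => ?_
    simp only [hB]
    split_ifs
    · exact le_coins_real_srw_mem_Icc hL
    · refine le_trans (by norm_num) (le_coins_real_le_srw L hL)
  rw [← h1] at h2
  refine h2.trans (measureReal_mono fun e he => ?_)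
  have he' : ∀ j < 17 * m, srw e ((j + 1) * s) - srw e (j * s) ∈ B j := he
  have a1 : ∀ j ≤ m, -16 * j * (L : ℤ) ≤ srw e (j * s) ∧ srw e (j * s) ≤ -2 * j * L := by
    intro j hj
    induction j with
    | zero => simp
    | succ j ih =>
      have h3 := he' j (by omega)
      simp only [hB, show j < m by omega, if_true, Set.mem_Icc] at h3
      have h4 := ih (by omega)
      push_cast
      constructor <;> nlinarith
  -- The cap `16 * L` on each left move bounds the debt by `16 * m * L`; `16 * m` right moves of at
  -- least `2 * L` repay it twice.
  have a2 : ∀ j ≤ 16 * m, -16 * m * (L : ℤ) + 2 * j * L ≤ srw e ((m + j) * s) := by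
    intro j hj
    induction j with
    | zero => simpa using (a1 m le_rfl).1
    | succ j ih =>
      have h3 := he' (m + j) (by omega)
      simp only [hB, show ¬ (m + j < m) by omega, if_false, Set.mem_Ici] at h3
      have h4 := ih (by omega)
      rw [← add_assoc]
      push_cast
      nlinarith
  refine ⟨(a1 m le_rfl).2, ?_⟩
  have h3 := a2 (16 * m) le_rfl
  rw [show m + 16 * m = 17 * m by ring] at h3
  push_cast at h3
  linarith

namespace LineCover

variable {G : SimpleGraph (Fin n)} (c : LineCover G)

theorem adj_proj (z : ℤ) : G.Adj (c.proj z) (c.proj (z + 1)) := by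
  rw [← SimpleGraph.mem_neighborSet, c.neighborSet_proj]
  exact Or.inl rfl

theorem dist_proj_add_natCast_le (z : ℤ) (j : ℕ) : G.dist (c.proj z) (c.proj (z + j)) ≤ j := by
  induction j with
  | zero => simp
  | succ j ih =>
    refine (c.connected.dist_triangle (v := c.proj (z + j))).trans ?_
    have := SimpleGraph.dist_eq_one_iff_adj.2 (c.adj_proj (z + j))
    rw [Nat.cast_succ, ← add_assoc, this]
    omega

theorem dist_proj_le (z z' : ℤ) : (G.dist (c.proj z) (c.proj z') : ℤ) ≤ |z' - z| := by
  rcases le_total z z' with h | h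
  · obtain ⟨j, hj⟩ := Int.eq_ofNat_of_zero_le (sub_nonneg.2 h)
    have h1 := c.dist_proj_add_natCast_le z j
    rw [← hj, add_sub_cancel] at h1
    rw [hj]
    simpa using h1
  · obtain ⟨j, hj⟩ := Int.eq_ofNat_of_zero_le (sub_nonneg.2 h)
    have h1 := c.dist_proj_add_natCast_le z' j
    rw [← hj, add_sub_cancel, SimpleGraph.dist_comm] at h1
    rw [abs_sub_comm, hj]
    simpa using h1

theorem dist_traj_le (ω : AgentSpace n) (t u : ℕ) :
    (G.dist (c.traj ω t) (c.traj ω u) : ℤ) ≤ |lift ω u - lift ω t| :=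
  c.dist_proj_le _ _

theorem dist_traj_succ_le (ω : AgentSpace n) (t : ℕ) :
    G.dist (c.traj ω t) (c.traj ω (t + 1)) ≤ 1 := by
  have h := c.dist_traj_le ω t (t + 1)
  have h1 : |lift ω (t + 1) - lift ω t| = 1 := by
    rcases isNNPath_lift ω t with h | h <;> rw [h] <;> simp
  omega

theorem exists_proj_eq (v : Fin n) : ∃ z, c.proj z = v := by
  obtain ⟨x, hx⟩ := (c.bijective_proj true).2 v
  exact ⟨_, hx⟩

/-- Lifting of graph walks to the line; it shows that a ball of radius `r` is covered by the image
of `2 * r + 1` consecutive integers. -/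
theorem exists_of_walk {v w : Fin n} (p : G.Walk v w) {z : ℤ} (hz : c.proj z = v) :
    ∃ j : ℤ, |j| ≤ p.length ∧ c.proj (z + j) = w := by
  induction p generalizing z with
  | nil => exact ⟨0, by simp, by simpa using hz⟩
  | @cons a b _ h p ih =>
    rw [← SimpleGraph.mem_neighborSet, ← hz, c.neighborSet_proj] at h
    have : ∃ ε : ℤ, |ε| ≤ 1 ∧ c.proj (z + ε) = b := by
      rcases h with h | h
      · exact ⟨1, by simp, h.symm⟩
      · exact ⟨-1, by simp, h.symm⟩
    obtain ⟨ε, hε, hb⟩ := this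
    obtain ⟨j, hj, hw⟩ := ih hb
    refine ⟨ε + j, (abs_add_le _ _).trans ?_, by rw [← add_assoc, hw]⟩
    rw [SimpleGraph.Walk.length_cons]
    push_cast
    linarith

theorem card_filter_dist_le (c : LineCover G) (v : Fin n) (r : ℕ) :
    (Finset.univ.filter fun w => G.dist v w ≤ r).card ≤ 2 * r + 1 := by
  obtain ⟨z, hz⟩ := c.exists_proj_eq v
  have hsub : (Finset.univ.filter fun w => G.dist v w ≤ r) ⊆
      (Finset.Icc (-(r : ℤ)) r).image fun j => c.proj (z + j) := by
    intro w hw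
    obtain ⟨p, hp⟩ := c.connected.exists_walk_length_eq_dist v w
    obtain ⟨j, hj, hjw⟩ := c.exists_of_walk p hz
    have := (Finset.mem_filter.1 hw).2
    rw [abs_le] at hj
    exact Finset.mem_image.2 ⟨j, Finset.mem_Icc.2 ⟨by omega, by omega⟩, hjw⟩
  refine (Finset.card_le_card hsub).trans (Finset.card_image_le.trans ?_)
  rw [Int.card_Icc]
  omega

/-- Starts with positive sign fill one window of `n` consecutive integers; those with negative sign,
read backwards, fill another. Each window meets `v` at most twice. -/
theorem card_startPos_le (a : ℤ) (v : Fin n) :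
    (Finset.univ.filter fun p : Fin n × Bool => c.proj (startPos p + a) = v).card ≤ 4 := by
  have hsub : (Finset.univ.filter fun p : Fin n × Bool => c.proj (startPos p + a) = v) ⊆
      ((Finset.univ.filter fun x : Fin n => c.proj (a + (x : ℕ)) = v).image fun x => (x, true)) ∪
      ((Finset.univ.filter fun x : Fin n => c.proj (a - (n - 1) + (x : ℕ)) = v).image
        fun x => (x.rev, false)) := by
    rintro ⟨x, b⟩ hx
    have h := (Finset.mem_filter.1 hx).2
    simp only [Finset.mem_union, Finset.mem_image, Finset.mem_filter, Finset.mem_univ, true_and,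
      Prod.mk.injEq]
    cases b
    · refine Or.inr ⟨x.rev, ?_, Fin.rev_rev x, rfl⟩
      rw [← h]
      congr 1
      have := x.2
      simp only [startPos, sgn, Bool.false_eq_true, if_false, Fin.val_rev]
      omega
    · refine Or.inl ⟨x, ?_, rfl, rfl⟩
      rw [← h]
      congr 1
      simp [startPos, sgn, add_comm]
  refine (Finset.card_le_card hsub).trans ((Finset.card_union_le _ _).trans ?_)
  have h1 := c.card_window_le a v
  have h2 := c.card_window_le (a - (n - 1)) v
  have h3 := Finset.card_image_le
    (s := Finset.univ.filter fun x : Fin n => c.proj (a + (x : ℕ)) = v) (f := fun x => (x, true))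
  have h4 := Finset.card_image_le
    (s := Finset.univ.filter fun x : Fin n => c.proj (a - (n - 1) + (x : ℕ)) = v)
    (f := fun x => (x.rev, false))
  omega

/-- At any time, an agent is in a given ball of radius `r` with probability at most
`2 * (2 * r + 1) / n`. -/
theorem agentMeasure_real_dist_le [NeZero n] (t : ℕ) (v : Fin n) (r : ℕ) :
    (agentMeasure n).real {ω | G.dist v (c.traj ω t) ≤ r} ≤ 2 * (2 * r + 1) / n := by
  refine agentMeasure_real_le ?_ (by positivity) fun e => ?_
  · exact ((measurable_pi_apply t).comp c.measurable_traj)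
      (MeasurableSet.of_discrete (s := {w | G.dist v w ≤ r}))
  · classical
    have hset : {p : Fin n × Bool | (p, e) ∈ {ω : AgentSpace n | G.dist v (c.traj ω t) ≤ r}} =
        ((Finset.univ.filter fun p : Fin n × Bool =>
          G.dist v (c.proj (startPos p + srw e t)) ≤ r : Finset _) : Set (Fin n × Bool)) := by
      ext p
      simp [traj, lift]
    rw [hset, startMeasure_real]
    have hcard : (Finset.univ.filter fun p : Fin n × Bool =>
        G.dist v (c.proj (startPos p + srw e t)) ≤ r).card ≤ 4 * (2 * r + 1) := by
      have hmaps : ∀ p ∈ (Finset.univ.filter fun p : Fin n × Bool =>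
          G.dist v (c.proj (startPos p + srw e t)) ≤ r),
          c.proj (startPos p + srw e t) ∈ Finset.univ.filter fun w => G.dist v w ≤ r := by
        intro p hp
        simpa using hp
      refine (Finset.card_le_mul_card_image_of_maps_to hmaps 4 fun w _ => ?_).trans
        (Nat.mul_le_mul_left 4 (c.card_filter_dist_le v r))
      refine le_trans (Finset.card_le_card fun p hp => ?_) (c.card_startPos_le (srw e t) w)
      simp only [Finset.mem_filter, Finset.mem_univ, true_and] at hp ⊢
      exact hp.2
    have hcard' : ((Finset.univ.filter fun p : Fin n × Bool =>
        G.dist v (c.proj (startPos p + srw e t)) ≤ r).card : ℝ) ≤ 4 * (2 * r + 1) := by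
      exact_mod_cast hcard
    have hn : (0 : ℝ) < n := by exact_mod_cast Nat.pos_of_ne_zero (NeZero.ne n)
    rw [div_le_div_iff₀ (by positivity) hn]
    nlinarith

/-- An arc of length `L` has probability at least `L / (2 * n)` under any translate of the
initial distribution. -/
theorem le_startMeasure_real_arc [NeZero n] {L : ℕ} (hL : L ≤ n) (x a : ℤ) :
    (L : ℝ) / (2 * n) ≤ (startMeasure n).real {p | ∃ q : ℤ, x ≤ startPos p + a + q * c.period ∧
      startPos p + a + q * c.period < x + L} := by
  classical
  have hex : ∀ i : ℕ, ∃ p : Fin n × Bool, (c.period : ℤ) ∣ startPos p - (x + i - a) := fun i => by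
    obtain ⟨y, b, h⟩ := c.exists_dvd (x + i - a)
    exact ⟨(y, b), h⟩
  choose p hp using hex
  -- The targets `x + i` with `i < L ≤ n ≤ period` lie in distinct residue classes, so the starts
  -- chosen for them are distinct.
  have hinj : Set.InjOn p (Finset.range L : Finset ℕ) := by
    intro i hi j hj hij
    have h1 := dvd_sub (hp i) (hij ▸ hp j)
    have e1 : startPos (p i) - (x + i - a) - (startPos (p i) - (x + j - a)) = (j : ℤ) - i := by ring
    rw [e1] at h1
    have hi' := Finset.mem_range.1 (Finset.mem_coe.1 hi)
    have hj' := Finset.mem_range.1 (Finset.mem_coe.1 hj)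
    have hN := c.le_period
    have := Int.eq_zero_of_abs_lt_dvd h1 (by rw [abs_lt]; constructor <;> omega)
    omega
  have hcard := Finset.card_image_of_injOn hinj
  rw [Finset.card_range] at hcard
  have h1 := startMeasure_real ((Finset.range L).image p)
  rw [hcard] at h1
  rw [← h1]
  refine measureReal_mono ?_
  intro y hy
  obtain ⟨i, hi, rfl⟩ := Finset.mem_image.1 (Finset.mem_coe.1 hy)
  obtain ⟨q, hq⟩ := hp i
  have hi' := Finset.mem_range.1 hi
  have e1 : startPos (p i) + a + -q * c.period = x + i := by linear_combination hq
  refine ⟨-q, ?_, ?_⟩ <;> rw [e1] <;> omega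

/-- Agents that move from `[b - L, b)` beyond `b + L`. -/
def rightMovers (c : LineCover G) (L t u : ℕ) (b : ℤ) : Set (AgentSpace n) :=
  {ω | ∃ q : ℤ, b - L ≤ lift ω t + q * c.period ∧ lift ω t + q * c.period < b ∧
    b + L ≤ lift ω u + q * c.period}

/-- Agents that move from `[a, a + L)` to the left of `a`. -/
def leftMovers (c : LineCover G) (L t u : ℕ) (a : ℤ) : Set (AgentSpace n) :=
  {ω | ∃ q : ℤ, a ≤ lift ω t + q * c.period ∧ lift ω t + q * c.period < a + L ∧
    lift ω u + q * c.period ≤ a}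

theorem measurableSet_rightMovers (L t u : ℕ) (b : ℤ) : MeasurableSet (c.rightMovers L t u b) :=
  ((measurable_lift t).prodMk (measurable_lift u)) (MeasurableSet.of_discrete
    (s := {z : ℤ × ℤ | ∃ q : ℤ, b - L ≤ z.1 + q * c.period ∧ z.1 + q * c.period < b ∧
      b + L ≤ z.2 + q * c.period}))

theorem measurableSet_leftMovers (L t u : ℕ) (a : ℤ) : MeasurableSet (c.leftMovers L t u a) :=
  ((measurable_lift t).prodMk (measurable_lift u)) (MeasurableSet.of_discrete
    (s := {z : ℤ × ℤ | ∃ q : ℤ, a ≤ z.1 + q * c.period ∧ z.1 + q * c.period < a + L ∧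
      z.2 + q * c.period ≤ a}))

/-- For any frozen steps, the uniform start puts a lift in `[b - L, b)` with probability at least `L
/ (2 * n)`; the steps themselves gain `2 * L` in the window with probability at least `3 / 32`. -/
theorem le_agentMeasure_real_rightMovers [NeZero n] {L : ℕ} (hL : 0 < L) (hLn : L ≤ n) (t : ℕ)
    (b : ℤ) : (L : ℝ) / (2 * n) * (3 / 32) ≤
      (agentMeasure n).real (c.rightMovers L t (t + 16 * L ^ 2) b) := by
  have hm : MeasurableSet {e | 2 * (L : ℤ) ≤ srw e (16 * L ^ 2)} :=
    measurable_srw _ (MeasurableSet.of_discrete (s := {z | 2 * (L : ℤ) ≤ z}))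
  have h1 := le_agentMeasure_real (c.measurableSet_rightMovers L t (t + 16 * L ^ 2) b)
    (measurable_shiftSeq t hm) (q := L / (2 * n)) (fun e he => ?_)
  · refine le_trans ?_ h1
    have h2 := le_coins_real_le_srw L hL
    rw [← coins_real_shiftSeq t hm] at h2
    exact mul_le_mul_of_nonneg_left h2 (by positivity)
  · refine (c.le_startMeasure_real_arc hLn (b - L) (srw e t)).trans (measureReal_mono ?_)
    rintro p ⟨q, hq1, hq2⟩
    simp only [Set.mem_preimage, Set.mem_ofPred_eq] at he
    refine ⟨q, hq1, by simp only [lift]; linarith, ?_⟩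
    simp only [lift, srw_add]
    linarith

theorem le_agentMeasure_real_leftMovers [NeZero n] {L : ℕ} (hL : 0 < L) (hLn : L ≤ n) (t : ℕ)
    (a : ℤ) : (L : ℝ) / (2 * n) * (3 / 32) ≤
      (agentMeasure n).real (c.leftMovers L t (t + 16 * L ^ 2) a) := by
  have hm : MeasurableSet {e | 2 * (L : ℤ) ≤ - srw e (16 * L ^ 2)} :=
    measurable_srw _ (MeasurableSet.of_discrete (s := {z | 2 * (L : ℤ) ≤ - z}))
  have h1 := le_agentMeasure_real (c.measurableSet_leftMovers L t (t + 16 * L ^ 2) a)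
    (measurable_shiftSeq t hm) (q := L / (2 * n)) (fun e he => ?_)
  · refine le_trans ?_ h1
    have h2 := le_coins_real_le_srw L hL
    have h3 := coins_real_neg_srw (16 * L ^ 2) {z | 2 * (L : ℤ) ≤ z}
    simp only [Set.mem_ofPred_eq] at h3
    rw [← h3, ← coins_real_shiftSeq t hm] at h2
    exact mul_le_mul_of_nonneg_left h2 (by positivity)
  · refine (c.le_startMeasure_real_arc hLn a (srw e t)).trans (measureReal_mono ?_)
    rintro p ⟨q, hq1, hq2⟩
    simp only [Set.mem_preimage, Set.mem_ofPred_eq] at he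
    refine ⟨q, hq1, hq2, ?_⟩
    simp only [lift, srw_add]
    linarith

/-- Agents that start slightly to the right of `x`, are then seen on its left, and later far on
its right. -/
def zigzaggers (c : LineCover G) (L m t u : ℕ) (x : ℤ) : Set (AgentSpace n) :=
  {ω | ∃ q : ℤ, x ≤ lift ω 0 + q * c.period ∧ lift ω t + q * c.period ≤ x - m * L ∧
    x + (m + 2) * L ≤ lift ω u + q * c.period}

/-- A start in `[x, x + L)` together with the zigzag event is enough: `L - 2 * m * L ≤ -m * L` and
`m + 2 ≤ 16 * m`, because `0 < m`. -/
theorem le_agentMeasure_real_zigzaggers [NeZero n] {L m : ℕ} (hL : 0 < L) (hLn : L ≤ n)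
    (hm : 0 < m) (x : ℤ) : (L : ℝ) / (2 * n) * (1 / 16) ^ (17 * m) ≤ (agentMeasure n).real
      (c.zigzaggers L m (m * (16 * L ^ 2)) (17 * m * (16 * L ^ 2)) x) := by
  set t := m * (16 * L ^ 2)
  set u := 17 * m * (16 * L ^ 2)
  have hmeas : MeasurableSet (c.zigzaggers L m t u x) :=
    ((measurable_lift 0).prodMk ((measurable_lift t).prodMk (measurable_lift u)))
      (MeasurableSet.of_discrete (s := {z : ℤ × ℤ × ℤ | ∃ q : ℤ, x ≤ z.1 + q * c.period ∧
        z.2.1 + q * c.period ≤ x - m * L ∧ x + (m + 2) * L ≤ z.2.2 + q * c.period}))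
  have hE : MeasurableSet {e | srw e t ≤ -2 * m * L ∧ 16 * m * (L : ℤ) ≤ srw e u} :=
    ((measurable_srw t).prodMk (measurable_srw u)) (MeasurableSet.of_discrete
      (s := {z : ℤ × ℤ | z.1 ≤ -2 * m * L ∧ 16 * m * (L : ℤ) ≤ z.2}))
  have h1 := le_agentMeasure_real hmeas hE (q := L / (2 * n)) (fun e he => ?_)
  · exact (mul_le_mul_of_nonneg_left (le_coins_real_zigzag hL m) (by positivity)).trans h1
  · refine (c.le_startMeasure_real_arc hLn x 0).trans (measureReal_mono ?_)
    rintro p ⟨q, hq1, hq2⟩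
    obtain ⟨he1, he2⟩ := he
    have hm' : (1 : ℤ) ≤ m := by exact_mod_cast hm
    have hL' : (0 : ℤ) < L := by exact_mod_cast hL
    refine ⟨q, ?_, ?_, ?_⟩
    · simpa [lift] using hq1
    · simp only [lift]
      nlinarith
    · simp only [lift]
      nlinarith

end LineCover

end OneAgent

/-! ### Union bounds and conditioning for independent agents. -/

section IndependentAgents

variable {Ω : Type*} [MeasurableSpace Ω] {μ : Measure Ω} [IsProbabilityMeasure μ] {k : ℕ}

/-- Conditioning on all coordinates but one. -/
theorem pi_inter_le {A B : Set (Fin k → Ω)} (hA : MeasurableSet A) (hB : MeasurableSet B)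
    (i : Fin k) (hAi : ∀ ω y, Function.update ω i y ∈ A → ω ∈ A) {q : ENNReal}
    (hq : ∀ ω, μ {y | Function.update ω i y ∈ B} ≤ q) :
    Measure.pi (fun _ => μ) (A ∩ B) ≤ q * Measure.pi (fun _ => μ) A := by
  rw [← lintegral_indicator_one (hA.inter hB), ← lintegral_indicator_one hA,
    ← lintegral_const_mul q (measurable_one.indicator hA)]
  refine lintegral_le_of_lmarginal_le {i} (measurable_one.indicator (hA.inter hB))
    ((measurable_one.indicator hA).const_mul q) ?_
  rw [lmarginal_singleton, lmarginal_singleton]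
  intro ω
  dsimp only
  by_cases hω : ∃ y, Function.update ω i y ∈ A
  · obtain ⟨y₀, hy₀⟩ := hω
    have hall : ∀ y, Function.update ω i y ∈ A := by
      intro y
      refine hAi _ y₀ ?_
      rwa [Function.update_idem]
    have h1 : ∀ y, (A ∩ B).indicator (1 : (Fin k → Ω) → ENNReal) (Function.update ω i y) =
        {y | Function.update ω i y ∈ B}.indicator 1 y := by
      intro y
      by_cases h : Function.update ω i y ∈ B <;> simp [h, hall y]
    simp only [h1, Set.indicator_of_mem (hall _), Pi.one_apply, mul_one, lintegral_const,
      measure_univ]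
    refine (lintegral_indicator_one (s := {y | Function.update ω i y ∈ B})
      (measurable_update ω hB)).trans_le ?_
    exact hq ω
  · push Not at hω
    have h1 : ∀ y, (A ∩ B).indicator (1 : (Fin k → Ω) → ENNReal) (Function.update ω i y) = 0 :=
      fun y => Set.indicator_of_notMem (fun h => hω y h.1) _
    simp [h1]

theorem pi_real_inter_le {A B : Set (Fin k → Ω)} (hA : MeasurableSet A) (hB : MeasurableSet B)
    (i : Fin k) (hAi : ∀ ω y, Function.update ω i y ∈ A → ω ∈ A) {q : ℝ} (hq0 : 0 ≤ q)
    (hq : ∀ ω, μ.real {y | Function.update ω i y ∈ B} ≤ q) :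
    (Measure.pi fun _ => μ).real (A ∩ B) ≤ q * (Measure.pi fun _ => μ).real A := by
  have h := pi_inter_le hA hB i hAi (q := ENNReal.ofReal q) fun ω =>
    (ENNReal.le_ofReal_iff_toReal_le (by finiteness) hq0).2 (hq ω)
  have h' := ENNReal.toReal_mono (by finiteness) h
  rwa [ENNReal.toReal_mul, ENNReal.toReal_ofReal hq0] at h'

theorem measurableSet_pair {A : Set (Ω × Ω)} (hA : MeasurableSet A) (o i : Fin k) :
    MeasurableSet {ω : Fin k → Ω | (ω o, ω i) ∈ A} :=
  ((measurable_pi_apply o).prodMk (measurable_pi_apply i)) hA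

theorem pi_real_pair_le {A : Set (Ω × Ω)} (hA : MeasurableSet A) {q : ℝ} (hq0 : 0 ≤ q)
    (hq : ∀ x, μ.real {y | (x, y) ∈ A} ≤ q) {o i : Fin k} (hoi : i ≠ o) :
    (Measure.pi fun _ => μ).real {ω : Fin k → Ω | (ω o, ω i) ∈ A} ≤ q := by
  have h := pi_real_inter_le (μ := μ) MeasurableSet.univ (measurableSet_pair hA o i) i
    (fun _ _ _ => trivial) hq0 (fun ω => by
      simpa [Function.update_of_ne hoi.symm] using hq (ω o))
  simpa using h

theorem pi_real_exists_pair_le {A : Set (Ω × Ω)} (hA : MeasurableSet A) {q : ℝ} (hq0 : 0 ≤ q)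
    (hq : ∀ x, μ.real {y | (x, y) ∈ A} ≤ q) (o : Fin k) :
    (Measure.pi fun _ => μ).real {ω : Fin k → Ω | ∃ i, i ≠ o ∧ (ω o, ω i) ∈ A} ≤ k * q := by
  classical
  have hsub : {ω : Fin k → Ω | ∃ i, i ≠ o ∧ (ω o, ω i) ∈ A} ⊆
      ⋃ i ∈ Finset.univ.filter (· ≠ o), {ω : Fin k → Ω | (ω o, ω i) ∈ A} := by
    rintro ω ⟨i, hi, h⟩
    simp only [Set.mem_iUnion]
    exact ⟨i, by simpa using hi, h⟩
  refine (measureReal_mono hsub (measure_ne_top _ _)).trans ((measureReal_biUnion_finset_le _ _).trans ?_)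
  refine (Finset.sum_le_card_nsmul _ _ q fun i hi => pi_real_pair_le hA hq0 hq ?_).trans ?_
  · simpa using hi
  · rw [nsmul_eq_mul]
    refine mul_le_mul_of_nonneg_right ?_ hq0
    exact_mod_cast (Finset.card_le_univ _).trans (by simp)

theorem pi_real_eval {A : Set Ω} (hA : MeasurableSet A) (i : Fin k) :
    (Measure.pi fun _ => μ).real {ω : Fin k → Ω | ω i ∈ A} = μ.real A :=
  (measurePreserving_eval (fun _ : Fin k => μ) i).measureReal_preimage hA.nullMeasurableSet

theorem pi_real_exists_le {A : Set Ω} (hA : MeasurableSet A) :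
    (Measure.pi fun _ => μ).real {ω : Fin k → Ω | ∃ i, ω i ∈ A} ≤ k * μ.real A := by
  rw [Set.ofPred_exists]
  refine (measureReal_iUnion_fintype_le _).trans ?_
  simp [pi_real_eval hA]

/-- Given agent `o`, the others avoid `A` independently. The induction adds one agent at a time and
conditions on all coordinates but hers; `o` stays outside `S`, so its coordinate is never resampled.
-/
theorem pi_real_forall_notMem_le {A : Set (Ω × Ω)} (hA : MeasurableSet A) {p : ℝ} (hp1 : p ≤ 1)
    (hp : ∀ x, p ≤ μ.real {y | (x, y) ∈ A}) (o : Fin k) :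
    (Measure.pi fun _ => μ).real {ω : Fin k → Ω | ∀ i, i ≠ o → (ω o, ω i) ∉ A} ≤
      (1 - p) ^ (k - 1) := by
  classical
  have key : ∀ S : Finset (Fin k), o ∉ S →
      (Measure.pi fun _ => μ).real {ω : Fin k → Ω | ∀ i ∈ S, (ω o, ω i) ∉ A} ≤
        (1 - p) ^ S.card := by
    intro S
    induction S using Finset.induction_on with
    | empty => simp
    | insert i S hi ih =>
      intro ho
      rw [Finset.mem_insert, not_or] at ho
      have hset : {ω : Fin k → Ω | ∀ j ∈ insert i S, (ω o, ω j) ∉ A} =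
          {ω | ∀ j ∈ S, (ω o, ω j) ∉ A} ∩ {ω | (ω o, ω i) ∈ Aᶜ} := by
        ext ω
        simp only [Finset.mem_insert, forall_eq_or_imp, Set.mem_inter_iff, Set.mem_ofPred_eq,
          Set.mem_compl_iff]
        exact and_comm
      have hm : MeasurableSet {ω : Fin k → Ω | ∀ j ∈ S, (ω o, ω j) ∉ A} := by
        simp only [Set.ofPred_forall]
        exact MeasurableSet.iInter fun j => MeasurableSet.iInter fun _ =>
          measurableSet_pair hA.compl o j
      rw [hset, Finset.card_insert_of_notMem hi, pow_succ']
      refine (pi_real_inter_le hm (measurableSet_pair hA.compl o i) i (q := 1 - p) ?_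
        (sub_nonneg.2 hp1) ?_).trans (mul_le_mul_of_nonneg_left (ih ho.2) (sub_nonneg.2 hp1))
      · intro ω y hω j hj
        have := hω j hj
        rwa [Function.update_of_ne ho.1, Function.update_of_ne (by rintro rfl; exact hi hj)] at this
      · intro ω
        simp only [Set.mem_ofPred_eq, Function.update_of_ne ho.1, Function.update_self]
        have h1 : MeasurableSet {y | (ω o, y) ∈ A} := measurable_prodMk_left hA
        have h2 := probReal_compl_eq_one_sub (μ := μ) h1
        have h3 := hp (ω o)
        change μ.real {y | (ω o, y) ∈ A}ᶜ ≤ _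
        linarith
  have h := key (Finset.univ.erase o) (Finset.notMem_erase o _)
  rw [Finset.card_erase_of_mem (Finset.mem_univ o), Finset.card_univ, Fintype.card_fin] at h
  simpa using h

/-- Agents of the chain are revealed in order: given its predecessor, each one contributes a factor
`q`. Injectivity of `f` makes the last agent fresh. -/
theorem pi_real_chain_le {A : Set (Ω × Ω)} (hA : MeasurableSet A) {q : ℝ} (hq0 : 0 ≤ q)
    (hq : ∀ x, μ.real {y | (x, y) ∈ A} ≤ q) {m : ℕ} {f : Fin (m + 1) → Fin k}
    (hf : Function.Injective f) :
    (Measure.pi fun _ => μ).real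
      {ω : Fin k → Ω | ∀ l : Fin m, (ω (f l.castSucc), ω (f l.succ)) ∈ A} ≤ q ^ m := by
  induction m with
  | zero => simp
  | succ m ih =>
    have hset : {ω : Fin k → Ω | ∀ l : Fin (m + 1), (ω (f l.castSucc), ω (f l.succ)) ∈ A} =
        {ω | ∀ l : Fin m, (ω (f l.castSucc.castSucc), ω (f l.castSucc.succ)) ∈ A} ∩
          {ω | (ω (f (Fin.last m).castSucc), ω (f (Fin.last (m + 1)))) ∈ A} := by
      ext ω
      simp only [Set.mem_ofPred_eq, Set.mem_inter_iff, Fin.forall_fin_succ', Fin.succ_last]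
    rw [hset, pow_succ']
    have hm : MeasurableSet {ω : Fin k → Ω |
        ∀ l : Fin m, (ω (f l.castSucc.castSucc), ω (f l.castSucc.succ)) ∈ A} := by
      simp only [Set.ofPred_forall]
      exact MeasurableSet.iInter fun l => measurableSet_pair hA _ _
    refine (pi_real_inter_le hm (measurableSet_pair hA _ _) (f (Fin.last (m + 1))) ?_ hq0 ?_).trans
      (mul_le_mul_of_nonneg_left (ih (f := fun l => f l.castSucc)
        (hf.comp (Fin.castSucc_injective _))) hq0)
    · intro ω y hω l
      have := hω l
      rwa [Function.update_of_ne (hf.ne (Fin.castSucc_lt_last _).ne), Fin.succ_castSucc,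
        Function.update_of_ne (hf.ne (Fin.castSucc_lt_last _).ne), ← Fin.succ_castSucc] at this
    · intro ω
      simp only [Set.mem_ofPred_eq, Function.update_self,
        Function.update_of_ne (hf.ne (Fin.castSucc_lt_last (Fin.last m)).ne)]
      exact hq _

/-- There are at most `k ^ (m + 1)` chains, so long chains are exponentially unlikely in `m` as soon
as `k * q < 1`, the subcritical case. -/
theorem pi_real_exists_chain_le {A : Set (Ω × Ω)} (hA : MeasurableSet A) {q : ℝ} (hq0 : 0 ≤ q)
    (hq : ∀ x, μ.real {y | (x, y) ∈ A} ≤ q) (m : ℕ) :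
    (Measure.pi fun _ => μ).real {ω : Fin k → Ω | ∃ f : Fin (m + 1) → Fin k,
      Function.Injective f ∧ ∀ l : Fin m, (ω (f l.castSucc), ω (f l.succ)) ∈ A} ≤
        k * (k * q) ^ m := by
  classical
  have hsub : {ω : Fin k → Ω | ∃ f : Fin (m + 1) → Fin k,
      Function.Injective f ∧ ∀ l : Fin m, (ω (f l.castSucc), ω (f l.succ)) ∈ A} ⊆
      ⋃ f ∈ Finset.univ.filter (fun f : Fin (m + 1) → Fin k => Function.Injective f),
        {ω : Fin k → Ω | ∀ l : Fin m, (ω (f l.castSucc), ω (f l.succ)) ∈ A} := by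
    rintro ω ⟨f, hf, h⟩
    simp only [Set.mem_iUnion]
    exact ⟨f, by simpa using hf, h⟩
  refine (measureReal_mono hsub (measure_ne_top _ _)).trans ((measureReal_biUnion_finset_le _ _).trans ?_)
  refine (Finset.sum_le_card_nsmul _ _ (q ^ m) fun f hf => pi_real_chain_le hA hq0 hq ?_).trans ?_
  · simpa using hf
  · rw [nsmul_eq_mul, mul_pow, ← mul_assoc, ← pow_succ']
    refine mul_le_mul_of_nonneg_right ?_ (by positivity)
    exact_mod_cast (Finset.card_le_univ _).trans (by simp)

end IndependentAgents

/-! ### Transfer from the driving coins to the law of the agents. -/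

section Transfer

variable {n : ℕ} {G : SimpleGraph (Fin n)} (c : LineCover G) (k : ℕ)

/-- The joint law of the randomness driving the agents. -/
def allAgents (n k : ℕ) : Measure (Fin k → AgentSpace n) := Measure.pi fun _ => agentMeasure n

instance [NeZero n] : IsProbabilityMeasure (allAgents n k) := by
  unfold allAgents
  infer_instance

def trajs (ω : Fin k → AgentSpace n) (i : Fin k) : ℕ → Fin n := c.traj (ω i)

theorem map_trajs [NeZero n] : (allAgents n k).map (trajs c k) = agentsLaw G k := by
  have : ∀ i : Fin k, SigmaFinite ((agentMeasure n).map c.traj) := fun i => by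
    rw [c.map_traj]
    infer_instance
  rw [agentsLaw, ← c.map_traj, allAgents]
  exact Measure.pi_map_pi (f := fun _ : Fin k => c.traj) fun _ => c.measurable_traj.aemeasurable

/-- `Measure.le_map_apply` holds for arbitrary sets, so events about the broadcasting time need not
be shown measurable. -/
theorem le_agentsLaw [NeZero n] {E : Set (Fin k → ℕ → Fin n)} {ε : ℝ}
    (h : (allAgents n k).real {ω | trajs c k ω ∉ E} ≤ ε) :
    1 - ENNReal.ofReal ε ≤ agentsLaw G k E := by
  have hm : Measurable (trajs c k) :=
    measurable_pi_iff.2 fun i => c.measurable_traj.comp (measurable_pi_apply i)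
  rw [← map_trajs c k]
  refine le_trans ?_ (Measure.le_map_apply hm.aemeasurable E)
  rw [tsub_le_iff_right]
  have h1 : (1 : ENNReal) = allAgents n k (trajs c k ⁻¹' E ∪ {ω | trajs c k ω ∉ E}) := by
    rw [show {ω | trajs c k ω ∉ E} = (trajs c k ⁻¹' E)ᶜ from rfl, Set.union_compl_self,
      measure_univ]
  rw [h1]
  refine (measure_union_le _ _).trans (add_le_add le_rfl ?_)
  exact (ENNReal.le_ofReal_iff_toReal_le (by finiteness) (measureReal_nonneg.trans h)).2 h

/-- To show that an event holds a.a.s. it is enough to bound the probability of its failure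
in the model with covers. -/
theorem aas_of_forall {G : (n : ℕ) → SimpleGraph (Fin n)}
    (hG : G = SimpleGraph.pathGraph ∨ G = SimpleGraph.cycleGraph) {k : ℕ → ℕ}
    {E : ℕ → ℕ∞ → Prop}
    (h : ∀ ε > 0, ∀ᶠ n in atTop, ∀ _ : NeZero n, ∀ c : LineCover (G n),
      (allAgents n (k n)).real {ω | ¬ E n (broadcastTime (trajs c (k n) ω))} ≤ ε) :
    AAS G k E := by
  refine ENNReal.tendsto_nhds_of_Icc fun ε hε => ?_
  obtain ⟨ε', hε', hlt⟩ : ∃ ε' : ℝ, 0 < ε' ∧ ENNReal.ofReal ε' ≤ ε := by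
    by_cases htop : ε = ⊤
    · exact ⟨1, one_pos, htop ▸ le_top⟩
    · exact ⟨ε.toReal, ENNReal.toReal_pos hε.ne' htop, ENNReal.ofReal_toReal_le⟩
  filter_upwards [h ε' hε', eventually_ge_atTop 2] with n hn hn2
  have hn0 : NeZero n := ⟨by omega⟩
  obtain ⟨c⟩ := exists_lineCover hG hn2
  refine ⟨(tsub_le_tsub_left hlt 1).trans (le_agentsLaw c (k n) (E := {X | E n (broadcastTime X)})
    (hn hn0 c)), ?_⟩
  have : IsProbabilityMeasure (agentsLaw (G n) (k n)) := by
    unfold agentsLaw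
    infer_instance
  exact prob_le_one.trans le_self_add

end Transfer

/-! ### Upper bounds: creation and growth of a green interval. -/

section UpperBounds

variable {n : ℕ} {G : SimpleGraph (Fin n)} (c : LineCover G) {k : ℕ}

theorem mem_green_zero {V : Type*} {X : Fin k → ℕ → V} {o : Fin k} (ho : (o : ℕ) = 0) :
    o ∈ green X 0 := ⟨o, ho, rfl⟩

/-- The lifts of the agents to the line. -/
def lifts (ω : Fin k → AgentSpace n) (i : Fin k) : ℕ → ℤ := lift (ω i)

theorem isNNPath_lifts (ω : Fin k → AgentSpace n) (i : Fin k) : IsNNPath (lifts ω i) :=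
  isNNPath_lift (ω i)

theorem trajs_eq (ω : Fin k → AgentSpace n) (i : Fin k) (t : ℕ) :
    trajs c k ω i t = c.proj (lifts ω i t) := rfl

theorem measurableSet_displaced (t s d : ℕ) :
    MeasurableSet {ω : AgentSpace n | ∃ u ≤ s, (d : ℤ) ≤ |lift ω (t + u) - lift ω t|} := by
  have : {ω : AgentSpace n | ∃ u ≤ s, (d : ℤ) ≤ |lift ω (t + u) - lift ω t|} =
      ⋃ u, ⋃ _ : u ≤ s, {ω : AgentSpace n | (d : ℤ) ≤ |lift ω (t + u) - lift ω t|} := by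
    ext ω; simp
  rw [this]
  exact MeasurableSet.iUnion fun u => MeasurableSet.iUnion fun _ =>
    ((measurable_lift (t + u)).prodMk (measurable_lift t))
      (MeasurableSet.of_discrete (s := {z : ℤ × ℤ | (d : ℤ) ≤ |z.1 - z.2|}))

/-- The endpoint of the green interval is random, but mover sets depend on it only modulo the
period, so the union bound over endpoints is finite. -/
theorem mem_rightMovers_add_period {L t u : ℕ} {b : ℤ} (r : ℤ) {ω : AgentSpace n}
    (h : ω ∈ c.rightMovers L t u b) : ω ∈ c.rightMovers L t u (b + r * c.period) := by
  obtain ⟨q, h1, h2, h3⟩ := h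
  refine ⟨q + r, ?_, ?_, ?_⟩ <;> rw [add_mul] <;> linarith

theorem mem_leftMovers_add_period {L t u : ℕ} {a : ℤ} (r : ℤ) {ω : AgentSpace n}
    (h : ω ∈ c.leftMovers L t u a) : ω ∈ c.leftMovers L t u (a + r * c.period) := by
  obtain ⟨q, h1, h2, h3⟩ := h
  refine ⟨q + r, ?_, ?_, ?_⟩ <;> rw [add_mul] <;> linarith

variable [NeZero n]

theorem period_pos : (0 : ℤ) < c.period := by
  have := c.le_period
  have := Nat.pos_of_ne_zero (NeZero.ne n)
  omega

/-- Creation of a first interval of green agents. -/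
theorem allAgents_real_no_interval_le {o : Fin k} (ho : (o : ℕ) = 0) {L m : ℕ} (hL : 0 < L)
    (hLn : L ≤ n) (hm : 0 < m) :
    (allAgents n k).real {ω | ¬ ∃ a, GreenOn (trajs c k ω) (lifts ω) c.period
      (17 * m * (16 * L ^ 2)) a (a + 2 * L)} ≤ 2 * Real.exp (-((m : ℝ) / 544)) +
        (1 - (L : ℝ) / (2 * n) * (1 / 16) ^ (17 * m)) ^ (k - 1) := by
  set t := m * (16 * L ^ 2) with ht
  set u := 17 * m * (16 * L ^ 2) with hu
  have hu0 : 0 < u := by positivity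
  have htu : t ≤ u := by rw [ht, hu]; gcongr; omega
  set D : Set (AgentSpace n) :=
    {ω | ∃ v ≤ u, ((m * L : ℕ) : ℤ) ≤ |lift ω (0 + v) - lift ω 0|} with hD
  set A : Set (AgentSpace n × AgentSpace n) :=
    {p | p.2 ∈ c.zigzaggers L m t u (lift p.1 0)} with hA
  have hAm : MeasurableSet A :=
    (((measurable_lift 0).comp measurable_fst).prodMk
      (((measurable_lift 0).comp measurable_snd).prodMk
        (((measurable_lift t).comp measurable_snd).prodMk
          ((measurable_lift u).comp measurable_snd))))
      (MeasurableSet.of_discrete (s := {z : ℤ × ℤ × ℤ × ℤ | ∃ q : ℤ, z.1 ≤ z.2.1 + q * c.period ∧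
        z.2.2.1 + q * c.period ≤ z.1 - m * L ∧ z.1 + (m + 2) * L ≤ z.2.2.2 + q * c.period}))
  have hsub : {ω | ¬ ∃ a, GreenOn (trajs c k ω) (lifts ω) c.period u a (a + 2 * L)} ⊆
      {ω | ω o ∈ D} ∪ {ω | ∀ i, i ≠ o → (ω o, ω i) ∉ A} := by
    intro ω hω
    by_contra hcon
    simp only [Set.mem_union, Set.mem_ofPred_eq, not_or, not_forall, not_not] at hcon
    obtain ⟨hoD, i, -, q, h1, h2, h3⟩ := hcon
    simp only [hD, Set.mem_ofPred_eq, not_exists, not_and, not_le, zero_add, abs_lt] at hoD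
    have d1 := hoD t htu
    have d2 := hoD u le_rfl
    push_cast at d1 d2
    -- The green agent stays within `m * L` of her start, so an agent seen below `x - m * L` and
    -- later beyond `x + (m + 2) * L` has crossed her both times, finally with room `2 * L`.
    refine hω ⟨_, greenOn_of_double_crossing (isNNPath_lifts ω) (trajs_eq c ω) c.proj_add_period
      (Nat.zero_le t) htu (g := o) (h := i) (q := q) (mem_green_zero ho) h1 ?_ ?_⟩
    · simp only [lifts] at h2 ⊢
      linarith
    · simp only [lifts] at h3 ⊢
      linarith
  refine (measureReal_mono hsub).trans ((measureReal_union_le _ _).trans (add_le_add ?_ ?_))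
  · rw [allAgents, pi_real_eval (measurableSet_displaced 0 u (m * L))]
    refine (agentMeasure_real_displacement_le 0 hu0).trans (le_of_eq ?_)
    have hL' : (0 : ℝ) < L := by exact_mod_cast hL
    have hm' : (0 : ℝ) < m := by exact_mod_cast hm
    congr 3
    rw [hu]
    push_cast
    field_simp
    norm_num
  · refine pi_real_forall_notMem_le hAm ?_ (fun x =>
      c.le_agentMeasure_real_zigzaggers hL hLn hm (lift x 0)) o
    exact (c.le_agentMeasure_real_zigzaggers hL hLn hm 0).trans measureReal_le_one

theorem exists_natCast_add_period (b : ℤ) :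
    ∃ b₀ < c.period, ∃ r : ℤ, b = (b₀ : ℕ) + r * c.period := by
  have hN := period_pos c
  have h1 := Int.emod_nonneg b hN.ne'
  have h2 := Int.emod_lt_of_pos b hN
  have h3 := Int.mul_ediv_add_emod b c.period
  refine ⟨(b % c.period).toNat, by omega, b / c.period, ?_⟩
  rw [Int.toNat_of_nonneg h1]
  linarith

theorem allAgents_real_no_mover_le {o : Fin k} {A : Set (AgentSpace n)} (hA : MeasurableSet A)
    {p : ℝ} (hp : p ≤ (agentMeasure n).real A) :
    (allAgents n k).real {ω | ∀ i, i ≠ o → ω i ∉ A} ≤ (1 - p) ^ (k - 1) :=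
  pi_real_forall_notMem_le (A := {x : AgentSpace n × AgentSpace n | x.2 ∈ A}) (measurable_snd hA)
    (hp.trans measureReal_le_one) (fun _ => hp) o

/-- The main upper bound: with high probability everybody is green after `17 * m + J` stages of
length `16 * L ^ 2`. -/
theorem allAgents_real_not_all_green_le {o : Fin k} (ho : (o : ℕ) = 0) {L m J : ℕ} (hL : 0 < L)
    (hLn : L ≤ n) (hm : 0 < m) (hJ : 2 * n ≤ (J + 2) * L) :
    (allAgents n k).real {ω | ¬ ∀ i, i ∈ green (trajs c k ω) ((17 * m + J) * (16 * L ^ 2))} ≤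
      2 * Real.exp (-((m : ℝ) / 544)) +
        (1 - (L : ℝ) / (2 * n) * (1 / 16) ^ (17 * m)) ^ (k - 1) +
        4 * J * n * (1 - (L : ℝ) / (2 * n) * (3 / 32)) ^ (k - 1) := by
  classical
  set s := 16 * L ^ 2 with hs
  set t : ℕ → ℕ := fun j => 17 * m * s + j * s with ht
  have hts : ∀ j, t (j + 1) = t j + s := fun j => by simp only [ht]; ring
  set p : ℝ := (L : ℝ) / (2 * n) * (3 / 32) with hp
  set R : ℕ × ℕ → Set (Fin k → AgentSpace n) := fun x =>
    {ω | ∀ i, i ≠ o → ω i ∉ c.rightMovers L (t x.1) (t (x.1 + 1)) x.2} with hR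
  set Q : ℕ × ℕ → Set (Fin k → AgentSpace n) := fun x =>
    {ω | ∀ i, i ≠ o → ω i ∉ c.leftMovers L (t x.1) (t (x.1 + 1)) x.2} with hQ
  set F := Finset.range J ×ˢ Finset.range c.period with hF
  have hsub : {ω | ¬ ∀ i, i ∈ green (trajs c k ω) ((17 * m + J) * s)} ⊆
      {ω | ¬ ∃ a, GreenOn (trajs c k ω) (lifts ω) c.period (17 * m * s) a (a + 2 * L)} ∪
        ⋃ x ∈ F, (R x ∪ Q x) := by
    intro ω hω
    by_contra hcon
    rw [Set.mem_union, not_or] at hcon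
    obtain ⟨h0, hmov⟩ := hcon
    obtain ⟨a, ha⟩ := not_not.1 h0
    simp only [Set.mem_iUnion, Set.mem_union, not_exists, not_or] at hmov
    have hmovR : ∀ j < J, ∀ b : ℤ, ∃ i, ω i ∈ c.rightMovers L (t j) (t (j + 1)) b := by
      intro j hj b
      obtain ⟨b₀, hb₀, r, rfl⟩ := exists_natCast_add_period c b
      have h := (hmov (j, b₀) (Finset.mem_product.2 ⟨Finset.mem_range.2 hj,
        Finset.mem_range.2 hb₀⟩)).1
      simp only [hR, Set.mem_ofPred_eq, not_forall, not_not] at h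
      obtain ⟨i, -, hi⟩ := h
      exact ⟨i, mem_rightMovers_add_period c r hi⟩
    have hmovL : ∀ j < J, ∀ b : ℤ, ∃ i, ω i ∈ c.leftMovers L (t j) (t (j + 1)) b := by
      intro j hj b
      obtain ⟨b₀, hb₀, r, rfl⟩ := exists_natCast_add_period c b
      have h := (hmov (j, b₀) (Finset.mem_product.2 ⟨Finset.mem_range.2 hj,
        Finset.mem_range.2 hb₀⟩)).2
      simp only [hQ, Set.mem_ofPred_eq, not_forall, not_not] at h
      obtain ⟨i, -, hi⟩ := h
      exact ⟨i, mem_leftMovers_add_period c r hi⟩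
    -- Each stage moves only the right end, by `L`. The last interval has length `(J + 2) * L ≥ 2 *
    -- n`, which is at least a period.
    have key : ∀ j ≤ J, GreenOn (trajs c k ω) (lifts ω) c.period (t j) a (a + (j + 2) * L) := by
      intro j hj
      induction j with
      | zero => simpa [ht] using ha
      | succ j ih =>
        obtain ⟨i, q, hi⟩ := hmovR j (by omega) (a + (j + 2) * L)
        obtain ⟨i', q', hi'⟩ := hmovL j (by omega) a
        have := (ih (by omega)).extend (isNNPath_lifts ω) (trajs_eq c ω) c.proj_add_period
          (u := t (j + 1)) (by rw [hts]; omega) (L := L) (by nlinarith) ⟨i, q, hi⟩ ⟨i', q', hi'⟩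
        have e : a + ((j + 1 : ℕ) + 2) * (L : ℤ) = a + (j + 2) * L + L := by push_cast; ring
        rw [e]
        exact this
    refine hω fun i => ?_
    have e : (17 * m + J) * s = t J := by simp only [ht]; ring
    rw [e]
    refine (key J le_rfl).all_green (period_pos c) ?_ i
    have h1 : (c.period : ℤ) ≤ 2 * n := by exact_mod_cast c.period_le
    have h2 : (2 * n : ℤ) ≤ (J + 2) * L := by exact_mod_cast hJ
    linarith
  have hp0 : 0 ≤ (1 - p) ^ (k - 1) := by
    have := (c.le_agentMeasure_real_rightMovers hL hLn 0 0).trans measureReal_le_one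
    exact pow_nonneg (sub_nonneg.2 this) _
  refine (measureReal_mono hsub (measure_ne_top _ _)).trans ((measureReal_union_le _ _).trans
    (add_le_add (allAgents_real_no_interval_le c ho hL hLn hm) ?_))
  refine (measureReal_biUnion_finset_le _ _).trans ?_
  refine (Finset.sum_le_card_nsmul _ _ (2 * (1 - p) ^ (k - 1)) fun x _ => ?_).trans ?_
  · refine (measureReal_union_le _ _).trans ?_
    rw [two_mul]
    refine add_le_add ?_ ?_
    · refine allAgents_real_no_mover_le (c.measurableSet_rightMovers _ _ _ _) ?_
      rw [hts]
      exact c.le_agentMeasure_real_rightMovers hL hLn (t x.1) x.2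
    · refine allAgents_real_no_mover_le (c.measurableSet_leftMovers _ _ _ _) ?_
      rw [hts]
      exact c.le_agentMeasure_real_leftMovers hL hLn (t x.1) x.2
  · rw [nsmul_eq_mul, hF, Finset.card_product, Finset.card_range, Finset.card_range]
    have h1 : (c.period : ℝ) ≤ 2 * n := by exact_mod_cast c.period_le
    calc ((J * c.period : ℕ) : ℝ) * (2 * (1 - p) ^ (k - 1))
        = 2 * J * c.period * (1 - p) ^ (k - 1) := by push_cast; ring
      _ ≤ 2 * J * (2 * n) * (1 - p) ^ (k - 1) := by gcongr
      _ = 4 * J * n * (1 - p) ^ (k - 1) := by ring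

/-- Upper bound through the meetings with the initial green agent only. -/
theorem allAgents_real_not_all_met_le {o : Fin k} (ho : (o : ℕ) = 0) (M : ℕ) :
    (allAgents n k).real
      {ω | ¬ ∀ i, i ∈ green (trajs c k ω) (M * (16 * c.period ^ 2))} ≤ k * (29 / 32) ^ M := by
  set N := c.period
  set s := 16 * N ^ 2
  have hN : 0 < N := by have := period_pos c; omega
  set A : Set (AgentSpace n × AgentSpace n) := {p | ∀ j < M,
    |lift p.2 ((j + 1) * s) - lift p.2 (j * s) -
      (lift p.1 ((j + 1) * s) - lift p.1 (j * s))| < N} with hA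
  have hAm : MeasurableSet A := by
    simp only [hA, Set.ofPred_forall]
    exact MeasurableSet.iInter fun j => MeasurableSet.iInter fun _ =>
      (((measurable_lift ((j + 1) * s)).comp measurable_snd).prodMk
        (((measurable_lift (j * s)).comp measurable_snd).prodMk
          (((measurable_lift ((j + 1) * s)).comp measurable_fst).prodMk
            ((measurable_lift (j * s)).comp measurable_fst))))
      (MeasurableSet.of_discrete
        (s := {z : ℤ × ℤ × ℤ × ℤ | |z.1 - z.2.1 - (z.2.2.1 - z.2.2.2)| < N}))
  refine le_trans (measureReal_mono ?_) (pi_real_exists_pair_le hAm (by positivity)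
    (fun x => agentMeasure_real_follow_le hN M
      fun j => lift x ((j + 1) * s) - lift x (j * s)) o)
  intro ω hω
  simp only [Set.mem_ofPred_eq, not_forall] at hω
  obtain ⟨i, hi⟩ := hω
  refine ⟨i, ?_, fun j hj => ?_⟩
  · rintro rfl
    exact hi (green_mono (Nat.zero_le _) (mem_green_zero ho))
  · obtain ⟨q, hq⟩ := mem_green_of_gap (isNNPath_lifts ω) (trajs_eq c ω) c.proj_add_period
      (period_pos c) (Nat.zero_le _) (mem_green_zero ho) hi
    have h1 := hq (j * s) (Nat.zero_le _) (Nat.mul_le_mul_right s hj.le)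
    have h2 := hq ((j + 1) * s) (Nat.zero_le _) (Nat.mul_le_mul_right s hj)
    simp only [lifts] at h1 h2
    rw [abs_lt]
    constructor <;> linarith

end UpperBounds

/-! ### Lower bounds: isolation, finite speed and small clusters. -/

section LowerBounds

variable {n : ℕ} {G : SimpleGraph (Fin n)} (c : LineCover G) {k : ℕ}

theorem measurableSet_dist (t u r : ℕ) : MeasurableSet
    {p : AgentSpace n × AgentSpace n | G.dist (c.traj p.1 t) (c.traj p.2 u) ≤ r} :=
  (((measurable_pi_apply t).comp (c.measurable_traj.comp measurable_fst)).prodMk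
    ((measurable_pi_apply u).comp (c.measurable_traj.comp measurable_snd)))
    (MeasurableSet.of_discrete (s := {v : Fin n × Fin n | G.dist v.1 v.2 ≤ r}))

theorem dist_traj_le_of_not_displaced {ω : AgentSpace n} {t s d : ℕ}
    (h : ¬ ∃ u ≤ s, ((d + 1 : ℕ) : ℤ) ≤ |lift ω (t + u) - lift ω t|) {v : ℕ} (htv : t ≤ v)
    (hv : v ≤ t + s) : G.dist (c.traj ω t) (c.traj ω v) ≤ d := by
  push Not at h
  have h1 := h (v - t) (by omega)
  rw [Nat.add_sub_cancel' htv] at h1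
  have h2 := c.dist_traj_le ω t v
  omega

variable [NeZero n]

theorem allAgents_real_exists_displaced_le (t : ℕ) {s d : ℕ} (hs : 0 < s) :
    (allAgents n k).real
      {ω | ∃ i, ∃ u ≤ s, ((d + 1 : ℕ) : ℤ) ≤ |lift (ω i) (t + u) - lift (ω i) t|} ≤
      k * (2 * Real.exp (-(((d : ℝ) + 1) ^ 2 / (2 * s)))) := by
  refine (pi_real_exists_le (measurableSet_displaced t s (d + 1))).trans ?_
  have := agentMeasure_real_displacement_le (n := n) t (d := d + 1) hs
  push_cast at this ⊢
  gcongr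

/-- The initial green agent is likely to be isolated for a while. -/
theorem allAgents_real_exists_green_le {o : Fin k} (ho : (o : ℕ) = 0) {s d : ℕ} (hs : 0 < s) :
    (allAgents n k).real {ω | ∃ i, i ≠ o ∧ i ∈ green (trajs c k ω) s} ≤
      k * (2 * Real.exp (-(((d : ℝ) + 1) ^ 2 / (2 * s)))) + k * (2 * (4 * d + 1) / n) := by
  set A := {p : AgentSpace n × AgentSpace n | G.dist (c.traj p.1 0) (c.traj p.2 0) ≤ 2 * d}
  have hsub : {ω | ∃ i, i ≠ o ∧ i ∈ green (trajs c k ω) s} ⊆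
      {ω | ∃ i, ∃ u ≤ s, ((d + 1 : ℕ) : ℤ) ≤ |lift (ω i) (0 + u) - lift (ω i) 0|} ∪
        {ω | ∃ i, i ≠ o ∧ (ω o, ω i) ∈ A} := by
    rintro ω ⟨i, hio, hi⟩
    by_contra hcon
    simp only [Set.mem_union, not_or] at hcon
    obtain ⟨h1, h2⟩ := hcon
    simp only [Set.mem_ofPred_eq, not_exists (p := fun i : Fin k => ∃ u ≤ s, _)] at h1
    refine hio (eq_of_mem_green_of_isolated c.connected (d := d) (u := s) (fun i v hv => ?_) ho
      (fun i hi => ?_) hi)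
    · exact dist_traj_le_of_not_displaced c (h1 i) (Nat.zero_le v) (by omega)
    · by_contra hle
      exact h2 ⟨i, hi, not_lt.1 hle⟩
  refine (measureReal_mono hsub).trans ((measureReal_union_le _ _).trans (add_le_add
    (allAgents_real_exists_displaced_le 0 hs)
    (pi_real_exists_pair_le (measurableSet_dist c 0 0 (2 * d)) (by positivity) (fun x => ?_) o)))
  refine (c.agentMeasure_real_dist_le 0 (c.traj x 0) (2 * d)).trans (le_of_eq ?_)
  push_cast
  ring

/-- The displacement estimate needs a window of positive length; this handles time 0. -/
theorem allAgents_real_all_green_zero_le {o i : Fin k} (ho : (o : ℕ) = 0) (hi : i ≠ o) :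
    (allAgents n k).real {ω | i ∈ green (trajs c k ω) 0} ≤ 2 / n := by
  have hsub : {ω | i ∈ green (trajs c k ω) 0} ⊆ {ω | (ω o, ω i) ∈
      {p : AgentSpace n × AgentSpace n | G.dist (c.traj p.1 0) (c.traj p.2 0) ≤ 0}} := by
    rintro ω ⟨j, hj, hij⟩
    have : j = o := Fin.ext (hj.trans ho.symm)
    subst this
    have h : c.traj (ω i) 0 = c.traj (ω j) 0 := hij
    simp [h]
  refine (measureReal_mono hsub).trans (pi_real_pair_le (measurableSet_dist c 0 0 0)
    (by positivity) (fun x => ?_) hi)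
  simpa using c.agentMeasure_real_dist_le 0 (c.traj x 0) 0

/-- It is unlikely that all agents are close to the starting point of the green agent. -/
theorem allAgents_real_all_close_le {o : Fin k} (t : ℕ) {r : ℕ}
    (hr : 2 * (2 * (r : ℝ) + 1) / n ≤ 1 / 2) :
    (allAgents n k).real {ω | ∀ i, i ≠ o → G.dist (trajs c k ω o 0) (trajs c k ω i t) ≤ r} ≤
      (1 / 2) ^ (k - 1) := by
  have h := pi_real_forall_notMem_le (μ := agentMeasure n) (p := 1 / 2) (o := o)
    (measurableSet_dist c 0 t r).compl (by norm_num) (fun x => ?_)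
  · norm_num at h
    exact h
  · have h1 : MeasurableSet {y | G.dist (c.traj x 0) (c.traj y t) ≤ r} :=
      measurable_prodMk_left (measurableSet_dist c 0 t r)
    have h2 := probReal_compl_eq_one_sub (μ := agentMeasure n) h1
    have h3 := c.agentMeasure_real_dist_le t (c.traj x 0) r
    change 1 / 2 ≤ (agentMeasure n).real {y | G.dist (c.traj x 0) (c.traj y t) ≤ r}ᶜ
    linarith

/-- Information travels at speed at most one. -/
theorem allAgents_real_all_green_le {o : Fin k} (ho : (o : ℕ) = 0) {t : ℕ}
    (ht : 2 * (2 * (t : ℝ) + 1) / n ≤ 1 / 2) :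
    (allAgents n k).real {ω | ∀ i, i ∈ green (trajs c k ω) t} ≤ (1 / 2) ^ (k - 1) := by
  refine le_trans (measureReal_mono ?_) (allAgents_real_all_close_le c (o := o) t ht)
  intro ω hω i _
  exact dist_le_of_mem_green c.connected (fun i t => c.dist_traj_succ_le (ω i) t) ho (hω i)

/-- In the sparse regime, information only travels within small clusters of agents during a
window of length `s`. -/
theorem allAgents_real_all_green_windows_le {o : Fin k} (ho : (o : ℕ) = 0) {s d m J : ℕ}
    (hs : 0 < s) (hR : 2 * (2 * ((J * ((2 * m + 1) * d) : ℕ) : ℝ) + 1) / n ≤ 1 / 2) :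
    (allAgents n k).real {ω | ∀ i, i ∈ green (trajs c k ω) (J * s)} ≤
      J * (k * (2 * Real.exp (-(((d : ℝ) + 1) ^ 2 / (2 * s)))) +
        k * (k * (2 * (4 * d + 1) / n)) ^ m) + (1 / 2) ^ (k - 1) := by
  set A : ℕ → Set (AgentSpace n × AgentSpace n) := fun j =>
    {p | G.dist (c.traj p.1 (j * s)) (c.traj p.2 (j * s)) ≤ 2 * d} with hA
  set D : ℕ → Set (Fin k → AgentSpace n) := fun j => {ω | ∃ i, ∃ u ≤ s,
    ((d + 1 : ℕ) : ℤ) ≤ |lift (ω i) (j * s + u) - lift (ω i) (j * s)|} with hD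
  set K : ℕ → Set (Fin k → AgentSpace n) := fun j => {ω | ∃ f : Fin (m + 1) → Fin k,
    Function.Injective f ∧ ∀ l : Fin m, (ω (f l.castSucc), ω (f l.succ)) ∈ A j} with hK
  have hsub : {ω | ∀ i, i ∈ green (trajs c k ω) (J * s)} ⊆
      (⋃ j ∈ Finset.range J, (D j ∪ K j)) ∪
        {ω | ∀ i, i ≠ o → G.dist (trajs c k ω o 0) (trajs c k ω i (J * s)) ≤
          J * ((2 * m + 1) * d)} := by
    intro ω hω
    rw [Set.mem_union, or_iff_not_imp_left]
    intro hgood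
    simp only [Set.mem_iUnion, Set.mem_union, not_exists, not_or, Finset.mem_range] at hgood
    -- The front advances by at most `(2 * m + 1) * d` per window. If all are green at time `J * s`,
    -- all lie in one ball that each agent hits with probability at most `1 / 2`.
    have key : ∀ j ≤ J, ∀ i ∈ green (trajs c k ω) (j * s),
        G.dist (trajs c k ω o 0) (trajs c k ω i (j * s)) ≤ j * ((2 * m + 1) * d) := by
      intro j hj
      induction j with
      | zero =>
        intro i hi
        have := dist_le_of_mem_green (X := trajs c k ω) c.connected
          (fun i t => c.dist_traj_succ_le (ω i) t) ho hi
        rw [zero_mul] at this ⊢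
        rwa [zero_mul]
      | succ j ih =>
        obtain ⟨h1, h2⟩ := hgood j (by omega)
        simp only [hD, Set.mem_ofPred_eq, not_exists (p := fun i : Fin k => ∃ u ≤ s, _)] at h1
        have := dist_le_of_no_chain c.connected (X := trajs c k ω) (t := j * s) (u := (j + 1) * s)
          (d := d) (m := m) (x := trajs c k ω o 0) (R := j * ((2 * m + 1) * d))
          (by rw [add_mul]; omega) (fun i v hv1 hv2 =>
            dist_traj_le_of_not_displaced c (h1 i) hv1 (by rw [add_mul, one_mul] at hv2; omega))
          (fun f hf => ?_) (ih (by omega))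
        · intro i hi
          refine (this i hi).trans (le_of_eq ?_)
          ring
        · by_contra hcon
          push Not at hcon
          exact h2 ⟨f, hf, hcon⟩
    exact fun i _ => key J le_rfl i (hω i)
  refine (measureReal_mono hsub (measure_ne_top _ _)).trans ((measureReal_union_le _ _).trans
    (add_le_add ?_ (allAgents_real_all_close_le c _ hR)))
  refine (measureReal_biUnion_finset_le _ _).trans ?_
  refine (Finset.sum_le_card_nsmul _ _ _ fun j _ => ?_).trans
    (le_of_eq (by rw [nsmul_eq_mul, Finset.card_range]))
  refine (measureReal_union_le _ _).trans (add_le_add (allAgents_real_exists_displaced_le _ hs)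
    (pi_real_exists_chain_le (measurableSet_dist c (j * s) (j * s) (2 * d)) (by positivity)
      (fun x => ?_) m))
  refine (c.agentMeasure_real_dist_le (j * s) (c.traj x (j * s)) (2 * d)).trans (le_of_eq ?_)
  push_cast
  ring

end LowerBounds

/-! ### Choice of parameters in each regime. -/

section Asymptotics

/-- With probability at least `1 - ε`, somebody is still white at time `t`. -/
def NotAllGreenAt (n k t : ℕ) (ε : ℝ) : Prop :=
  ∀ (_ : NeZero n) (G : SimpleGraph (Fin n)) (c : LineCover G),
    (allAgents n k).real {ω | ∀ i, i ∈ green (trajs c k ω) t} ≤ ε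

/-- With probability at least `1 - ε`, everybody is green at time `t`. -/
def AllGreenAt (n k t : ℕ) (ε : ℝ) : Prop :=
  ∀ (_ : NeZero n) (G : SimpleGraph (Fin n)) (c : LineCover G),
    (allAgents n k).real {ω | ¬ ∀ i, i ∈ green (trajs c k ω) t} ≤ ε

/-- The failure probability of an event tends to `0`, in the model with covers. -/
def FailsRarely (G : (n : ℕ) → SimpleGraph (Fin n)) (k : ℕ → ℕ) (E : ℕ → ℕ∞ → Prop) : Prop :=
  ∀ ε > 0, ∀ᶠ n in atTop, ∀ _ : NeZero n, ∀ c : LineCover (G n),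
    (allAgents n (k n)).real {ω | ¬ E n (broadcastTime (trajs c (k n) ω))} ≤ ε

variable {G : (n : ℕ) → SimpleGraph (Fin n)} {k : ℕ → ℕ}

theorem FailsRarely.and {E F : ℕ → ℕ∞ → Prop} (hE : FailsRarely G k E) (hF : FailsRarely G k F) :
    FailsRarely G k fun n ξ => E n ξ ∧ F n ξ := by
  intro ε hε
  filter_upwards [hE (ε / 2) (by positivity), hF (ε / 2) (by positivity)] with n h1 h2 hn c
  have hsub : {ω | ¬ (E n (broadcastTime (trajs c (k n) ω)) ∧
      F n (broadcastTime (trajs c (k n) ω)))} ⊆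
      {ω | ¬ E n (broadcastTime (trajs c (k n) ω))} ∪
        {ω | ¬ F n (broadcastTime (trajs c (k n) ω))} := fun ω hω => not_and_or.1 hω
  have := (measureReal_mono hsub).trans (measureReal_union_le (μ := allAgents n (k n)) _ _)
  linarith [h1 hn c, h2 hn c]

theorem FailsRarely.mono {E F : ℕ → ℕ∞ → Prop} (hE : FailsRarely G k E)
    (h : ∀ᶠ n in atTop, ∀ ξ, E n ξ → F n ξ) : FailsRarely G k F := by
  intro ε hε
  filter_upwards [hE ε hε, h] with n h1 h2 hn c
  refine (measureReal_mono ?_).trans (h1 hn c)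
  intro ω hω hE
  exact hω (h2 _ hE)

/-- The condition `P n` is deterministic and is tested separately for each `n`, so `k` may switch
regimes infinitely often. -/
theorem failsRarely_between {P : ℕ → Prop} {a b : ℕ → ℝ}
    (hl : ∀ ε > 0, ∀ᶠ n in atTop, P n → ∃ t : ℕ, a n ≤ t + 1 ∧ NotAllGreenAt n (k n) t ε)
    (hu : ∀ ε > 0, ∀ᶠ n in atTop, P n → ∃ u : ℕ, (u : ℝ) ≤ b n ∧ AllGreenAt n (k n) u ε) :
    FailsRarely G k fun n ξ => P n → Between (a n) ξ (b n) := by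
  intro ε hε
  filter_upwards [hl (ε / 2) (by positivity), hu (ε / 2) (by positivity)] with n h1 h2 hn c
  by_cases hP : P n
  · obtain ⟨t, hat, ht⟩ := h1 hP
    obtain ⟨u, hbu, hu⟩ := h2 hP
    have hsub : {ω | ¬ (P n → Between (a n) (broadcastTime (trajs c (k n) ω)) (b n))} ⊆
        {ω | ∀ i, i ∈ green (trajs c (k n) ω) t} ∪
          {ω | ¬ ∀ i, i ∈ green (trajs c (k n) ω) u} := by
      intro ω hω
      by_contra hcon
      rw [Set.mem_union, not_or] at hcon
      obtain ⟨h3, h4⟩ := hcon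
      simp only [Set.mem_ofPred_eq, not_forall] at h3
      obtain ⟨i, hi⟩ := h3
      exact hω fun _ => between_broadcastTime hat hi (not_not.1 h4) hbu
    have := (measureReal_mono hsub).trans (measureReal_union_le (μ := allAgents n (k n)) _ _)
    linarith [ht hn _ c, hu hn _ c]
  · simp [hP, hε.le]

theorem one_sub_pow_le_exp {p : ℝ} (hp0 : 0 ≤ p) (hp : p ≤ 1) {k : ℕ} (hk : 2 ≤ k) :
    (1 - p) ^ (k - 1) ≤ Real.exp (-(p * k / 2)) := by
  have h1 : (1 - p) ^ (k - 1) ≤ Real.exp (-p) ^ (k - 1) :=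
    pow_le_pow_left₀ (by linarith) (Real.one_sub_le_exp_neg p) _
  refine h1.trans ?_
  rw [← Real.exp_nat_mul]
  refine Real.exp_le_exp.2 ?_
  have h2 : ((k - 1 : ℕ) : ℝ) = k - 1 := by
    rw [Nat.cast_sub (by omega)]
    simp
  have h3 : (2 : ℝ) ≤ k := by exact_mod_cast hk
  rw [h2]
  nlinarith

theorem exists_zigzag_parameter {ε : ℝ} (hε : 0 < ε) :
    ∃ m : ℕ, 0 < m ∧ 2 * Real.exp (-((m : ℝ) / 544)) ≤ ε := by
  have h1 : Tendsto (fun m : ℕ => 2 * Real.exp (-((m : ℝ) / 544))) atTop (𝓝 (2 * 0)) :=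
    (Real.tendsto_exp_neg_atTop_nhds_zero.comp
      (tendsto_natCast_atTop_atTop.atTop_div_const (by norm_num))).const_mul 2
  rw [mul_zero] at h1
  obtain ⟨m, hm1, hm2⟩ := ((h1.eventually_le_const hε).and (eventually_gt_atTop 0)).exists
  exact ⟨m, hm2, hm1⟩

/-- Upper bound for a bounded number of agents. -/
theorem eventually_allGreenAt_of_le {ω : ℕ → ℝ} (hω : Tendsto ω atTop atTop) (hk : ∀ n, 2 ≤ k n)
    {ε : ℝ} (hε : 0 < ε) : ∀ᶠ n in atTop, (k n : ℝ) ≤ ω n →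
      ∃ u : ℕ, (u : ℝ) ≤ (n : ℝ) ^ 2 * ω n ∧ AllGreenAt n (k n) u ε := by
  -- Blocks of length at most `16 * (2 * n) ^ 2 = 64 * n ^ 2` fit `M` times into `n ^ 2 * ω n`, and
  -- `k < 64 * (M + 1)` is beaten by `(29 / 32) ^ M`.
  have hM : Tendsto (fun n => ⌊ω n / 64⌋₊) atTop atTop :=
    tendsto_nat_floor_atTop.comp (hω.atTop_div_const (by norm_num))
  have hlim : Tendsto (fun M : ℕ => 64 * ((M : ℝ) * (29 / 32) ^ M) + 64 * (29 / 32 : ℝ) ^ M) atTop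
      (𝓝 (64 * 0 + 64 * 0)) :=
    ((tendsto_self_mul_const_pow_of_lt_one (by norm_num) (by norm_num)).const_mul 64).add
      ((tendsto_pow_atTop_nhds_zero_of_lt_one (by norm_num) (by norm_num)).const_mul 64)
  rw [mul_zero, add_zero] at hlim
  filter_upwards [(hlim.comp hM).eventually_le_const hε, hω.eventually_ge_atTop 0] with n h1 h2 hkω
  simp only [Function.comp_apply] at h1
  set M := ⌊ω n / 64⌋₊
  refine ⟨M * (16 * (2 * n) ^ 2), ?_, fun hn G c => ?_⟩
  · have h3 : (M : ℝ) ≤ ω n / 64 := Nat.floor_le (by positivity)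
    push_cast
    nlinarith [sq_nonneg (n : ℝ)]
  · have hk0 : 0 < k n := by have := hk n; omega
    have h3 := allAgents_real_not_all_met_le c (k := k n) (o := ⟨0, hk0⟩) rfl M
    refine (measureReal_mono ?_).trans (h3.trans ?_)
    · intro x hx hall
      refine hx fun i => green_mono ?_ (hall i)
      have := c.period_le
      gcongr
    · have h4 : ω n / 64 < M + 1 := Nat.lt_floor_add_one _
      have h5 : (k n : ℝ) ≤ 64 * M + 64 := by linarith
      calc (k n : ℝ) * (29 / 32) ^ M ≤ (64 * M + 64) * (29 / 32) ^ M := by gcongr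
        _ ≤ ε := by linarith

/-- Upper bound for a number of agents tending to infinity. -/
theorem eventually_allGreenAt_of_lt {ω : ℕ → ℝ} (hω : Tendsto ω atTop atTop) (hk : ∀ n, 2 ≤ k n)
    {ε : ℝ} (hε : 0 < ε) : ∀ᶠ n in atTop, ω n < (k n : ℝ) →
      ∃ u : ℕ, (u : ℝ) ≤ (n : ℝ) ^ 2 * ω n ∧ AllGreenAt n (k n) u ε := by
  obtain ⟨m, hm0, hm⟩ := exists_zigzag_parameter (half_pos hε)
  set ρ : ℝ := 1 - 1 / 2 * (1 / 16) ^ (17 * m) with hρ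
  have hρ1 : ρ < 1 := by
    have : (0 : ℝ) < 1 / 2 * (1 / 16) ^ (17 * m) := by positivity
    linarith
  have hρ0 : 0 ≤ ρ := by
    have : (1 / 16 : ℝ) ^ (17 * m) ≤ 1 := pow_le_one₀ (by norm_num) (by norm_num)
    linarith
  obtain ⟨K, hK⟩ := exists_pow_lt_of_lt_one (half_pos hε) hρ1
  filter_upwards [hω.eventually_ge_atTop (K + 1), hω.eventually_ge_atTop (272 * m),
    eventually_gt_atTop 0] with n h1 h2 hn0 hlt
  -- With `L = n` and `J = 0` the first green interval already covers a period. As `m` depends on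
  -- `ε` only, `272 * m` is eventually below `ω n`.
  refine ⟨(17 * m + 0) * (16 * n ^ 2), ?_, fun hn G c => ?_⟩
  · push_cast
    nlinarith [sq_nonneg (n : ℝ)]
  · have hk0 : 0 < k n := by have := hk n; omega
    refine (allAgents_real_not_all_green_le c (k := k n) (o := ⟨0, hk0⟩) rfl (J := 0) hn0 le_rfl hm0
      (by omega)).trans ?_
    have hn' : (0 : ℝ) < n := by exact_mod_cast hn0
    have e : (n : ℝ) / (2 * n) = 1 / 2 := by field_simp
    rw [e, ← hρ]
    have hKk : K ≤ k n - 1 := by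
      have : (K : ℝ) + 1 < k n := h1.trans_lt hlt
      have : K + 1 < k n := by exact_mod_cast this
      omega
    have h3 : ρ ^ (k n - 1) ≤ ρ ^ K := pow_le_pow_of_le_one hρ0 hρ1.le hKk
    simp only [Nat.cast_zero, mul_zero, zero_mul, add_zero]
    linarith

/-- Upper bound through the expansion of intervals of length `L`. -/
theorem exists_eventually_allGreenAt {ε : ℝ} (hε : 0 < ε) : ∃ m : ℕ, ∀ᶠ n : ℕ in atTop,
    ∀ k L : ℕ, 2 ≤ k → 0 < L → 272 * m * L ≤ n → 128 * n * Real.log n ≤ (k : ℝ) * L →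
      ∃ u : ℕ, (u : ℝ) ≤ 33 * n * L ∧ AllGreenAt n k u ε := by
  obtain ⟨m, hm0, hm⟩ := exists_zigzag_parameter (ε := ε / 3) (by positivity)
  refine ⟨m, ?_⟩
  set η : ℝ := (1 / 16) ^ (17 * m) with hη
  have hη0 : 0 < η := by positivity
  have hη1 : η ≤ 1 := pow_le_one₀ (by norm_num) (by norm_num)
  have hlog : Tendsto (fun n : ℕ => Real.log n) atTop atTop :=
    Real.tendsto_log_atTop.comp tendsto_natCast_atTop_atTop
  have hlim1 : Tendsto (fun n : ℕ => Real.exp (-(32 * η * Real.log n))) atTop (𝓝 0) :=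
    Real.tendsto_exp_neg_atTop_nhds_zero.comp (hlog.const_mul_atTop (by positivity))
  have hlim2 : Tendsto (fun n : ℕ => 8 / (n : ℝ)) atTop (𝓝 0) :=
    tendsto_const_div_atTop_nhds_zero_nat 8
  filter_upwards [hlim1.eventually_le_const (show 0 < ε / 3 by positivity),
    hlim2.eventually_le_const (show 0 < ε / 3 by positivity), eventually_gt_atTop 0]
    with n h1 h2 hn0 k L hk hL hLn hkL
  have hn' : (0 : ℝ) < n := by exact_mod_cast hn0
  have hL' : (0 : ℝ) < L := by exact_mod_cast hL
  have hLn' : L ≤ n := by nlinarith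
  have hLn'' : (L : ℝ) ≤ n := by exact_mod_cast hLn'
  have hJL : 2 * n / L * L ≤ 2 * n := Nat.div_mul_le_self _ _
  have hJn : 2 * n / L ≤ 2 * n := Nat.div_le_self _ _
  -- The `17 * m` creation stages cost at most `n * L`, by `272 * m * L ≤ n`, and the `J` growth
  -- stages at most `32 * n * L`.
  set J := 2 * n / L with hJ
  have hJL' : (J : ℝ) * L ≤ 2 * n := by exact_mod_cast hJL
  have hJn' : (J : ℝ) ≤ 2 * n := by exact_mod_cast hJn
  refine ⟨(17 * m + J) * (16 * L ^ 2), ?_, fun hn G c => ?_⟩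
  · have h3 : (272 : ℝ) * m * L ≤ n := by exact_mod_cast hLn
    push_cast
    calc ((17 : ℝ) * m + J) * (16 * L ^ 2) = 272 * m * L * L + 16 * (J * L) * L := by ring
      _ ≤ n * L + 16 * (2 * n) * L := by gcongr
      _ = 33 * n * L := by ring
  · have hk0 : 0 < k := by omega
    refine (allAgents_real_not_all_green_le c (o := ⟨0, hk0⟩) rfl (J := J) hL hLn' hm0 ?_).trans ?_
    · have := Nat.lt_div_mul_add hL (a := 2 * n)
      rw [← hJ] at this
      nlinarith
    · have hLn2 : (L : ℝ) / (2 * n) ≤ 1 / 2 := by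
        rw [div_le_div_iff₀ (by positivity) (by norm_num)]
        linarith
      have hLn0 : 0 ≤ (L : ℝ) / (2 * n) := by positivity
      -- After the factor `3 / 32` and the halving in `one_sub_pow_le_exp` this leaves `3 * log n`:
      -- failure `n ^ (-3)` against at most `8 * n ^ 2` terms.
      have hmain : 64 * Real.log n ≤ (L : ℝ) / (2 * n) * k := by
        rw [div_mul_eq_mul_div, le_div_iff₀ (by positivity)]
        linarith
      have e1 : (1 - (L : ℝ) / (2 * n) * η) ^ (k - 1) ≤ ε / 3 := by
        refine (one_sub_pow_le_exp (by positivity) (by nlinarith) hk).trans (le_trans ?_ h1)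
        refine Real.exp_le_exp.2 (neg_le_neg ?_)
        nlinarith
      have e2 : (1 - (L : ℝ) / (2 * n) * (3 / 32)) ^ (k - 1) ≤ ((n : ℝ) ^ 3)⁻¹ := by
        refine (one_sub_pow_le_exp (by positivity) (by linarith) hk).trans ?_
        rw [← Real.exp_log (show (0 : ℝ) < ((n : ℝ) ^ 3)⁻¹ by positivity), Real.log_inv,
          Real.log_pow]
        refine Real.exp_le_exp.2 (neg_le_neg ?_)
        push_cast
        nlinarith
      have e3 : 4 * J * n * (1 - (L : ℝ) / (2 * n) * (3 / 32)) ^ (k - 1) ≤ ε / 3 := by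
        refine le_trans ?_ h2
        calc 4 * J * n * (1 - (L : ℝ) / (2 * n) * (3 / 32)) ^ (k - 1)
            ≤ 4 * J * n * ((n : ℝ) ^ 3)⁻¹ := mul_le_mul_of_nonneg_left e2 (by positivity)
          _ ≤ 4 * (2 * n) * n * ((n : ℝ) ^ 3)⁻¹ := by gcongr
          _ = 8 / n := by field_simp; norm_num
      linarith

/-- Upper bound for an intermediate number of agents. -/
theorem exists_eventually_allGreenAt_of_le {ε : ℝ} (hε : 0 < ε) : ∃ W : ℝ, ∀ᶠ n : ℕ in atTop,
    ∀ k : ℕ, 2 ≤ k → W * Real.log n ≤ k → (k : ℝ) ≤ 50 * n * Real.log n →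
      ∃ u : ℕ, (u : ℝ) ≤ 8448 * ((n : ℝ) ^ 2 * Real.log n / k) ∧ AllGreenAt n k u ε := by
  obtain ⟨m, hm⟩ := exists_eventually_allGreenAt hε
  refine ⟨69632 * m, ?_⟩
  filter_upwards [hm, eventually_ge_atTop 3] with n h hn k hk h1 h2
  have hn' : (0 : ℝ) < n := by positivity
  have hk' : (0 : ℝ) < k := by positivity
  have hlog : 0 < Real.log n := Real.log_pos (by exact_mod_cast (by omega : 1 < n))
  -- The smallest stage length allowed by `128 * n * log n ≤ k * L`. Since `k ≤ 50 * n * log n` it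
  -- is at least 1, so rounding up at most doubles it, and `33 * 2 * 128 = 8448`.
  set x : ℝ := 128 * n * Real.log n / k with hx
  have hxk : x * k = 128 * n * Real.log n := div_mul_cancel₀ _ hk'.ne'
  have hx1 : 1 ≤ x := by
    rw [hx, le_div_iff₀ hk']
    linarith
  have hL1 : x ≤ ⌈x⌉₊ := Nat.le_ceil x
  have hL2 : (⌈x⌉₊ : ℝ) ≤ 2 * x := by linarith [Nat.ceil_lt_add_one (show 0 ≤ x by linarith)]
  have hA : 272 * m * ⌈x⌉₊ ≤ n := by
    have h3 : 272 * (m : ℝ) * ⌈x⌉₊ ≤ n := by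
      refine le_of_mul_le_mul_right ?_ hk'
      calc 272 * (m : ℝ) * ⌈x⌉₊ * k ≤ 272 * m * (2 * x) * k := by gcongr
        _ = 544 * m * (x * k) := by ring
        _ = n * (69632 * m * Real.log n) := by rw [hxk]; ring
        _ ≤ n * k := by gcongr
    exact_mod_cast h3
  have hB : 128 * (n : ℝ) * Real.log n ≤ k * (⌈x⌉₊ : ℝ) := by
    rw [← hxk, mul_comm]
    exact mul_le_mul_of_nonneg_left hL1 hk'.le
  obtain ⟨u, hu, hu'⟩ := h k ⌈x⌉₊ hk (Nat.ceil_pos.2 (by linarith)) hA hB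
  refine ⟨u, hu.trans ?_, hu'⟩
  calc 33 * (n : ℝ) * ⌈x⌉₊ ≤ 33 * n * (2 * x) := by gcongr
    _ = 8448 * ((n : ℝ) ^ 2 * Real.log n / k) := by rw [hx]; ring

/-- Lower bound when the initial green agent remains isolated. -/
theorem eventually_notAllGreenAt_of_isolated {ω : ℕ → ℝ} (hω : Tendsto ω atTop atTop)
    (hk : ∀ n, 2 ≤ k n) {ε : ℝ} (hε : 0 < ε) : ∀ᶠ n : ℕ in atTop, ∀ κ : ℝ, ω n ≤ κ →
      (k n : ℝ) ≤ κ → ∃ t : ℕ, (n : ℝ) ^ 2 / (ω n * κ ^ 2 * Real.log κ) ≤ t + 1 ∧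
        NotAllGreenAt n (k n) t ε := by
  have hlim : Tendsto (fun n => 2 / ω n + 18 / √(ω n)) atTop (𝓝 (0 + 0)) :=
    (hω.const_div_atTop 2).add ((Real.tendsto_sqrt_atTop.comp hω).const_div_atTop 18)
  rw [add_zero] at hlim
  have hlim2 : Tendsto (fun n : ℕ => 2 / (n : ℝ)) atTop (𝓝 0) :=
    tendsto_const_div_atTop_nhds_zero_nat 2
  filter_upwards [hlim.eventually_le_const hε, hlim2.eventually_le_const hε,
    hω.eventually_ge_atTop 3, eventually_gt_atTop 0] with n h1 h2 h3 hn0 κ hκω hκk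
  have hn' : (0 : ℝ) < n := by exact_mod_cast hn0
  have hk2 := hk n
  have hω0 : 0 < ω n := by linarith
  have hκ0 : 0 < κ := by linarith
  have hlog : 1 ≤ Real.log κ := by
    rw [Real.le_log_iff_exp_le hκ0]
    linarith [Real.exp_one_lt_d9]
  set T : ℝ := (n : ℝ) ^ 2 / (ω n * κ ^ 2 * Real.log κ) with hT
  have hT0 : 0 < T := by positivity
  obtain ⟨t, ht⟩ : ∃ t, ⌈T⌉₊ = t + 1 := Nat.exists_eq_succ_of_ne_zero (Nat.ceil_pos.2 hT0).ne'
  have htT : T ≤ t + 1 := by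
    have := Nat.le_ceil T
    rw [ht] at this
    exact_mod_cast this
  have htT' : (t : ℝ) < T := by
    rw [← Nat.lt_ceil, ht]
    omega
  refine ⟨t, htT, fun hn G c => ?_⟩
  set o : Fin (k n) := ⟨0, by omega⟩
  set i : Fin (k n) := ⟨1, by omega⟩
  have hio : i ≠ o := by simp [i, o]
  rcases Nat.eq_zero_or_pos t with rfl | htpos
  · refine le_trans ?_ h2
    refine (measureReal_mono ?_).trans
      (allAgents_real_all_green_zero_le c (o := o) (i := i) rfl hio)
    intro x hx
    exact hx i
  -- This `D` balances the two failures: `D ^ 2 = 4 * T * log κ` bounds each agent's escape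
  -- probability by `2 / κ ^ 2`, while `κ * D / n` is only `2 / √(ω n)`.
  · set D : ℝ := 2 * n / (κ * √(ω n)) with hD
    have hs0 : 0 < √(ω n) := Real.sqrt_pos.2 hω0
    have hss : √(ω n) ^ 2 = ω n := Real.sq_sqrt hω0.le
    have hD0 : 0 < D := by positivity
    have hd1 : (⌊D⌋₊ : ℝ) ≤ D := Nat.floor_le hD0.le
    have hd2 : D ≤ ⌊D⌋₊ + 1 := (Nat.lt_floor_add_one D).le
    have ht0 : (0 : ℝ) < t := by exact_mod_cast htpos
    refine le_trans ?_ h1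
    refine (measureReal_mono ?_).trans
      ((allAgents_real_exists_green_le c (o := o) rfl (s := t) (d := ⌊D⌋₊) htpos).trans ?_)
    · intro x hx
      exact ⟨i, hio, hx i⟩
    · have hT1 : 1 ≤ T := by
        have : (1 : ℝ) ≤ t := by exact_mod_cast htpos
        linarith
      have hTlog : D ^ 2 = 4 * (T * Real.log κ) := by
        rw [hD, hT, div_pow, mul_pow, mul_pow, hss]
        field_simp
        norm_num
      have e1 : 2 * Real.log κ ≤ ((⌊D⌋₊ : ℝ) + 1) ^ 2 / (2 * t) := by
        rw [le_div_iff₀ (by positivity)]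
        calc 2 * Real.log κ * (2 * t) = 4 * (t * Real.log κ) := by ring
          _ ≤ 4 * (T * Real.log κ) := by gcongr
          _ = D ^ 2 := hTlog.symm
          _ ≤ _ := by gcongr
      have e2 : Real.exp (-(((⌊D⌋₊ : ℝ) + 1) ^ 2 / (2 * t))) ≤ (κ ^ 2)⁻¹ := by
        rw [← Real.exp_log (show (0 : ℝ) < (κ ^ 2)⁻¹ by positivity), Real.log_inv, Real.log_pow]
        exact Real.exp_le_exp.2 (neg_le_neg (by exact_mod_cast e1))
      have e3 : (k n : ℝ) * (2 * Real.exp (-(((⌊D⌋₊ : ℝ) + 1) ^ 2 / (2 * t)))) ≤ 2 / ω n := by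
        calc _ ≤ κ * (2 * (κ ^ 2)⁻¹) := by gcongr
          _ = 2 / κ := by field_simp
          _ ≤ 2 / ω n := by gcongr
      -- Here `1 ≤ T` enters, as `ω n * κ ^ 2 * log κ ≤ n ^ 2`; this is why `t = 0` is treated
      -- apart.
      have e4 : κ / n ≤ 1 / √(ω n) := by
        rw [div_le_div_iff₀ hn' hs0, one_mul]
        refine le_of_sq_le_sq ?_ hn'.le
        rw [mul_pow, hss]
        rw [hT, one_le_div (by positivity)] at hT1
        nlinarith [mul_le_mul_of_nonneg_left hlog (show 0 ≤ ω n * κ ^ 2 by positivity)]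
      have e5 : (k n : ℝ) * (2 * (4 * ⌊D⌋₊ + 1) / n) ≤ 18 / √(ω n) := by
        calc (k n : ℝ) * (2 * (4 * ⌊D⌋₊ + 1) / n) ≤ κ * (2 * (4 * D + 1) / n) := by gcongr
          _ = 8 * D * κ / n + 2 * (κ / n) := by ring
          _ = 16 / √(ω n) + 2 * (κ / n) := by
              congr 1
              rw [hD]
              field_simp
              norm_num
          _ ≤ 16 / √(ω n) + 2 * (1 / √(ω n)) := by gcongr
          _ = 18 / √(ω n) := by ring
      linarith

/-- Linear lower bound for many agents. -/
theorem exists_eventually_notAllGreenAt_linear {ε : ℝ} (hε : 0 < ε) : ∃ K : ℕ,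
    ∀ᶠ n : ℕ in atTop, ∀ k : ℕ, K ≤ k → NotAllGreenAt n k (n / 32) ε := by
  obtain ⟨K, hK⟩ := exists_pow_lt_of_lt_one hε (show (1 / 2 : ℝ) < 1 by norm_num)
  refine ⟨K + 1, ?_⟩
  filter_upwards [eventually_ge_atTop 8] with n hn8 k hk hn G c
  have hk0 : 0 < k := by omega
  refine (allAgents_real_all_green_le c (o := ⟨0, hk0⟩) rfl ?_).trans
    ((pow_le_pow_of_le_one (by norm_num) (by norm_num) (by omega)).trans hK.le)
  have hn' : (8 : ℝ) ≤ n := by exact_mod_cast hn8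
  have h1 : ((n / 32 : ℕ) : ℝ) ≤ n / 32 := Nat.cast_div_le
  rw [div_le_div_iff₀ (by linarith) (by norm_num)]
  linarith

/-- Lower bound in the sparse regime. -/
theorem exists_eventually_notAllGreenAt_sparse {ε : ℝ} (hε : 0 < ε) : ∃ K : ℝ,
    ∀ᶠ n : ℕ in atTop, ∀ k : ℕ, K ≤ k → (k : ℝ) ≤ n / Real.log n ^ 2 →
      ∃ t : ℕ, 1 / 400000 * ((n : ℝ) ^ 2 / (k * Real.log k * Real.log n)) ≤ t ∧
        NotAllGreenAt n k t ε := by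
  have hlim : Tendsto (fun x : ℝ => 3 / x) atTop (𝓝 0) := tendsto_id.const_div_atTop 3
  have hlogo : ∀ᶠ x : ℝ in atTop, 3 * Real.log x ≤ x := by
    have := Real.isLittleO_log_id_atTop.bound (show (0 : ℝ) < 1 / 3 by norm_num)
    filter_upwards [this, eventually_ge_atTop 1] with x hx hx1
    rw [Real.norm_eq_abs, abs_of_nonneg (Real.log_nonneg hx1), id, Real.norm_eq_abs,
      abs_of_nonneg (by linarith)] at hx
    linarith
  obtain ⟨K', hK'⟩ := exists_pow_lt_of_lt_one (half_pos hε) (show (1 / 2 : ℝ) < 1 by norm_num)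
  obtain ⟨K, hK⟩ := eventually_atTop.1 (((hlim.eventually_le_const (half_pos hε)).and hlogo).and
    ((eventually_ge_atTop (K' + 1 : ℝ)).and (eventually_ge_atTop 3)))
  have hlogn : Tendsto (fun n : ℕ => Real.log n) atTop atTop :=
    Real.tendsto_log_atTop.comp tendsto_natCast_atTop_atTop
  refine ⟨K, ?_⟩
  filter_upwards [hlogn.eventually_ge_atTop 32, eventually_ge_atTop 8] with n hln hn8 k hKk hkn
  obtain ⟨⟨hk3, hklog⟩, hkK', hk3'⟩ := hK k hKk
  have hn' : (8 : ℝ) ≤ n := by exact_mod_cast hn8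
  have hk0 : (0 : ℝ) < k := by linarith
  set l := Real.log k with hl
  have hl1 : 1 ≤ l := by
    rw [hl, Real.le_log_iff_exp_le hk0]
    linarith [Real.exp_one_lt_d9]
  have hkn' : (k : ℝ) * Real.log n ^ 2 ≤ n := (le_div_iff₀ (by positivity)).1 hkn
  have hlln : l ≤ Real.log n := by
    refine Real.log_le_log hk0 ?_
    have : (1 : ℝ) ≤ Real.log n ^ 2 := one_le_pow₀ (by linarith)
    nlinarith
  -- Window length `S`, displacement `D`, number of windows `Y`. `D` makes `k * q` at most `1 / 4`;
  -- `8 * l * S = D ^ 2` makes escapes cost `k ^ (-4)`; chains of `m ≈ 4 * l` links cost the same.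
  -- `Y` keeps the total advance `11 * l * D * Y` below `n / 16`.
  set S : ℝ := (n : ℝ) ^ 2 / (32768 * k ^ 2 * l) with hS
  set D : ℝ := n / (64 * k) with hD
  set Y : ℝ := k / (3 * l) with hY
  have hS1 : 1 ≤ S := by
    rw [hS, one_le_div (by positivity)]
    calc 32768 * (k : ℝ) ^ 2 * l ≤ 32 ^ 3 * k ^ 2 * Real.log n := by
          norm_num
          gcongr
      _ ≤ Real.log n ^ 3 * k ^ 2 * Real.log n := by gcongr
      _ = (k * Real.log n ^ 2) ^ 2 := by ring
      _ ≤ n ^ 2 := by gcongr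
  have hY1 : 1 ≤ Y := by
    rw [hY, one_le_div (by positivity)]
    exact hklog
  have hs1 : (⌊S⌋₊ : ℝ) ≤ S := Nat.floor_le (by linarith)
  have hs2 : S / 2 ≤ ⌊S⌋₊ := by
    have h1 := Nat.lt_floor_add_one S
    have h2 : (1 : ℝ) ≤ ⌊S⌋₊ := by exact_mod_cast Nat.floor_pos.2 hS1
    linarith
  have hJ1 : (⌊Y⌋₊ : ℝ) ≤ Y := Nat.floor_le (by linarith)
  have hJ2 : Y / 2 ≤ ⌊Y⌋₊ := by
    have h1 := Nat.lt_floor_add_one Y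
    have h2 : (1 : ℝ) ≤ ⌊Y⌋₊ := by exact_mod_cast Nat.floor_pos.2 hY1
    linarith
  have hd1 : (⌊D⌋₊ : ℝ) ≤ D := Nat.floor_le (by positivity)
  have hd2 : D ≤ ⌊D⌋₊ + 1 := (Nat.lt_floor_add_one D).le
  have hm1 : 4 * l ≤ ⌈4 * l⌉₊ := Nat.le_ceil _
  have hm2 : (⌈4 * l⌉₊ : ℝ) ≤ 4 * l + 1 := (Nat.ceil_lt_add_one (by positivity)).le
  set s := ⌊S⌋₊ with hs
  set d := ⌊D⌋₊ with hd
  set J := ⌊Y⌋₊ with hJ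
  set m := ⌈4 * l⌉₊ with hm
  have hspos : 0 < s := Nat.floor_pos.2 hS1
  have hspos' : (0 : ℝ) < s := by exact_mod_cast hspos
  refine ⟨J * s, ?_, fun hn G c => ?_⟩
  · push_cast
    -- `393216 = 4 * 3 * 32768`, with the 4 from rounding `S` and `Y` down. One factor `log k` is
    -- given away to `log n`.
    calc 1 / 400000 * ((n : ℝ) ^ 2 / (k * l * Real.log n))
        ≤ 1 / 393216 * ((n : ℝ) ^ 2 / (k * l * l)) := by gcongr; norm_num
      _ = Y / 2 * (S / 2) := by rw [hY, hS]; field_simp; norm_num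
      _ ≤ J * s := by gcongr
  · have hkpos : 0 < k := by exact_mod_cast hk0
    refine (allAgents_real_all_green_windows_le c (o := ⟨0, hkpos⟩) rfl (d := d) (m := m) (J := J)
      hspos ?_).trans ?_
    · have hR : ((J * ((2 * m + 1) * d) : ℕ) : ℝ) ≤ n / 16 := by
        push_cast
        calc (J : ℝ) * ((2 * m + 1) * d) ≤ Y * ((2 * (4 * l + 1) + 1) * D) := by gcongr
          _ ≤ Y * ((11 * l) * D) := by
              have : 2 * (4 * l + 1) + 1 ≤ 11 * l := by linarith
              gcongr
          _ = 11 / 192 * n := by rw [hY, hD]; field_simp; norm_num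
          _ ≤ n / 16 := by linarith
      rw [div_le_div_iff₀ (by linarith) (by norm_num)]
      linarith
    · have hk4 : Real.exp (-(4 * l)) = ((k : ℝ) ^ 4)⁻¹ := by
        rw [Real.exp_neg, show 4 * l = ((4 : ℕ) : ℝ) * l by norm_num, Real.exp_nat_mul, hl,
          Real.exp_log hk0]
      have e1 : Real.exp (-(((d : ℝ) + 1) ^ 2 / (2 * s))) ≤ ((k : ℝ) ^ 4)⁻¹ := by
        rw [← hk4]
        refine Real.exp_le_exp.2 (neg_le_neg ?_)
        rw [le_div_iff₀ (by positivity)]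
        calc 4 * l * (2 * s) ≤ 4 * l * (2 * S) := by gcongr
          _ = D ^ 2 := by rw [hS, hD]; field_simp; norm_num
          _ ≤ _ := by gcongr
      have e2 : (k : ℝ) * (2 * (4 * d + 1) / n) ≤ 1 / 4 := by
        have h1 : (k : ℝ) * 32 ^ 2 ≤ n := le_trans (by gcongr) hkn'
        calc (k : ℝ) * (2 * (4 * d + 1) / n) ≤ k * (2 * (4 * D + 1) / n) := by gcongr
          _ = 1 / 8 + 2 * k / n := by rw [hD]; field_simp; ring
          _ ≤ 1 / 8 + 1 / 8 := by
              refine add_le_add_right ?_ _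
              rw [div_le_div_iff₀ (by linarith) (by norm_num)]
              linarith
          _ = 1 / 4 := by norm_num
      have e3 : ((k : ℝ) * (2 * (4 * d + 1) / n)) ^ m ≤ ((k : ℝ) ^ 4)⁻¹ := by
        calc ((k : ℝ) * (2 * (4 * d + 1) / n)) ^ m ≤ (1 / 4) ^ m := by gcongr
          _ ≤ Real.exp (-1) ^ m := by
              have : (1 / 4 : ℝ) ≤ Real.exp (-1) := by
                rw [Real.exp_neg, one_div]
                exact inv_anti₀ (Real.exp_pos 1) (by linarith [Real.exp_one_lt_d9])
              gcongr
          _ = Real.exp (-m) := by rw [← Real.exp_nat_mul]; simp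
          _ ≤ Real.exp (-(4 * l)) := Real.exp_le_exp.2 (neg_le_neg hm1)
          _ = _ := hk4
      have hYk : Y ≤ k := by
        rw [hY, div_le_iff₀ (by positivity)]
        nlinarith
      have e4 : (J : ℝ) * (k * (2 * Real.exp (-(((d : ℝ) + 1) ^ 2 / (2 * s)))) +
          k * (k * (2 * (4 * d + 1) / n)) ^ m) ≤ 3 / k := by
        calc _ ≤ (k : ℝ) * (k * (2 * ((k : ℝ) ^ 4)⁻¹) + k * ((k : ℝ) ^ 4)⁻¹) := by
              have : J ≤ k := by exact_mod_cast hJ1.trans hYk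
              gcongr
          _ = 3 / (k : ℝ) ^ 2 := by field_simp; norm_num
          _ ≤ 3 / k := by
              gcongr
              nlinarith
      have e5 : (1 / 2 : ℝ) ^ (k - 1) ≤ (1 / 2) ^ K' := by
        refine pow_le_pow_of_le_one (by norm_num) (by norm_num) ?_
        have : K' + 1 ≤ k := by exact_mod_cast hkK'
        omega
      linarith

end Asymptotics


/-! ### Assembling the regimes. -/

variable {G : (n : ℕ) → SimpleGraph (Fin n)} {k : ℕ → ℕ}

theorem Between.mono {a b a' b' : ℝ} {ξ : ℕ∞} (h : Between a ξ b) (ha : a' ≤ a) (hb : b ≤ b') :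
    Between a' ξ b' := by
  obtain ⟨t, ht, h1, h2⟩ := h
  exact ⟨t, ht, ha.trans h1, h2.trans hb⟩

theorem FailsRarely.aas (hG : G = SimpleGraph.pathGraph ∨ G = SimpleGraph.cycleGraph)
    {E : ℕ → ℕ∞ → Prop} (h : FailsRarely G k E) : AAS G k E :=
  aas_of_forall hG h

theorem tendsto_log_natCast : Tendsto (fun n : ℕ => Real.log n) atTop atTop :=
  Real.tendsto_log_atTop.comp tendsto_natCast_atTop_atTop

theorem tendsto_natCast_div_log_pow (p : ℕ) :
    Tendsto (fun n : ℕ => (n : ℝ) / Real.log n ^ p) atTop atTop := by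
  have h1 : Tendsto (fun n : ℕ => Real.log n ^ p / (n : ℝ)) atTop (𝓝 0) := by
    have := (Real.isLittleO_pow_log_id_atTop (n := p)).tendsto_div_nhds_zero.comp
      (tendsto_natCast_atTop_atTop (R := ℝ))
    exact this
  refine ((tendsto_inv_nhdsGT_zero.comp (tendsto_nhdsWithin_iff.2 ⟨h1, ?_⟩))).congr fun n => ?_
  · filter_upwards [tendsto_log_natCast.eventually_gt_atTop 0, eventually_gt_atTop 0] with n h h'
    exact div_pos (pow_pos h _) (by exact_mod_cast h')
  · simp

/-- Very few agents. -/
theorem failsRarely_of_le {ω : ℕ → ℝ} (hω : Tendsto ω atTop atTop) (hk : ∀ n, 2 ≤ k n) :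
    FailsRarely G k fun n ξ => (k n : ℝ) ≤ ω n →
      Between ((n : ℝ) ^ 2 / (ω n ^ 3 * Real.log (ω n))) ξ ((n : ℝ) ^ 2 * ω n) := by
  refine failsRarely_between (fun ε hε => ?_) fun ε hε => eventually_allGreenAt_of_le hω hk hε
  filter_upwards [eventually_notAllGreenAt_of_isolated hω hk hε] with n h hkn
  obtain ⟨t, ht, h'⟩ := h (ω n) le_rfl hkn
  exact ⟨t, by rwa [pow_succ' (ω n) 2], h'⟩

/-- Few agents. -/
theorem failsRarely_of_lt {ω : ℕ → ℝ} (hω : Tendsto ω atTop atTop) (hk : ∀ n, 2 ≤ k n) :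
    FailsRarely G k fun n ξ => ω n < (k n : ℝ) →
      Between ((n : ℝ) ^ 2 / (ω n * (k n : ℝ) ^ 2 * Real.log (k n))) ξ ((n : ℝ) ^ 2 * ω n) := by
  refine failsRarely_between (fun ε hε => ?_) fun ε hε => eventually_allGreenAt_of_lt hω hk hε
  filter_upwards [eventually_notAllGreenAt_of_isolated hω hk hε] with n h hkn
  exact h (k n) hkn.le le_rfl

/-- An intermediate number of agents. -/
theorem failsRarely_of_le_div_log_sq {ω : ℕ → ℝ} (hω : Tendsto ω atTop atTop)
    (hk : ∀ n, 2 ≤ k n) :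
    FailsRarely G k fun n ξ =>
      ω n * Real.log n < (k n : ℝ) ∧ (k n : ℝ) ≤ n / Real.log n ^ 2 →
      Between (1 / 400000 * ((n : ℝ) ^ 2 / (k n * Real.log (k n) * Real.log n))) ξ
        (8448 * ((n : ℝ) ^ 2 * Real.log n / k n)) := by
  refine failsRarely_between (fun ε hε => ?_) fun ε hε => ?_
  · obtain ⟨K, hK⟩ := exists_eventually_notAllGreenAt_sparse hε
    filter_upwards [hK, hω.eventually_ge_atTop (max K 0),
      tendsto_log_natCast.eventually_ge_atTop 1] with n h h1 h2 ⟨h3, h4⟩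
    obtain ⟨t, ht, h'⟩ := h (k n) (by nlinarith [le_max_left K 0, le_max_right K 0]) h4
    exact ⟨t, by linarith, h'⟩
  · obtain ⟨W, hW⟩ := exists_eventually_allGreenAt_of_le hε
    filter_upwards [hW, hω.eventually_ge_atTop W,
      tendsto_log_natCast.eventually_ge_atTop 1] with n h h1 h2 ⟨h3, h4⟩
    refine h (k n) (hk n) (le_trans (by gcongr) h3.le) (h4.trans ?_)
    have hn : (0 : ℝ) ≤ n := n.cast_nonneg
    calc (n : ℝ) / Real.log n ^ 2 ≤ n := div_le_self hn (one_le_pow₀ h2)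
      _ ≤ 50 * n * Real.log n := by nlinarith

theorem mul_le_div_add_one {c : ℝ} (hc : c ≤ 1 / 32) (n : ℕ) :
    c * n ≤ ((n / 32 : ℕ) : ℝ) + 1 := by
  have h : (n : ℝ) ≤ 32 * ((n / 32 : ℕ) : ℝ) + 32 := by
    exact_mod_cast (by omega : n ≤ 32 * (n / 32) + 32)
  nlinarith [(n.cast_nonneg : (0 : ℝ) ≤ n)]

/-- Many agents. -/
theorem failsRarely_of_div_log_sq_lt (hk : ∀ n, 2 ≤ k n) :
    FailsRarely G k fun n ξ =>
      (n : ℝ) / Real.log n ^ 2 < k n ∧ (k n : ℝ) ≤ 50 * n * Real.log n →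
      Between (1 / 400000 * n) ξ (8448 * ((n : ℝ) ^ 2 * Real.log n / k n)) := by
  refine failsRarely_between (fun ε hε => ?_) fun ε hε => ?_
  · obtain ⟨K, hK⟩ := exists_eventually_notAllGreenAt_linear hε
    filter_upwards [hK, (tendsto_natCast_div_log_pow 2).eventually_ge_atTop (K : ℝ)]
      with n h h1 ⟨h3, h4⟩
    exact ⟨n / 32, mul_le_div_add_one (by norm_num) n,
      h (k n) (by exact_mod_cast h1.trans h3.le)⟩
  · obtain ⟨W, hW⟩ := exists_eventually_allGreenAt_of_le hε
    filter_upwards [hW, (tendsto_natCast_div_log_pow 3).eventually_ge_atTop W,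
      tendsto_log_natCast.eventually_ge_atTop 1] with n h h1 h2 ⟨h3, h4⟩
    refine h (k n) (hk n) (le_trans ?_ h3.le) h4
    calc W * Real.log n ≤ n / Real.log n ^ 3 * Real.log n := by gcongr
      _ = n / Real.log n ^ 2 := by field_simp

/-- Very many agents. -/
theorem failsRarely_of_ge (hk : ∀ n, 2 ≤ k n) :
    FailsRarely G k fun n ξ => 50 * (n : ℝ) * Real.log n ≤ k n →
      Between (1 / 400000 * n) ξ (8448 * n) := by
  refine failsRarely_between (fun ε hε => ?_) fun ε hε => ?_
  · obtain ⟨K, hK⟩ := exists_eventually_notAllGreenAt_linear hε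
    filter_upwards [hK, eventually_ge_atTop K,
      tendsto_log_natCast.eventually_ge_atTop 1] with n h h1 h2 h3
    refine ⟨n / 32, mul_le_div_add_one (by norm_num) n, h (k n) ?_⟩
    have : (n : ℝ) ≤ k n := by nlinarith [(n.cast_nonneg : (0 : ℝ) ≤ n)]
    exact h1.trans (by exact_mod_cast this)
  · obtain ⟨m, hm⟩ := exists_eventually_allGreenAt hε
    filter_upwards [hm, eventually_ge_atTop (816 * m),
      tendsto_log_natCast.eventually_ge_atTop 0] with n h h1 h2 h3
    have hn : (0 : ℝ) ≤ n := n.cast_nonneg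
    -- A constant stage length suffices, since `128 ≤ 3 * 50`; the time is `33 * 3 * n ≤ 8448 * n`,
    -- and `816 = 272 * 3`.
    obtain ⟨u, hu, h'⟩ := h (k n) 3 (hk n) (by norm_num) (by omega)
      (by push_cast; nlinarith [mul_nonneg hn h2])
    exact ⟨u, hu.trans (by push_cast; nlinarith), h'⟩

/-- If the number of agents is `n ^ (x + ε n)`, the broadcasting time is `n ^ 2 / k` up to a factor
`n ^ |ε n| * log n ^ 6`. -/
theorem failsRarely_of_eq_rpow (hk : ∀ n, 2 ≤ k n) {x : ℝ} (hx : x ≤ 1) {ε : ℕ → ℝ}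
    (hε : Tendsto ε atTop (𝓝 0)) (hkx : ∀ᶠ n in atTop, (k n : ℝ) = (n : ℝ) ^ (x + ε n)) :
    FailsRarely G k fun n ξ =>
      Between ((n : ℝ) ^ 2 / (k n * ((n : ℝ) ^ |ε n| * Real.log n ^ 6))) ξ
        ((n : ℝ) ^ 2 * ((n : ℝ) ^ |ε n| * Real.log n ^ 6) / k n) := by
  -- With so slow an `ω`, the bounds of the first four regimes are within `log n ^ 6` of `n ^ 2 /
  -- k`.
  have hω : Tendsto (fun n : ℕ => Real.log (Real.log n)) atTop atTop :=
    Real.tendsto_log_atTop.comp tendsto_log_natCast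
  refine (((failsRarely_of_le hω hk).and ((failsRarely_of_lt hω hk).and
    ((failsRarely_of_le_div_log_sq hω hk).and ((failsRarely_of_div_log_sq_lt hk).and
      (failsRarely_of_ge hk)))))).mono ?_
  filter_upwards [hkx, hω.eventually_ge_atTop 1, tendsto_log_natCast.eventually_ge_atTop 800000,
    eventually_ge_atTop 1, (hε.abs.eventually_le_const (by simp : |(0 : ℝ)| < 1))]
    with n hkn hω1 hL hn1 hε1 ξ ⟨ha, hb, hc, hd, he⟩
  have hn : (1 : ℝ) ≤ n := by exact_mod_cast hn1
  have hk2 : (2 : ℝ) ≤ k n := by exact_mod_cast hk n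
  have hk0 : (0 : ℝ) < k n := by linarith
  -- Needed with very many agents, where the time is of order `n` instead of `n ^ 2 / k`: `k`
  -- exceeds `n` by a factor of at most `n ^ |ε n|`.
  have hkε : (k n : ℝ) ≤ n * (n : ℝ) ^ |ε n| := by
    rw [hkn, ← Real.rpow_one_add' (by linarith) (by positivity)]
    exact Real.rpow_le_rpow_of_exponent_le hn (by linarith [le_abs_self (ε n)])
  have hlogk : Real.log (k n) ≤ 2 * Real.log n := by
    rw [hkn, Real.log_rpow (by linarith)]
    gcongr
    linarith [le_abs_self (ε n)]
  have hlogk0 : 0 < Real.log (k n) := Real.log_pos (by linarith)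
  have hpow : 1 ≤ (n : ℝ) ^ |ε n| := Real.one_le_rpow hn (abs_nonneg _)
  have hωL : Real.log (Real.log n) ≤ Real.log n := by
    linarith [Real.log_le_sub_one_of_pos (show 0 < Real.log n by linarith)]
  set p : ℝ := (n : ℝ) ^ |ε n|
  set w : ℝ := Real.log (Real.log n)
  set L : ℝ := Real.log n
  have hwlog : Real.log w ≤ L := by
    linarith [Real.log_le_sub_one_of_pos (show 0 < w by linarith)]
  have hwlog0 : 0 ≤ Real.log w := Real.log_nonneg hω1
  have hF : L ^ 6 ≤ p * L ^ 6 := le_mul_of_one_le_left (by positivity) hpow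
  have hF1 : 1 ≤ p * L ^ 6 := (one_le_pow₀ (by linarith)).trans hF
  have hlow : ∀ D : ℝ, 0 < D → D ≤ k n * L ^ 6 →
      (n : ℝ) ^ 2 / (k n * (p * L ^ 6)) ≤ (n : ℝ) ^ 2 / D := fun D hD h =>
    div_le_div_of_nonneg_left (by positivity) hD (h.trans (by gcongr))
  have hlin : (n : ℝ) / L ^ 2 < k n → (n : ℝ) ^ 2 / (k n * (p * L ^ 6)) ≤ 1 / 400000 * n := by
    intro h
    rw [div_lt_iff₀ (by positivity)] at h
    rw [div_le_iff₀ (by positivity)]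
    have : 400000 * L ^ 2 ≤ p * L ^ 6 := by
      refine le_trans ?_ hF
      calc 400000 * L ^ 2 ≤ L ^ 4 * L ^ 2 := by
            gcongr
            exact le_trans (by linarith) (le_self_pow₀ (by linarith : 1 ≤ L) (by norm_num))
        _ = L ^ 6 := by ring
    calc (n : ℝ) ^ 2 = 1 / 400000 * n * (400000 * n) := by ring
      _ ≤ 1 / 400000 * n * (400000 * (k n * L ^ 2)) := by gcongr
      _ = 1 / 400000 * n * (k n * (400000 * L ^ 2)) := by ring
      _ ≤ _ := by gcongr
  have hupp : ∀ u : ℝ, k n * u ≤ L ^ 6 → (n : ℝ) ^ 2 * u ≤ (n : ℝ) ^ 2 * (p * L ^ 6) / k n := by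
    intro u hu
    rw [le_div_iff₀ hk0, mul_assoc, mul_comm u]
    exact mul_le_mul_of_nonneg_left (hu.trans hF) (by positivity)
  have hmid : 8448 * ((n : ℝ) ^ 2 * L / k n) ≤ (n : ℝ) ^ 2 * (p * L ^ 6) / k n := by
    rw [← mul_div_assoc]
    refine div_le_div_of_nonneg_right ?_ hk0.le
    calc 8448 * ((n : ℝ) ^ 2 * L) = (n : ℝ) ^ 2 * (8448 * L) := by ring
      _ ≤ (n : ℝ) ^ 2 * L ^ 6 := by
        gcongr
        calc 8448 * L ≤ L ^ 5 * L := by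
              gcongr
              exact le_trans (by linarith) (le_self_pow₀ (by linarith : 1 ≤ L) (by norm_num))
          _ = L ^ 6 := by ring
      _ ≤ _ := by gcongr
  rcases le_or_gt (k n : ℝ) w with h1 | h1
  · have hlogw : 0 < Real.log w := Real.log_pos (by linarith)
    refine (ha h1).mono (hlow _ (by positivity) ?_) (hupp _ ?_)
    · calc w ^ 3 * Real.log w ≤ L ^ 3 * L := by gcongr
        _ ≤ L ^ 6 := by
          rw [← pow_succ]
          exact pow_le_pow_right₀ (by linarith) (by norm_num)
        _ ≤ k n * L ^ 6 := le_mul_of_one_le_left (by positivity) (by linarith)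
    · calc (k n : ℝ) * w ≤ L * L := by gcongr; linarith
        _ = L ^ 2 := by ring
        _ ≤ L ^ 6 := pow_le_pow_right₀ (by linarith) (by norm_num)
  rcases le_or_gt (k n : ℝ) (w * L) with h2 | h2
  · have h2' : (k n : ℝ) ≤ L * L := h2.trans (by gcongr)
    refine (hb h1).mono (hlow _ (by positivity) ?_) (hupp _ ?_)
    · calc w * (k n : ℝ) ^ 2 * Real.log (k n) = k n * (w * k n * Real.log (k n)) := by ring
        _ ≤ k n * (L * (L * L) * (L * L)) := by
          gcongr
          nlinarith
        _ = k n * L ^ 5 := by ring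
        _ ≤ k n * L ^ 6 := by
          gcongr
          exacts [by linarith, by norm_num]
    · calc (k n : ℝ) * w ≤ L * L * L := by gcongr
        _ = L ^ 3 := by ring
        _ ≤ L ^ 6 := pow_le_pow_right₀ (by linarith) (by norm_num)
  rcases le_or_gt (k n : ℝ) (n / L ^ 2) with h3 | h3
  · refine (hc ⟨h2, h3⟩).mono ?_ hmid
    rw [one_div_mul_eq_div, div_div]
    refine hlow _ (by positivity) ?_
    calc k n * Real.log (k n) * L * 400000 = k n * (Real.log (k n) * L * 400000) := by ring
      _ ≤ k n * (2 * L * L * 400000) := by gcongr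
      _ = k n * (800000 * L ^ 2) := by ring
      _ ≤ k n * (L ^ 4 * L ^ 2) := by
        gcongr
        exact le_trans hL (le_self_pow₀ (by linarith : 1 ≤ L) (by norm_num))
      _ = k n * L ^ 6 := by ring
  rcases le_or_gt (k n : ℝ) (50 * n * L) with h4 | h4
  · exact (hd ⟨h3, h4⟩).mono (hlin h3) hmid
  · refine (he h4.le).mono (hlin h3) ?_
    rw [le_div_iff₀ hk0]
    calc 8448 * (n : ℝ) * k n ≤ L ^ 6 * n * (n * p) := by
          gcongr
          exact le_trans (by linarith) (le_self_pow₀ (by linarith : 1 ≤ L) (by norm_num))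
      _ = _ := by ring

/-- If the number of agents is `n ^ (x + o(1))`, the broadcasting time is `n ^ (2 - x + o(1))`. -/
theorem exists_failsRarely_of_eq_rpow (hk : ∀ n, 2 ≤ k n) {x : ℝ} (hx : x ≤ 1) {ε : ℕ → ℝ}
    (hε : Tendsto ε atTop (𝓝 0)) (hkx : ∀ᶠ n in atTop, (k n : ℝ) = (n : ℝ) ^ (x + ε n)) :
    ∃ δ : ℕ → ℝ, Tendsto δ atTop (𝓝 0) ∧
      FailsRarely G k fun n ξ =>
        Between ((n : ℝ) ^ (2 - δ n) / k n) ξ ((n : ℝ) ^ (2 + δ n) / k n) ∧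
        Between ((n : ℝ) ^ (2 - x - δ n)) ξ ((n : ℝ) ^ (2 - x + δ n)) := by
  have hlog : Tendsto (fun n : ℕ => Real.log (Real.log n) / Real.log n) atTop (𝓝 0) := by
    have := Real.isLittleO_log_id_atTop.tendsto_div_nhds_zero.comp tendsto_log_natCast
    exact this
  -- The first two terms are the exponent of `n ^ |ε n| * log n ^ 6`; the second `|ε n|` pays for
  -- replacing `k` by `n ^ x`.
  refine ⟨fun n => |ε n| + 6 * (Real.log (Real.log n) / Real.log n) + |ε n|, ?_,
    (failsRarely_of_eq_rpow hk hx hε hkx).mono ?_⟩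
  · simpa using (hε.abs.add (hlog.const_mul 6)).add hε.abs
  filter_upwards [hkx, tendsto_log_natCast.eventually_ge_atTop 1, eventually_ge_atTop 1]
    with n hkn hL hn1 ξ h
  have hn : (1 : ℝ) ≤ n := by exact_mod_cast hn1
  have hn0 : (0 : ℝ) < n := by linarith
  have hk0 : (0 : ℝ) < k n := by
    have := hk n
    exact_mod_cast (by omega : 0 < k n)
  set d : ℝ := |ε n| + 6 * (Real.log (Real.log n) / Real.log n) with hd
  have hF : (n : ℝ) ^ |ε n| * Real.log n ^ 6 = (n : ℝ) ^ d := by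
    rw [hd, Real.rpow_add hn0]
    congr 1
    rw [Real.rpow_def_of_pos hn0, show Real.log n * (6 * (Real.log (Real.log n) / Real.log n))
      = (6 : ℕ) * Real.log (Real.log n) by push_cast; field_simp, Real.exp_nat_mul,
      Real.exp_log (by linarith)]
  have hsq : (n : ℝ) ^ 2 = (n : ℝ) ^ (2 : ℝ) := by norm_cast
  have hε' := neg_abs_le (ε n)
  have hε'' := le_abs_self (ε n)
  rw [hF, hsq] at h
  have hlow : (n : ℝ) ^ (2 : ℝ) / (k n * (n : ℝ) ^ d) = (n : ℝ) ^ (2 - d) / k n := by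
    rw [Real.rpow_sub hn0, div_div, mul_comm]
  have hupp : (n : ℝ) ^ (2 : ℝ) * (n : ℝ) ^ d / k n = (n : ℝ) ^ (2 + d) / k n := by
    rw [Real.rpow_add hn0 2 d]
  rw [hlow, hupp] at h
  refine ⟨h.mono ?_ ?_, h.mono ?_ ?_⟩
  · exact div_le_div_of_nonneg_right
      (Real.rpow_le_rpow_of_exponent_le hn (by linarith [abs_nonneg (ε n)])) hk0.le
  · exact div_le_div_of_nonneg_right
      (Real.rpow_le_rpow_of_exponent_le hn (by linarith [abs_nonneg (ε n)])) hk0.le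
  · rw [hkn, ← Real.rpow_sub hn0]
    exact Real.rpow_le_rpow_of_exponent_le hn (by linarith)
  · rw [hkn, ← Real.rpow_sub hn0]
    exact Real.rpow_le_rpow_of_exponent_le hn (by linarith)

end Broadcast

end

theorem theorem1 :
    ∃ c C : ℝ, 0 < c ∧ 0 < C ∧
      ∀ G : (n : ℕ) → SimpleGraph (Fin n),
        (G = SimpleGraph.pathGraph ∨ G = SimpleGraph.cycleGraph) →
      ∀ k : ℕ → ℕ, (∀ n, 2 ≤ k n) →
        (∀ ω : ℕ → ℝ, Tendsto ω atTop atTop →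
          -- (a)
          Broadcast.AAS G k (fun n ξ => (k n : ℝ) ≤ ω n →
            Broadcast.Between ((n : ℝ) ^ 2 / (ω n ^ 3 * Real.log (ω n))) ξ
              ((n : ℝ) ^ 2 * ω n)) ∧
          -- (b)
          Broadcast.AAS G k (fun n ξ =>
            ω n < (k n : ℝ) → (k n : ℝ) ≤ ω n * Real.log n →
            Broadcast.Between ((n : ℝ) ^ 2 / (ω n * (k n : ℝ) ^ 2 * Real.log (k n))) ξ
              ((n : ℝ) ^ 2 * ω n)) ∧
          -- (c)
          Broadcast.AAS G k (fun n ξ =>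
            ω n * Real.log n < (k n : ℝ) → (k n : ℝ) ≤ n / Real.log n ^ 2 →
            Broadcast.Between (c * ((n : ℝ) ^ 2 / (k n * Real.log (k n) * Real.log n))) ξ
              (C * ((n : ℝ) ^ 2 * Real.log n / k n)))) ∧
        -- (d)
        Broadcast.AAS G k (fun n ξ =>
          (n : ℝ) / Real.log n ^ 2 < k n → (k n : ℝ) ≤ 50 * n * Real.log n →
          Broadcast.Between (c * n) ξ (C * ((n : ℝ) ^ 2 * Real.log n / k n))) ∧
        -- (e)
        Broadcast.AAS G k (fun n ξ =>
          50 * (n : ℝ) * Real.log n ≤ k n → Broadcast.Between (c * n) ξ (C * n)) ∧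
        -- in any case
        (∀ x : ℝ, 0 ≤ x → x ≤ 1 →
          ∀ ε : ℕ → ℝ, Tendsto ε atTop (𝓝 0) →
            (∀ᶠ n in atTop, (k n : ℝ) = (n : ℝ) ^ (x + ε n)) →
          ∃ δ : ℕ → ℝ, Tendsto δ atTop (𝓝 0) ∧
            Broadcast.AAS G k (fun n ξ =>
              Broadcast.Between ((n : ℝ) ^ (2 - δ n) / k n) ξ ((n : ℝ) ^ (2 + δ n) / k n) ∧
              Broadcast.Between ((n : ℝ) ^ (2 - x - δ n)) ξ ((n : ℝ) ^ (2 - x + δ n)))) := by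
  refine ⟨1 / 400000, 8448, by norm_num, by norm_num, fun G hG k hk => ⟨fun ω hω => ⟨?_, ?_, ?_⟩,
    ?_, ?_, fun x _ hx ε hε hkx => ?_⟩⟩
  · exact Broadcast.FailsRarely.aas hG (Broadcast.failsRarely_of_le hω hk)
  · exact Broadcast.FailsRarely.aas hG ((Broadcast.failsRarely_of_lt hω hk).mono
      (.of_forall fun n ξ h h1 _ => h h1))
  · exact Broadcast.FailsRarely.aas hG ((Broadcast.failsRarely_of_le_div_log_sq hω hk).mono
      (.of_forall fun n ξ h h1 h2 => h ⟨h1, h2⟩))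
  · exact Broadcast.FailsRarely.aas hG ((Broadcast.failsRarely_of_div_log_sq_lt hk).mono
      (.of_forall fun n ξ h h1 h2 => h ⟨h1, h2⟩))
  · exact Broadcast.FailsRarely.aas hG (Broadcast.failsRarely_of_ge hk)
  · obtain ⟨δ, hδ, h⟩ := Broadcast.exists_failsRarely_of_eq_rpow (G := G) hk hx hε hkx
    exact ⟨δ, hδ, h.aas hG⟩
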